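/- **Theorem (staircase laminate criterion).** Let $K\subset\mathbb{R}^{d\times m}$ be any set, $U\subset\mathbb{R}^{d\times m}$ open, and $1<p<\infty$; $|X|$ is the Euclidean norm of a matrix. *Laminates.* A probability measure $\mu$ arises from $\nu$ by an elementary splitting with construction step in $U$ if $\nu=\lambda\delta_X+(1-\lambda)\tilde\nu$ and $\mu=\lambda(\lambda'\delta_B+(1-\lambda')\delta_{B'})+(1-\lambda)\tilde\nu$ with $\tilde\nu$ a probability measure, $\lambda\in(0,1]$, $\lambda'\in(0,1)$, $X\in U$, $X=\lambda'B+(1-\lambda')B'$ and $\operatorname{rank}(B'-B)=1$. A laminate of finite order with construction steps in $U$ starting from $\delta_A$ is a measure obtained from $\delta_A$ by finitely many such splittings. A staircase laminate supported on $K$ with construction steps in $U$, starting from $X_0\notin K$, is a probability measure $\nu^\infty$ for which there are pairwise different matrices $X_n\notin K$ $(n\ge0)$, finitely supported probability measures $\mu_n$ on $K$ and $\gamma_n\in(0,1)$ $(n\ge1)$ such that $\omega_n=(1-\gamma_n)\mu_n+\gamma_n\delta_{X_n}$ is a laminate of finite order with construction steps in $U$ starting from $\delta_{X_{n-1}}$,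 $|X_n|$ increases strictly to $\infty$, $\beta_n=\prod_{k\le n}\gamma_k\to0$, and $$\nu^\infty(E)=\lim_{N\to\infty}\Big(\sum_{n=1}^N\beta_{n-1}(1-\gamma_n)\mu_n+\beta_N\delta_{X_N}\Big)(E)\quad\text{for every Borel set }E.$$ It has barycenter $X_0$ if $\int|X|\,d\nu^\infty<\infty$ and $\int X\,d\nu^\infty(X)=X_0$. *Reducibility.* A regular domain is a nonempty bounded connected open set $\Omega\subset\mathbb{R}^m$ with $|\partial\Omega|=0$. A map $w\in W^{1,1}(\Omega,\mathbb{R}^d)$ is piecewise affine if $\Omega$ is, up to a null set, an at most countable disjoint union of regular domains on each of which $w$ is affine. $U$ can be $U$-reduced to $K$ in weak $L^p$ if there is $M'\ge1$ such that for all $X_0\in U$, $b\in\mathbb{R}^d$, $\varepsilon,\alpha\in(0,1)$, $q\in(1,\infty)$ and every regular domain $\Omega$ there is a piecewise affine $w\in W^{1,1}(\Omega,\mathbb{R}^d)\cap C^\alpha(\overline\Omega,\mathbb{R}^d)$ with $w(x)=X_0x+b$ on $\partial\Omega$, $$|\{x\in\Omega:|\nabla w(x)|>t\}|\le M'^p(1+|X_0|^p)\,|\Omega|\,t^{-p}\quad\text{for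 all }t>0,$$ and, for $\Omega_{err}=\{x\in\Omega:\nabla w(x)\notin K\}$, $\nabla w\in U$ a.e. in $\Omega_{err}$ and $\int_{\Omega_{err}}(1+|\nabla w|)^q\,dx<\varepsilon|\Omega|$. The reduction is exact if there is also $m'>0$, independent of $X_0,b,\varepsilon,\alpha,q,\Omega$, such that $w$ can be chosen to satisfy in addition $$|\{x\in\Omega:|\nabla w(x)|>t\}|\ge m'^p\,|\Omega|\,t^{-p}\quad\text{for all }t>1.$$ *Claim.* Let $M\ge1$ and $c>0$. Suppose that for every $X_0\in U$ there is a staircase laminate $\nu_{X_0}^\infty$ supported on $K$ with construction steps in $U$, starting from $X_0$ and with barycenter $X_0$, such that $$\nu_{X_0}^\infty(\{X:|X|>t\})\le M^p(1+|X_0|^p)\,t^{-p}\quad\text{for all }t>0.$$ Then $U$ can be $U$-reduced to $K$ in weak $L^p$. If these laminates can be chosen so that, in addition, $$\nu_{X_0}^\infty(\{X:|X|>t\})\ge c^p\,t^{-p}\quad\text{for all }t>1,$$ then $U$ can be $U$-reduced to $K$ exactly in weak $L^p$. -/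

import Mathlib

open MeasureTheory Filter Topology
open scoped ContDiff

namespace StaircaseLaminate

/-- Euclidean space. -/
abbrev Euc (n : ℕ) : Type := EuclideanSpace ℝ (Fin n)

/-- The space `ℝ^{d × m}` of real matrices with the Euclidean (Frobenius) norm; the `(i, j)` entry
of `X` is `X (i, j)`. -/
abbrev Mat (d m : ℕ) : Type := EuclideanSpace ℝ (Fin d × Fin m)

/-- The matrix with the entries of `X`. -/
def toMatrix {d m : ℕ} (X : Mat d m) : Matrix (Fin d) (Fin m) ℝ :=
  Matrix.of fun i j => X (i, j)

/-! ### Laminates -/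

/-- `μ` is obtained from `ν` by an elementary splitting with construction step in `U`: a portion
`lam` of the mass, sitting at a point `X ∈ U`, is split along the rank-one segment `[B, B']`. -/
def ElementarySplitting {d m : ℕ} (U : Set (Mat d m)) (ν μ : Measure (Mat d m)) : Prop :=
  ∃ (lam lam' : ℝ) (X B B' : Mat d m) (ρ : Measure (Mat d m)),
    lam ∈ Set.Ioc (0 : ℝ) 1 ∧ lam' ∈ Set.Ioo (0 : ℝ) 1 ∧ IsProbabilityMeasure ρ ∧
    X ∈ U ∧ X = lam' • B + (1 - lam') • B' ∧ (toMatrix (B' - B)).rank = 1 ∧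
    ν = ENNReal.ofReal lam • Measure.dirac X + ENNReal.ofReal (1 - lam) • ρ ∧
    μ = ENNReal.ofReal lam •
          (ENNReal.ofReal lam' • Measure.dirac B + ENNReal.ofReal (1 - lam') • Measure.dirac B') +
        ENNReal.ofReal (1 - lam) • ρ

/-- `FiniteLaminate U A ν`: `ν` is a laminate of finite order, obtained from the Dirac mass at `A`
by finitely many elementary splittings, each of them with construction step in `U`.
(The barycenter of such a `ν` is `A`.) -/
inductive FiniteLaminate {d m : ℕ} (U : Set (Mat d m)) (A : Mat d m) : Measure (Mat d m) → Prop
  | dirac : FiniteLaminate U A (Measure.dirac A)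
  | split {ν μ : Measure (Mat d m)} :
      FiniteLaminate U A ν → ElementarySplitting U ν μ → FiniteLaminate U A μ

/-- `μ` is a probability measure which is a finite combination of Dirac masses at points of `K`. -/
def IsFiniteAtomic {d m : ℕ} (K : Set (Mat d m)) (μ : Measure (Mat d m)) : Prop :=
  ∃ (S : Finset (Mat d m)) (c : Mat d m → ℝ),
    (S : Set (Mat d m)) ⊆ K ∧ (∀ Y ∈ S, 0 ≤ c Y) ∧ ∑ Y ∈ S, c Y = 1 ∧
    μ = ∑ Y ∈ S, ENNReal.ofReal (c Y) • Measure.dirac Y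

/-- The measure `ω = (1 - γ) μ + γ δ_X`. -/
noncomputable def stepMeasure {d m : ℕ} (γ : ℝ) (μ : Measure (Mat d m)) (X : Mat d m) :
    Measure (Mat d m) :=
  ENNReal.ofReal (1 - γ) • μ + ENNReal.ofReal γ • Measure.dirac X

/-- `β_n = γ_1 ⋯ γ_n`, where `γ k` stands for `γ_{k+1}`. -/
noncomputable def stairWeight (γ : ℕ → ℝ) (n : ℕ) : ℝ := ∏ k ∈ Finset.range n, γ k

/-- The measure `ν^N = ∑_{n=1}^N β_{n-1} (1 - γ_n) μ_n + β_N δ_{X_N}`, where `γ n`, `μ n` stand for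
`γ_{n+1}`, `μ_{n+1}`. -/
noncomputable def stairMeasure {d m : ℕ} (X : ℕ → Mat d m) (μ : ℕ → Measure (Mat d m))
    (γ : ℕ → ℝ) (N : ℕ) : Measure (Mat d m) :=
  (∑ n ∈ Finset.range N, ENNReal.ofReal (stairWeight γ n * (1 - γ n)) • μ n) +
    ENNReal.ofReal (stairWeight γ N) • Measure.dirac (X N)

/-- `ν` is a staircase laminate supported on `K`, starting at `X₀`, with construction steps in `U`.
The soaring sequence is `X 0 = X₀, X 1, X 2, …`; the data `μ n`, `γ n` of the `(n+1)`-st step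
(from `X n` to `X (n + 1)`) are written `μ_{n+1}`, `γ_{n+1}` on paper. -/
def IsStaircaseLaminate {d m : ℕ} (K U : Set (Mat d m)) (X₀ : Mat d m)
    (ν : Measure (Mat d m)) : Prop :=
  ∃ (X : ℕ → Mat d m) (μ : ℕ → Measure (Mat d m)) (γ : ℕ → ℝ),
    X 0 = X₀ ∧ Function.Injective X ∧ (∀ n, X n ∉ K) ∧
    (∀ n, IsFiniteAtomic K (μ n)) ∧ (∀ n, γ n ∈ Set.Ioo (0 : ℝ) 1) ∧
    (∀ n, FiniteLaminate U (X n) (stepMeasure (γ n) (μ n) (X (n + 1)))) ∧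
    StrictMono (fun n => ‖X n‖) ∧ Tendsto (fun n => ‖X n‖) atTop atTop ∧
    Tendsto (stairWeight γ) atTop (𝓝 0) ∧
    ∀ E : Set (Mat d m), MeasurableSet E →
      Tendsto (fun N => stairMeasure X μ γ N E) atTop (𝓝 (ν E))

/-- `X` is the barycenter `∫ Y dν(Y)` of `ν`; the first moment is required to be finite. -/
def HasBarycenter {d m : ℕ} (ν : Measure (Mat d m)) (X : Mat d m) : Prop :=
  Integrable (fun Y : Mat d m => Y) ν ∧ ∫ Y, Y ∂ν = X

/-! ### Domains and maps -/

/-- Open, bounded, connected (and nonempty), with Lebesgue-null boundary. -/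
structure IsRegularDomain {m : ℕ} (Ω : Set (Euc m)) : Prop where
  isOpen : IsOpen Ω
  isBounded : Bornology.IsBounded Ω
  isConnected : IsConnected Ω
  volume_frontier : volume (frontier Ω) = 0

/-- The affine map `x ↦ X x + b`. -/
noncomputable def affineFun {d m : ℕ} (X : Mat d m) (b : Euc d) (x : Euc m) : Euc d :=
  WithLp.toLp 2 ((toMatrix X).mulVec x.ofLp) + b

/-- `w ∈ W^{1,1}(Ω; ℝ^d)` with weak gradient `G`, i.e. `w` and `G` are integrable on `Ω` and
`∫_Ω w_i ∂_j φ = - ∫_Ω G_{ij} φ` for all test functions `φ ∈ C_c^∞(Ω)`. -/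
structure IsW11WithGradient {d m : ℕ} (Ω : Set (Euc m)) (w : Euc m → Euc d)
    (G : Euc m → Mat d m) : Prop where
  integrableOn : IntegrableOn w Ω volume
  integrableOn_grad : IntegrableOn G Ω volume
  integral_eq : ∀ φ : Euc m → ℝ, ContDiff ℝ ∞ φ → HasCompactSupport φ → tsupport φ ⊆ Ω →
    ∀ (i : Fin d) (j : Fin m),
      ∫ x in Ω, w x i * fderiv ℝ φ x (EuclideanSpace.single j 1) = - ∫ x in Ω, G x (i, j) * φ x

/-- Up to a null set, `Ω` is an at most countable union of pairwise disjoint regular domains on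
each of which `w` is affine. -/
def IsPiecewiseAffine {d m : ℕ} (Ω : Set (Euc m)) (w : Euc m → Euc d) : Prop :=
  ∃ (ι : Type) (P : ι → Set (Euc m)), Countable ι ∧
    (∀ i, IsRegularDomain (P i)) ∧ (∀ i, P i ⊆ Ω) ∧ Pairwise (fun i j => Disjoint (P i) (P j)) ∧
    volume (Ω \ ⋃ i, P i) = 0 ∧
    ∀ i, ∃ (X : Mat d m) (b : Euc d), ∀ x ∈ P i, w x = affineFun X b x

/-- `w ∈ C^α(S)`. On a bounded set `S` the supremum of `|w|` is then automatically finite. -/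
def IsHolderOn {d m : ℕ} (α : ℝ) (S : Set (Euc m)) (w : Euc m → Euc d) : Prop :=
  ∃ C : ℝ, ∀ x ∈ S, ∀ y ∈ S, ‖w x - w y‖ ≤ C * ‖x - y‖ ^ α

/-- The properties required of the map `w` in both notions of reducibility:
`w ∈ W^{1,1}(Ω) ∩ C^α(closure Ω)` is piecewise affine with gradient `G`, it equals `X₀ x + b` on the
boundary, `|{x ∈ Ω : |G| > t}| ≤ M^p (1 + |X₀|^p) |Ω| t^{-p}` for all `t > 0`, and on the error set
`{x ∈ Ω : G x ∉ K}` one has `G ∈ U` a.e. and `∫ (1 + |G|)^q < ε |Ω|`. -/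
structure IsReduction {d m : ℕ} (K U : Set (Mat d m)) (p M : ℝ) (X₀ : Mat d m) (b : Euc d)
    (ε α q : ℝ) (Ω : Set (Euc m)) (w : Euc m → Euc d) (G : Euc m → Mat d m) : Prop where
  sobolev : IsW11WithGradient Ω w G
  holder : IsHolderOn α (closure Ω) w
  piecewiseAffine : IsPiecewiseAffine Ω w
  boundary : ∀ x ∈ frontier Ω, w x = affineFun X₀ b x
  upper : ∀ t : ℝ, 0 < t →
    volume {x ∈ Ω | t < ‖G x‖} ≤
      ENNReal.ofReal (M ^ p * (1 + ‖X₀‖ ^ p) * t ^ (-p)) * volume Ω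
  error_mem : ∀ᵐ x ∂(volume : Measure (Euc m)), x ∈ Ω → G x ∉ K → G x ∈ U
  error_small : ∫⁻ x in {x ∈ Ω | G x ∉ K}, ENNReal.ofReal ((1 + ‖G x‖) ^ q) <
    ENNReal.ofReal ε * volume Ω

/-- `U` can be `U`-reduced to `K` in weak `L^p`. -/
def Reducible {d m : ℕ} (U K : Set (Mat d m)) (p : ℝ) : Prop :=
  ∃ M : ℝ, 1 ≤ M ∧
    ∀ X₀ ∈ U, ∀ (b : Euc d) (ε α q : ℝ), ε ∈ Set.Ioo (0 : ℝ) 1 → α ∈ Set.Ioo (0 : ℝ) 1 → 1 < q →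
      ∀ Ω : Set (Euc m), IsRegularDomain Ω →
        ∃ (w : Euc m → Euc d) (G : Euc m → Mat d m), IsReduction K U p M X₀ b ε α q Ω w G

/-- `U` can be `U`-reduced to `K` exactly in weak `L^p`. -/
def ExactlyReducible {d m : ℕ} (U K : Set (Mat d m)) (p : ℝ) : Prop :=
  ∃ M : ℝ, 1 ≤ M ∧ ∃ c : ℝ, 0 < c ∧
    ∀ X₀ ∈ U, ∀ (b : Euc d) (ε α q : ℝ), ε ∈ Set.Ioo (0 : ℝ) 1 → α ∈ Set.Ioo (0 : ℝ) 1 → 1 < q →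
      ∀ Ω : Set (Euc m), IsRegularDomain Ω →
        ∃ (w : Euc m → Euc d) (G : Euc m → Mat d m), IsReduction K U p M X₀ b ε α q Ω w G ∧
          ∀ t : ℝ, 1 < t →
            ENNReal.ofReal (c ^ p * t ^ (-p)) * volume Ω ≤ volume {x ∈ Ω | t < ‖G x‖}

end StaircaseLaminate

/-! A staircase is a recipe for an iterated perturbation. Start from the affine map with gradient `X
0` on `R 0 = Ω`. Once the current map has gradient `X n` on an open set `R n`, add a perturbation `ψ
n`, supported there, whose gradient turns the single value `X n` into nearly the distribution
`stepMeasure (γ n) (μ n) (X (n + 1))`. The share distributed like `μ n` has gradients in `K` and is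
never touched again (`frozen`). The share with value `X (n + 1)` is the next region `R (n + 1)`.
What remains is an error set `E n` with gradients in `U`. Since |R n| ≤ β_n |Ω| → 0, almost every
point is affected by finitely many steps only, and the limit map is affine near it.

One step is built from rank-one splittings. The model is the positive part of a minimum of affine
functions: it has exactly the two required gradients, in exactly the required proportion, outside a
small set of small gradients (`exists_scalar_block`, `exists_block`). Filling an open set with tiny
copies of the model keeps the gradient distribution and makes the amplitude small (`exists_fill`).
Interpolation with the Lipschitz bound then makes the Hölder seminorm small. Induction over the
splittings treats laminates of finite order (`IsPerturbation.split`). Level sets of the gradient are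
shrunk by null sets to open sets (`levelRegion`), so that each step can act inside them.

The errors allowed in the steps are ε 2^{-(n+2)}, which sum to ε / 2. On the frozen part the
gradient distribution lies between |Ω| ν / 2 and |Ω| ν, as measures, where ν is the staircase
laminate. This gives both tail bounds. The contribution of the error set to the upper tail is
controlled by Chebyshev's inequality, because the errors are small with an exponent at least p.

The limit need not be Lipschitz, so it must be shown that its pointwise gradient is the weak one.
The partial sums are Lipschitz, and the gradient of the n-th one differs from the limit gradient
only on `R n`, where it equals `X n`. This contributes at most a constant times β_n |X n| |Ω|. The
barycenter condition forces β_n X n → 0 by a telescoping sum (`tendsto_stairWeight_smul`), which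
excludes a singular part. -/

namespace StaircaseLaminate

variable {d m : ℕ}

/-! ### Affine maps and gradients -/

/-- The linear map `x ↦ X x`. -/
noncomputable def linMap (X : Mat d m) : Euc m →L[ℝ] Euc d :=
  LinearMap.toContinuousLinearMap
    { toFun := fun x => WithLp.toLp 2 ((toMatrix X).mulVec x.ofLp)
      map_add' := fun x y => by
        ext i
        simp [Matrix.mulVec_add]
      map_smul' := fun c x => by
        ext i
        simp [Matrix.mulVec_smul] }

theorem affineFun_eq (X : Mat d m) (b : Euc d) (x : Euc m) :
    affineFun X b x = linMap X x + b := rfl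

theorem linMap_apply (X : Mat d m) (x : Euc m) (i : Fin d) :
    linMap X x i = ∑ j, X (i, j) * x j := rfl

theorem linMap_single (X : Mat d m) (i : Fin d) (j : Fin m) :
    linMap X (EuclideanSpace.single j 1) i = X (i, j) := by
  rw [linMap_apply]
  simp [Finset.sum_ite_eq', PiLp.single_apply]

theorem linMap_add (X Y : Mat d m) : linMap (X + Y) = linMap X + linMap Y := by
  ext x i
  simp [linMap_apply, add_mul, Finset.sum_add_distrib]

theorem linMap_zero : linMap (0 : Mat d m) = 0 := by
  ext x i
  simp [linMap_apply]

theorem affineFun_add (X Y : Mat d m) (b c : Euc d) (x : Euc m) :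
    affineFun X b x + affineFun Y c x = affineFun (X + Y) (b + c) x := by
  simp only [affineFun_eq, linMap_add, add_apply]
  abel

/-- The matrix of first partial derivatives. -/
noncomputable def grad (w : Euc m → Euc d) (x : Euc m) : Mat d m :=
  WithLp.toLp 2 fun ij => (fderiv ℝ w x (EuclideanSpace.single ij.2 1)) ij.1

theorem grad_apply (w : Euc m → Euc d) (x : Euc m) (i : Fin d) (j : Fin m) :
    grad w x (i, j) = (fderiv ℝ w x (EuclideanSpace.single j 1)) i := rfl

theorem measurable_grad (w : Euc m → Euc d) : Measurable (grad w) := by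
  refine (WithLp.measurable_toLp 2 _).comp ?_
  refine measurable_pi_lambda _ fun ij => ?_
  exact (continuous_apply ij.1 |>.comp (PiLp.continuous_ofLp 2 _)).measurable.comp
    (measurable_fderiv_apply_const ℝ w _)

/-- Near `x` the map `w` is affine with linear part `X`. -/
def AffineNear (w : Euc m → Euc d) (X : Mat d m) (x : Euc m) : Prop :=
  ∃ b, w =ᶠ[𝓝 x] affineFun X b

theorem hasFDerivAt_affineFun (X : Mat d m) (b : Euc d) (x : Euc m) :
    HasFDerivAt (affineFun X b) (linMap X) x :=
  (linMap X).hasFDerivAt.add_const b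

theorem grad_affineFun (X : Mat d m) (b : Euc d) (x : Euc m) : grad (affineFun X b) x = X := by
  ext ⟨i, j⟩
  rw [grad_apply, (hasFDerivAt_affineFun X b x).fderiv, linMap_single]

theorem grad_congr {w w' : Euc m → Euc d} {x : Euc m} (h : w =ᶠ[𝓝 x] w') :
    grad w x = grad w' x := by
  unfold grad
  rw [h.fderiv_eq]

theorem AffineNear.grad_eq {w : Euc m → Euc d} {X : Mat d m} {x : Euc m}
    (h : AffineNear w X x) : grad w x = X := by
  obtain ⟨b, hb⟩ := h
  rw [grad_congr hb, grad_affineFun]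

theorem AffineNear.eventually {w : Euc m → Euc d} {X : Mat d m} {x : Euc m}
    (h : AffineNear w X x) : ∀ᶠ y in 𝓝 x, AffineNear w X y := by
  obtain ⟨b, hb⟩ := h
  filter_upwards [eventually_eventually_nhds.2 hb] with y hy using ⟨b, hy⟩

theorem AffineNear.congr {w w' : Euc m → Euc d} {X : Mat d m} {x : Euc m}
    (h : AffineNear w X x) (h' : w' =ᶠ[𝓝 x] w) : AffineNear w' X x := by
  obtain ⟨b, hb⟩ := h
  exact ⟨b, h'.trans hb⟩

theorem AffineNear.add {w w' : Euc m → Euc d} {X X' : Mat d m} {x : Euc m}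
    (h : AffineNear w X x) (h' : AffineNear w' X' x) :
    AffineNear (fun y => w y + w' y) (X + X') x := by
  obtain ⟨b, hb⟩ := h
  obtain ⟨b', hb'⟩ := h'
  refine ⟨b + b', ?_⟩
  filter_upwards [hb, hb'] with y h1 h2
  rw [h1, h2, affineFun_add]

theorem affineNear_zero {w : Euc m → Euc d} {x : Euc m} (h : ∀ᶠ y in 𝓝 x, w y = 0) :
    AffineNear w 0 x := by
  refine ⟨0, ?_⟩
  filter_upwards [h] with y hy
  rw [hy, affineFun_eq, linMap_zero]
  simp

/-! ### Good points and open level regions of the gradient -/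

/-- Near `x` the map `w` is affine and the indicator function of `E` is constant. -/
def IsGood (w : Euc m → Euc d) (E : Set (Euc m)) (x : Euc m) : Prop :=
  AffineNear w (grad w x) x ∧ ∀ᶠ y in 𝓝 x, (y ∈ E ↔ x ∈ E)

theorem IsGood.of_affineNear {w : Euc m → Euc d} {E : Set (Euc m)} {X : Mat d m} {x : Euc m}
    (h : AffineNear w X x) (hE : ∀ᶠ y in 𝓝 x, (y ∈ E ↔ x ∈ E)) : IsGood w E x :=
  ⟨h.grad_eq.symm ▸ h, hE⟩

/-- At a good point both the gradient and membership in `E` are locally constant, so goodness is an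
open condition. This makes the level regions open without any regularity of `E`. -/
theorem IsGood.eventually {w : Euc m → Euc d} {E : Set (Euc m)} {x : Euc m} (h : IsGood w E x) :
    ∀ᶠ y in 𝓝 x, IsGood w E y ∧ grad w y = grad w x ∧ (y ∈ E ↔ x ∈ E) := by
  filter_upwards [h.1.eventually, eventually_eventually_nhds.2 h.2, h.2] with y h1 h2 h3
  refine ⟨.of_affineNear h1 ?_, h1.grad_eq, h3⟩
  filter_upwards [h2] with z hz using hz.trans h3.symm

/-- The part of `V \ E` on which `A + grad ψ` is locally constant with value `Y`. -/
def levelRegion (V : Set (Euc m)) (A : Mat d m) (ψ : Euc m → Euc d) (E : Set (Euc m))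
    (Y : Mat d m) : Set (Euc m) :=
  {x | x ∈ V ∧ x ∉ E ∧ IsGood ψ E x ∧ A + grad ψ x = Y}

theorem isOpen_levelRegion {V : Set (Euc m)} (hV : IsOpen V) (A : Mat d m) (ψ : Euc m → Euc d)
    (E : Set (Euc m)) (Y : Mat d m) : IsOpen (levelRegion V A ψ E Y) := by
  rw [isOpen_iff_mem_nhds]
  rintro x ⟨hx, hxE, hg, hY⟩
  filter_upwards [hg.eventually, hV.mem_nhds hx] with y hy hyV
  exact ⟨hyV, fun h => hxE (hy.2.2.1 h), hy.1, by rw [hy.2.1, hY]⟩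

/-- The complement counterpart of `isOpen_levelRegion`: a perturbation supported in the level region
vanishes near a good point outside it, so the gradient there is not altered. -/
theorem IsGood.eventually_notMem_levelRegion {V : Set (Euc m)} {A : Mat d m} {ψ : Euc m → Euc d}
    {E : Set (Euc m)} {Y : Mat d m} {x : Euc m} (hx : x ∈ V) (hg : IsGood ψ E x)
    (h : x ∉ levelRegion V A ψ E Y) : ∀ᶠ y in 𝓝 x, y ∉ levelRegion V A ψ E Y := by
  filter_upwards [hg.eventually] with y hy hmem
  exact h ⟨hx, fun h => hmem.2.1 (hy.2.2.2 h), hg, by rw [← hy.2.1]; exact hmem.2.2.2⟩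

/-! ### Rank-one matrices -/

/-- The rank-one matrix `a ⊗ v`. -/
noncomputable def tensor (a : Euc d) (v : Euc m) : Mat d m :=
  WithLp.toLp 2 fun ij => a ij.1 * v ij.2

theorem norm_tensor (a : Euc d) (v : Euc m) : ‖tensor a v‖ = ‖a‖ * ‖v‖ := by
  rw [EuclideanSpace.norm_eq, EuclideanSpace.norm_eq, EuclideanSpace.norm_eq,
    ← Real.sqrt_mul (by positivity), Finset.sum_mul_sum, ← Finset.univ_product_univ,
    Finset.sum_product]
  simp [tensor, mul_pow]

theorem linMap_tensor (a : Euc d) (v x : Euc m) : linMap (tensor a v) x = inner ℝ v x • a := by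
  ext i
  rw [linMap_apply]
  simp only [tensor, PiLp.smul_apply, smul_eq_mul, PiLp.inner_apply, Finset.sum_mul]
  refine Finset.sum_congr rfl fun j _ => ?_
  simp
  ring

theorem tensor_smul (a : Euc d) (c : ℝ) (v : Euc m) : tensor a (c • v) = c • tensor a v := by
  ext ij
  simp [tensor]
  ring

/-- All columns are multiples of one vector spanning the range. The vector of the multiples is
normalized and its length moved to the other factor. -/
theorem exists_tensor_of_rank {X : Mat d m} (h : (toMatrix X).rank = 1) :
    ∃ (a : Euc d) (n : Euc m), ‖n‖ = 1 ∧ X = tensor a n := by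
  rw [Matrix.rank, finrank_eq_one_iff'] at h
  obtain ⟨⟨v, hv⟩, hv0, hall⟩ := h
  have hcol : ∀ j, ∃ c : ℝ, ∀ i, c * v i = X (i, j) := fun j => by
    obtain ⟨c, hc⟩ := hall ⟨(toMatrix X).mulVecLin (Pi.single j 1), LinearMap.mem_range_self _ _⟩
    refine ⟨c, fun i => ?_⟩
    have := congrFun (congrArg Subtype.val hc) i
    change c * v i = _ at this
    simpa [toMatrix] using this
  choose c hc using hcol
  have hne : (WithLp.toLp 2 c : Euc m) ≠ 0 := by
    intro h0
    have hc0 : c = 0 := by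
      funext j
      simpa using congrArg (fun z : Euc m => z j) h0
    apply hv0
    obtain ⟨y, hy⟩ := hv
    have : v = 0 := by
      rw [← hy]
      funext i
      simp [Matrix.mulVec, dotProduct, toMatrix, ← hc, hc0]
    simpa [Subtype.ext_iff] using this
  refine ⟨‖(WithLp.toLp 2 c : Euc m)‖ • WithLp.toLp 2 v,
    ‖(WithLp.toLp 2 c : Euc m)‖⁻¹ • WithLp.toLp 2 c, ?_, ?_⟩
  · rw [norm_smul, norm_inv, norm_norm, inv_mul_cancel₀ (norm_ne_zero_iff.2 hne)]
  · ext ⟨i, j⟩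
    have := norm_ne_zero_iff.2 hne
    simp only [tensor, PiLp.smul_apply, smul_eq_mul]
    rw [← hc j i]
    field_simp

/-! ### Filling an open set with rescaled copies of a building block -/

/-- The affine change of variables that maps the copy at `y` with scale `r` to the model. -/
noncomputable def rescale (a : Euc m × ℝ) (x : Euc m) : Euc m := a.2⁻¹ • (x - a.1)

theorem continuous_rescale (a : Euc m × ℝ) : Continuous (rescale a) := by
  unfold rescale
  fun_prop

theorem volume_preimage_rescale {a : Euc m × ℝ} (ha : 0 < a.2) (A : Set (Euc m)) :
    volume (rescale a ⁻¹' A) = ENNReal.ofReal (a.2 ^ m) * volume A := by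
  have h1 : rescale a ⁻¹' A = (fun x => x + -a.1) ⁻¹' ((fun x => a.2⁻¹ • x) ⁻¹' A) := by
    ext x
    simp [rescale, sub_eq_add_neg]
  rw [h1, measure_preimage_add_right, Measure.addHaar_preimage_smul _ (inv_ne_zero ha.ne')]
  simp [abs_of_pos ha]

/-- The rescaled copy of a map. -/
noncomputable def copyMap (ψ : Euc m → Euc d) (a : Euc m × ℝ) (x : Euc m) : Euc d :=
  a.2 • ψ (rescale a x)

/-- The outer factor r cancels the inner factor 1 / r, so copies keep the gradients and the
Lipschitz constant of the model while their amplitude shrinks. -/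
theorem affineNear_copyMap {ψ : Euc m → Euc d} {a : Euc m × ℝ} (ha : 0 < a.2) {X : Mat d m}
    {x : Euc m} (h : AffineNear ψ X (rescale a x)) : AffineNear (copyMap ψ a) X x := by
  obtain ⟨b, hb⟩ := h
  refine ⟨a.2 • b - linMap X a.1, ?_⟩
  filter_upwards [(continuous_rescale a).continuousAt.eventually hb] with y hy
  rw [copyMap, hy, affineFun_eq, affineFun_eq, rescale, map_smul, map_sub, smul_add,
    smul_inv_smul₀ ha.ne']
  abel

theorem lipschitzWith_copyMap {ψ : Euc m → Euc d} {C : NNReal} (h : LipschitzWith C ψ)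
    {a : Euc m × ℝ} (ha : 0 < a.2) : LipschitzWith C (copyMap ψ a) := by
  refine LipschitzWith.of_dist_le_mul fun x y => ?_
  have := h.dist_le_mul (rescale a x) (rescale a y)
  rw [dist_eq_norm] at this ⊢
  rw [copyMap, copyMap, ← smul_sub, norm_smul, Real.norm_of_nonneg ha.le]
  have h2 : dist (rescale a x) (rescale a y) = a.2⁻¹ * dist x y := by
    rw [dist_eq_norm, dist_eq_norm, rescale, rescale, ← smul_sub, norm_smul, norm_inv,
      Real.norm_of_nonneg ha.le]
    congr 2
    abel
  rw [h2] at this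
  calc a.2 * _ ≤ a.2 * (C * (a.2⁻¹ * dist x y)) := by gcongr
    _ = C * dist x y := by field_simp

/-- Vitali covering of an open set by small copies of the closure of a bounded open set. -/
theorem exists_covering {Q : Set (Euc m)} (hQo : IsOpen Q) (hQb : Bornology.IsBounded Q)
    (hQne : Q.Nonempty) {V : Set (Euc m)} (hV : IsOpen V) {s : ℝ} (hs : 0 < s) :
    ∃ u : Set (Euc m × ℝ), u.Countable ∧ (∀ a ∈ u, 0 < a.2 ∧ a.2 ≤ s ∧
      rescale a ⁻¹' (closure Q) ⊆ V) ∧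
      u.PairwiseDisjoint (fun a => rescale a ⁻¹' (closure Q)) ∧
      volume (V \ ⋃ a ∈ u, rescale a ⁻¹' (closure Q)) = 0 := by
  obtain ⟨ρ, hρ, hQρ⟩ : ∃ ρ > 0, closure Q ⊆ Metric.closedBall 0 ρ := by
    obtain ⟨ρ, hρ⟩ := hQb.closure.subset_closedBall 0
    exact ⟨max ρ 1, by positivity, hρ.trans (Metric.closedBall_subset_closedBall (le_max_left _ _))⟩
  have hball : ∀ (a : Euc m × ℝ) (k : ℝ), 0 < a.2 →
      rescale a ⁻¹' (Metric.closedBall 0 k) = Metric.closedBall a.1 (a.2 * k) := by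
    intro a k ha
    ext x
    rw [Set.mem_preimage, mem_closedBall_zero_iff, Metric.mem_closedBall, dist_eq_norm, rescale,
      norm_smul, norm_inv, Real.norm_of_nonneg ha.le, inv_mul_le_iff₀ ha]
  have hvQ : volume (closure Q) ≠ 0 :=
    ((hQo.measure_pos volume hQne).trans_le (measure_mono subset_closure)).ne'
  have hvQ' : volume (closure Q) ≠ ⊤ := hQb.closure.measure_lt_top.ne
  -- The Vitali theorem requires the ball of triple radius to have at most a fixed multiple of the
  -- volume of the copy; this ratio does not depend on the scale.
  set C : ENNReal := volume (Metric.closedBall (0 : Euc m) (3 * ρ)) / volume (closure Q) with hC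
  have hCtop : C ≠ ⊤ := ENNReal.div_ne_top measure_closedBall_lt_top.ne hvQ
  suffices h : ∃ u ⊆ {a : Euc m × ℝ | 0 < a.2 ∧ a.2 ≤ s ∧ rescale a ⁻¹' (closure Q) ⊆ V},
      u.Countable ∧ u.PairwiseDisjoint (fun a => rescale a ⁻¹' (closure Q)) ∧
      volume (V \ ⋃ a ∈ u, rescale a ⁻¹' (closure Q)) = 0 by
    obtain ⟨u, hut, huc, hud, hu0⟩ := h
    exact ⟨u, huc, fun a ha => hut ha, hud, hu0⟩
  refine Vitali.exists_disjoint_covering_ae (volume : Measure (Euc m)) V _ C.toNNReal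
    (fun a => a.2 * ρ) (fun a => a.1) (fun a => rescale a ⁻¹' (closure Q)) ?_ ?_ ?_ ?_ ?_
  · intro a ha
    rw [← hball a ρ ha.1]
    exact Set.preimage_mono hQρ
  · intro a ha
    have : 3 * (a.2 * ρ) = a.2 * (3 * ρ) := by ring
    rw [this, ← hball a _ ha.1, volume_preimage_rescale ha.1, volume_preimage_rescale ha.1,
      ENNReal.coe_toNNReal hCtop, mul_left_comm, hC, ENNReal.div_mul_cancel hvQ hvQ']
  · intro a ha
    obtain ⟨z, hz⟩ := hQne
    refine ⟨a.1 + a.2 • z, mem_interior.2 ⟨rescale a ⁻¹' Q, Set.preimage_mono subset_closure,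
      hQo.preimage (continuous_rescale a), ?_⟩⟩
    simp [rescale, inv_smul_smul₀ ha.1.ne', hz]
  · exact fun a _ => isClosed_closure.preimage (continuous_rescale a)
  · intro x hx ε hε
    obtain ⟨k, hk, hkV⟩ := Metric.isOpen_iff.1 hV x hx
    refine ⟨(x, min (min s (ε / ρ)) (k / (2 * ρ))), ⟨by positivity, ?_, ?_⟩, ?_, rfl⟩
    · exact (min_le_left _ _).trans (min_le_left _ _)
    · refine (Set.preimage_mono hQρ).trans ?_
      rw [hball _ _ (by positivity)]
      refine (Metric.closedBall_subset_ball ?_).trans hkV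
      calc min (min s (ε / ρ)) (k / (2 * ρ)) * ρ ≤ (k / (2 * ρ)) * ρ := by
            gcongr
            exact min_le_right _ _
        _ = k / 2 := by field_simp
        _ < k := by linarith
    · calc min (min s (ε / ρ)) (k / (2 * ρ)) * ρ ≤ (ε / ρ) * ρ := by
            gcongr
            exact (min_le_left _ _).trans (min_le_right _ _)
        _ = ε := by field_simp

/-- Given a building block `(Q, ψ₀, E₀)`, every open set `V` carries a map of arbitrarily small
sup norm which has in `V` the same gradient distribution as `ψ₀` in `Q`. -/
theorem exists_fill {Q : Set (Euc m)} (hQo : IsOpen Q) (hQb : Bornology.IsBounded Q)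
    (hQne : Q.Nonempty) (hQf : volume (frontier Q) = 0) {ψ₀ : Euc m → Euc d} {C : NNReal}
    (hL : LipschitzWith C ψ₀) (h0 : ∀ x ∉ Q, ψ₀ x = 0) {E₀ : Set (Euc m)} (hE₀ : E₀ ⊆ Q)
    (hE₀m : MeasurableSet E₀) (hgood : ∀ᵐ x ∂(volume : Measure (Euc m)), x ∈ Q → IsGood ψ₀ E₀ x)
    {V : Set (Euc m)} (hV : IsOpen V) {s : ℝ} (hs : 0 < s) :
    ∃ (ψ : Euc m → Euc d) (E : Set (Euc m)), LipschitzWith (2 * C) ψ ∧ (∀ x, ‖ψ x‖ ≤ s) ∧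
      (∀ x ∉ V, ψ x = 0) ∧ E ⊆ V ∧ MeasurableSet E ∧
      (∀ᵐ x ∂(volume : Measure (Euc m)), x ∈ V → IsGood ψ E x) ∧
      (∀ S, MeasurableSet S → volume (E ∩ grad ψ ⁻¹' S) * volume Q =
        volume (E₀ ∩ grad ψ₀ ⁻¹' S) * volume V) ∧
      (∀ S, MeasurableSet S → volume ((V \ E) ∩ grad ψ ⁻¹' S) * volume Q =
        volume ((Q \ E₀) ∩ grad ψ₀ ⁻¹' S) * volume V) := by
  classical
  obtain ⟨b, hb, hb'⟩ : ∃ b > 0, ∀ x, ‖ψ₀ x‖ ≤ b := by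
    obtain ⟨b, hb⟩ := hQb.isCompact_closure.exists_bound_of_continuousOn hL.continuous.continuousOn
    refine ⟨max b 1, by positivity, fun x => ?_⟩
    by_cases hx : x ∈ Q
    · exact (hb x (subset_closure hx)).trans (le_max_left _ _)
    · rw [h0 x hx]
      simp
  -- With `b` a bound for the model, scales at most `s / b` give amplitude at most `s`.
  obtain ⟨u, huc, hu, hud, hu0⟩ := exists_covering hQo hQb hQne hV (s := s / b) (by positivity)
  have huc' : Countable u := huc.to_subtype
  have huniq : ∀ {x a a'}, a ∈ u → a' ∈ u → rescale a x ∈ Q → rescale a' x ∈ Q → a = a' := by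
    intro x a a' ha ha' hx hx'
    exact hud.elim_set ha ha' x (subset_closure hx) (subset_closure hx')
  set ψ : Euc m → Euc d := fun x =>
    if h : ∃ a ∈ u, rescale a x ∈ Q then copyMap ψ₀ h.choose x else 0 with hψ
  have hψa : ∀ {x a}, a ∈ u → rescale a x ∈ Q → ψ x = copyMap ψ₀ a x := by
    intro x a ha hx
    have h : ∃ a ∈ u, rescale a x ∈ Q := ⟨a, ha, hx⟩
    rw [hψ]
    simp only [dif_pos h]
    rw [huniq h.choose_spec.1 ha h.choose_spec.2 hx]
  have hψ0 : ∀ {x}, (¬ ∃ a ∈ u, rescale a x ∈ Q) → ψ x = 0 := by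
    intro x h
    rw [hψ]
    simp only [dif_neg h]
  have hcopy0 : ∀ {x a}, rescale a x ∉ Q → copyMap ψ₀ a x = 0 := by
    intro x a h
    rw [copyMap, h0 _ h, smul_zero]
  set E : Set (Euc m) := ⋃ a ∈ u, rescale a ⁻¹' E₀ with hE
  have hEa : ∀ {x a}, a ∈ u → rescale a x ∈ Q → (x ∈ E ↔ rescale a x ∈ E₀) := by
    intro x a ha hx
    simp only [hE, Set.mem_iUnion, Set.mem_preimage, exists_prop]
    constructor
    · rintro ⟨a', ha', h⟩
      rwa [huniq ha ha' hx (hE₀ h)]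
    · exact fun h => ⟨a, ha, h⟩
  have hcop : ∀ a ∈ u, IsOpen (rescale a ⁻¹' Q) := fun a _ => hQo.preimage (continuous_rescale a)
  have hsub : ∀ {x a}, a ∈ u → rescale a x ∈ Q → x ∈ V := fun {x a} ha hx =>
    (hu a ha).2.2 (show rescale a x ∈ closure Q from subset_closure hx)
  have hcov : ∀ᵐ x ∂(volume : Measure (Euc m)), x ∈ V → ∃ a ∈ u, rescale a x ∈ Q := by
    have h1 : ∀ᵐ x ∂(volume : Measure (Euc m)), ∀ a ∈ u, rescale a x ∉ frontier Q := by
      rw [ae_ball_iff huc]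
      intro a ha
      have : volume (rescale a ⁻¹' frontier Q) = 0 := by
        rw [volume_preimage_rescale (hu a ha).1, hQf, mul_zero]
      exact measure_eq_zero_iff_ae_notMem.1 this
    have h2 : ∀ᵐ x ∂(volume : Measure (Euc m)),
        x ∉ V \ ⋃ a ∈ u, rescale a ⁻¹' (closure Q) := by
      exact measure_eq_zero_iff_ae_notMem.1 hu0
    filter_upwards [h1, h2] with x hx1 hx2 hxV
    by_contra hcon
    push Not at hcon
    refine hx2 ⟨hxV, fun hmem => ?_⟩
    simp only [Set.mem_iUnion, Set.mem_preimage, exists_prop] at hmem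
    obtain ⟨a, ha, hxa⟩ := hmem
    refine hx1 a ha ⟨hxa, ?_⟩
    rw [hQo.interior_eq]
    exact hcon a ha
  have hgood' : ∀ᵐ x ∂(volume : Measure (Euc m)), ∀ a ∈ u, rescale a x ∈ Q →
      IsGood ψ₀ E₀ (rescale a x) := by
    rw [ae_ball_iff huc]
    intro a ha
    rw [ae_iff] at hgood ⊢
    change volume (rescale a ⁻¹' {x | ¬ (x ∈ Q → IsGood ψ₀ E₀ x)}) = 0
    rw [volume_preimage_rescale (hu a ha).1, hgood, mul_zero]
  have hgoodx : ∀ {x a}, a ∈ u → rescale a x ∈ Q → IsGood ψ₀ E₀ (rescale a x) →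
      IsGood ψ E x ∧ grad ψ x = grad ψ₀ (rescale a x) := by
    intro x a ha hx hg
    have h1 : AffineNear ψ (grad ψ₀ (rescale a x)) x := by
      refine (affineNear_copyMap (hu a ha).1 hg.1).congr ?_
      filter_upwards [(hcop a ha).mem_nhds hx] with y hy using hψa ha hy
    refine ⟨.of_affineNear h1 ?_, h1.grad_eq⟩
    filter_upwards [(hcop a ha).mem_nhds hx,
      (continuous_rescale a).continuousAt.eventually hg.2] with y hy hy2
    rw [hEa ha hy, hEa ha hx, hy2]
  -- Everything assembled from copies has the volume of its model times one common factor. The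
  -- factor also relates `V` to `Q`, hence the proportions, even if `V` has infinite volume.
  have hvol : ∀ A₀ ⊆ Q, MeasurableSet A₀ → ∀ A : Set (Euc m),
      (∀ᵐ x ∂(volume : Measure (Euc m)), x ∈ A ↔ ∃ a ∈ u, rescale a x ∈ A₀) →
      volume A = (∑' a : u, ENNReal.ofReal (a.1.2 ^ m)) * volume A₀ := by
    intro A₀ hA₀ hA₀m A hA
    have : A =ᵐ[volume] ⋃ a ∈ u, rescale a ⁻¹' A₀ := by
      filter_upwards [hA] with x hx
      apply propext
      change x ∈ A ↔ x ∈ ⋃ a ∈ u, rescale a ⁻¹' A₀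
      rw [hx]
      simp
    rw [measure_congr this, measure_biUnion huc, ← ENNReal.tsum_mul_right]
    · exact tsum_congr fun a => volume_preimage_rescale (hu a.1 a.2).1 _
    · exact hud.mono fun a => Set.preimage_mono (hA₀.trans subset_closure)
    · exact fun a ha => hA₀m.preimage (continuous_rescale a).measurable
  have hvolV : volume V = (∑' a : u, ENNReal.ofReal (a.1.2 ^ m)) * volume Q := by
    refine hvol Q subset_rfl hQo.measurableSet V ?_
    filter_upwards [hcov] with x hx
    exact ⟨hx, fun ⟨a, ha, h⟩ => hsub ha h⟩
  refine ⟨ψ, E, ?_, ?_, ?_, ?_, ?_, ?_, ?_, ?_⟩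
  · refine LipschitzWith.of_dist_le_mul fun x y => ?_
    have hCp : ∀ {a}, a ∈ u → dist (copyMap ψ₀ a x) (copyMap ψ₀ a y) ≤ C * dist x y :=
      fun {a} ha => (lipschitzWith_copyMap hL (hu a ha).1).dist_le_mul x y
    have hnn : 0 ≤ (C : ℝ) * dist x y := by positivity
    push_cast
    by_cases hx : ∃ a ∈ u, rescale a x ∈ Q
    · obtain ⟨a, ha, hxa⟩ := hx
      have h1 := hCp ha
      rw [hψa ha hxa]
      by_cases hya : rescale a y ∈ Q
      · rw [hψa ha hya]
        linarith
      · rw [hcopy0 hya] at h1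
        -- For points in different copies the values are compared through 0: each copy vanishes at
        -- the point lying in the other one. This costs the factor 2.
        by_cases hy : ∃ a ∈ u, rescale a y ∈ Q
        · obtain ⟨a', ha', hya'⟩ := hy
          have hxa' : rescale a' x ∉ Q := fun h => hya (huniq ha ha' hxa h ▸ hya')
          have h2 := hCp ha'
          rw [hcopy0 hxa'] at h2
          rw [hψa ha' hya']
          have := dist_triangle (copyMap ψ₀ a x) 0 (copyMap ψ₀ a' y)
          linarith
        · rw [hψ0 hy]
          linarith
    · rw [hψ0 hx]
      by_cases hy : ∃ a ∈ u, rescale a y ∈ Q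
      · obtain ⟨a', ha', hya'⟩ := hy
        have h2 := hCp ha'
        rw [hcopy0 fun h => hx ⟨a', ha', h⟩] at h2
        rw [hψa ha' hya']
        linarith
      · rw [hψ0 hy, dist_self]
        linarith
  · intro x
    by_cases hx : ∃ a ∈ u, rescale a x ∈ Q
    · obtain ⟨a, ha, hxa⟩ := hx
      rw [hψa ha hxa, copyMap, norm_smul, Real.norm_of_nonneg (hu a ha).1.le]
      calc a.2 * ‖ψ₀ (rescale a x)‖ ≤ (s / b) * b :=
            mul_le_mul (hu a ha).2.1 (hb' _) (norm_nonneg _) (by positivity)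
        _ = s := by field_simp
    · rw [hψ0 hx, norm_zero]
      exact hs.le
  · exact fun x hx => hψ0 fun ⟨a, ha, h⟩ => hx (hsub ha h)
  · intro x hx
    simp only [hE, Set.mem_iUnion, Set.mem_preimage, exists_prop] at hx
    obtain ⟨a, ha, h⟩ := hx
    exact hsub ha (hE₀ h)
  · exact MeasurableSet.biUnion huc fun a _ => hE₀m.preimage (continuous_rescale a).measurable
  · filter_upwards [hcov, hgood'] with x hx hg hxV
    obtain ⟨a, ha, h⟩ := hx hxV
    exact (hgoodx ha h (hg a ha h)).1
  · intro S hS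
    rw [hvol (E₀ ∩ grad ψ₀ ⁻¹' S) (Set.inter_subset_left.trans hE₀)
      (hE₀m.inter (measurable_grad _ hS)) (E ∩ grad ψ ⁻¹' S), hvolV]
    · ring
    · filter_upwards [hgood'] with x hg
      constructor
      · rintro ⟨hxE, hxS⟩
        simp only [hE, Set.mem_iUnion, Set.mem_preimage, exists_prop] at hxE
        obtain ⟨a, ha, h⟩ := hxE
        refine ⟨a, ha, h, ?_⟩
        rw [Set.mem_preimage, ← (hgoodx ha (hE₀ h) (hg a ha (hE₀ h))).2]
        exact hxS
      · rintro ⟨a, ha, h, hS'⟩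
        refine ⟨(hEa ha (hE₀ h)).2 h, ?_⟩
        rw [Set.mem_preimage, (hgoodx ha (hE₀ h) (hg a ha (hE₀ h))).2]
        exact hS'
  · intro S hS
    rw [hvol ((Q \ E₀) ∩ grad ψ₀ ⁻¹' S) (Set.inter_subset_left.trans Set.sdiff_subset)
      ((hQo.measurableSet.diff hE₀m).inter (measurable_grad _ hS)) ((V \ E) ∩ grad ψ ⁻¹' S), hvolV]
    · ring
    · filter_upwards [hgood', hcov] with x hg hc
      constructor
      · rintro ⟨⟨hxV, hxE⟩, hxS⟩
        obtain ⟨a, ha, h⟩ := hc hxV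
        refine ⟨a, ha, ⟨h, fun h' => hxE ((hEa ha h).2 h')⟩, ?_⟩
        rw [Set.mem_preimage, ← (hgoodx ha h (hg a ha h)).2]
        exact hxS
      · rintro ⟨a, ha, ⟨h, hnE⟩, hS'⟩
        refine ⟨⟨hsub ha h, fun h' => hnE ((hEa ha h).1 h')⟩, ?_⟩
        rw [Set.mem_preimage, (hgoodx ha h (hg a ha h)).2]
        exact hS'

/-- A map that is affine near almost every point of a bounded open set is piecewise affine. -/
theorem isPiecewiseAffine_of_ae {Ω : Set (Euc m)} (hΩ : IsOpen Ω) {w : Euc m → Euc d}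
    (h : ∀ᵐ x ∂(volume : Measure (Euc m)), x ∈ Ω → AffineNear w (grad w x) x) :
    IsPiecewiseAffine Ω w := by
  have hO : IsOpen {x | x ∈ Ω ∧ AffineNear w (grad w x) x} := by
    rw [isOpen_iff_mem_nhds]
    rintro x ⟨hx, hg⟩
    filter_upwards [hg.eventually, hΩ.mem_nhds hx] with y hy hyΩ
    exact ⟨hyΩ, hy.grad_eq.symm ▸ hy⟩
  have hconst : ∀ (y : Euc m) (r : ℝ), Metric.ball y r ⊆ {x | x ∈ Ω ∧ AffineNear w (grad w x) x} →
      ∃ (X : Mat d m) (b : Euc d), ∀ x ∈ Metric.ball y r, w x = affineFun X b x := by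
    intro y r hsub
    rcases le_or_gt r 0 with hr | hr
    · exact ⟨0, 0, fun x hx => by simp [Metric.ball_eq_empty.2 hr] at hx⟩
    have hpre : IsPreconnected (Metric.ball y r) := (convex_ball y r).isPreconnected
    have hy := Metric.mem_ball_self (x := y) hr
    -- A locally constant gradient is constant on the connected ball. The same argument then applies
    -- to the difference of `w` and the linear map.
    have hgrad : ∀ x ∈ Metric.ball y r, grad w x = grad w y := by
      have key : ∀ x ∈ Metric.ball y r, HasFDerivAt (grad w) (0 : Euc m →L[ℝ] Mat d m) x := by
        intro x hx
        refine (hasFDerivAt_const (grad w x) x).congr_of_eventuallyEq ?_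
        filter_upwards [(hsub hx).2.eventually] with z hz using hz.grad_eq
      intro x hx
      exact Metric.isOpen_ball.is_const_of_fderiv_eq_zero hpre
        (fun z hz => (key z hz).differentiableAt.differentiableWithinAt)
        (fun z hz => (key z hz).fderiv) hx hy
    have key : ∀ x ∈ Metric.ball y r,
        HasFDerivAt (fun z => w z - linMap (grad w y) z) (0 : Euc m →L[ℝ] Euc d) x := by
      intro x hx
      obtain ⟨b, hb⟩ := (hsub hx).2
      rw [hgrad x hx] at hb
      refine (hasFDerivAt_const b x).congr_of_eventuallyEq ?_
      filter_upwards [hb] with z hz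
      rw [hz, affineFun_eq, add_sub_cancel_left]
    refine ⟨grad w y, w y - linMap (grad w y) y, fun x hx => ?_⟩
    have := Metric.isOpen_ball.is_const_of_fderiv_eq_zero hpre
        (fun z hz => (key z hz).differentiableAt.differentiableWithinAt)
        (fun z hz => (key z hz).fderiv) hx hy
    rw [affineFun_eq, ← this, add_sub_cancel]
  obtain ⟨u, huc, hu, hud, hu0⟩ := exists_covering (Metric.isOpen_ball (x := (0 : Euc m)) (ε := 1))
    Metric.isBounded_ball ⟨0, by simp⟩ hO one_pos
  rw [closure_ball _ one_ne_zero] at hud hu0 hu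
  have hball : ∀ a ∈ u, rescale a ⁻¹' (Metric.closedBall 0 1) = Metric.closedBall a.1 a.2 := by
    intro a ha
    ext x
    rw [Set.mem_preimage, mem_closedBall_zero_iff, Metric.mem_closedBall, dist_eq_norm, rescale,
      norm_smul, norm_inv, Real.norm_of_nonneg (hu a ha).1.le, inv_mul_le_iff₀ (hu a ha).1, mul_one]
  have hcl : ∀ a ∈ u, Metric.ball a.1 a.2 ⊆ rescale a ⁻¹' (Metric.closedBall 0 1) := fun a ha => by
    rw [hball a ha]
    exact Metric.ball_subset_closedBall
  refine ⟨u, fun a => Metric.ball a.1.1 a.1.2, huc.to_subtype, fun a => ?_, fun a => ?_, ?_, ?_,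
    fun a => hconst _ _ ((hcl a a.2).trans (hu a a.2).2.2)⟩
  · refine ⟨Metric.isOpen_ball, Metric.isBounded_ball, ?_, (convex_ball _ _).addHaar_frontier _⟩
    exact (convex_ball _ _).isConnected ⟨a.1.1, Metric.mem_ball_self (hu a a.2).1⟩
  · exact fun x hx => ((hu a a.2).2.2 (hcl a a.2 hx)).1
  · intro a a' haa'
    exact (hud a.2 a'.2 fun h => haa' (Subtype.ext h)).mono (hcl a a.2) (hcl a' a'.2)
  · rw [measure_eq_zero_iff_ae_notMem] at hu0 ⊢
    have hfr : ∀ᵐ x ∂(volume : Measure (Euc m)), ∀ a ∈ u, x ∉ frontier (Metric.ball a.1 a.2) := by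
      rw [ae_ball_iff huc]
      exact fun a ha => measure_eq_zero_iff_ae_notMem.1 ((convex_ball _ _).addHaar_frontier _)
    filter_upwards [hu0, h, hfr] with x h1 h2 h3 hx
    refine h1 ⟨⟨hx.1, h2 hx.1⟩, fun hmem => ?_⟩
    simp only [Set.mem_iUnion, exists_prop] at hmem
    obtain ⟨a, ha, hxa⟩ := hmem
    rw [hball a ha, ← closure_ball _ (hu a ha).1.ne'] at hxa
    refine h3 a ha ⟨hxa, ?_⟩
    rw [Metric.isOpen_ball.interior_eq]
    exact fun hb => hx.2 (Set.mem_iUnion.2 ⟨⟨a, ha⟩, hb⟩)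

/-! ### The building block -/

/-- The affine function `x ↦ ⟨k.1, x⟩ + k.2`. -/
noncomputable def affineVal (k : Euc m × ℝ) (x : Euc m) : ℝ := inner ℝ k.1 x + k.2

theorem continuous_affineVal (k : Euc m × ℝ) : Continuous (affineVal k) := by
  unfold affineVal
  fun_prop

theorem volume_affineVal_eq {k l : Euc m × ℝ} (h : k ≠ l) :
    volume {x | affineVal k x = affineVal l x} = 0 := by
  by_cases h1 : k.1 = l.1
  · have h2 : k.2 ≠ l.2 := fun h2 => h (Prod.ext h1 h2)
    have : {x | affineVal k x = affineVal l x} = ∅ := by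
      ext x
      simp [affineVal, h1, h2]
    rw [this, measure_empty]
  · set v := k.1 - l.1 with hv
    have hv0 : v ≠ 0 := sub_ne_zero.2 h1
    have hvv : inner ℝ v v ≠ 0 := inner_self_ne_zero.2 hv0
    set W : Submodule ℝ (Euc m) := (innerSL ℝ v).toLinearMap.ker with hW
    have hWt : W ≠ ⊤ := by
      intro ht
      have : v ∈ W := ht ▸ Submodule.mem_top
      rw [hW, LinearMap.mem_ker] at this
      exact hvv this
    have hz := Measure.addHaar_submodule (volume : Measure (Euc m)) W hWt
    set z : Euc m := ((l.2 - k.2) / inner ℝ v v) • v with hzdef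
    have : {x | affineVal k x = affineVal l x} = (fun x => x + -z) ⁻¹' (W : Set (Euc m)) := by
      ext x
      have h3 : inner ℝ v z = l.2 - k.2 := by
        rw [hzdef, real_inner_smul_right, div_mul_cancel₀ _ hvv]
      have h4 : inner ℝ v x = inner ℝ k.1 x - inner ℝ l.1 x := by rw [hv, inner_sub_left]
      simp only [Set.mem_ofPred_eq, Set.mem_preimage, SetLike.mem_coe, hW, LinearMap.mem_ker,
        ContinuousLinearMap.coe_coe, innerSL_apply_apply, inner_add_right, inner_neg_right, h3, h4,
        affineVal]
      constructor <;> intro h5 <;> linarith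
    rw [this, measure_preimage_add_right, hz]

/-- Distinct affine functions agree at most on a hyperplane. The conclusion is equality of the
functions and not of the indices, since the family may contain repetitions. -/
theorem ae_affineVal_injective {ι : Type*} [Finite ι] (k : ι → Euc m × ℝ) :
    ∀ᵐ x ∂(volume : Measure (Euc m)), ∀ i j, affineVal (k i) x = affineVal (k j) x → k i = k j := by
  rw [ae_all_iff]
  intro i
  rw [ae_all_iff]
  intro j
  by_cases h : k i = k j
  · simp [h]
  · filter_upwards [measure_eq_zero_iff_ae_notMem.1 (volume_affineVal_eq h)] with x hx hx'
    exact absurd hx' hx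

/-- Away from ties between distinct functions, a minimizing index stays minimizing nearby, so the
minimum is affine near almost every point. -/
theorem eventually_affineVal_le {ι : Type*} [Finite ι] {k : ι → Euc m × ℝ} {x : Euc m} {i : ι}
    (hx : ∀ j, affineVal (k i) x = affineVal (k j) x → k i = k j)
    (hi : ∀ j, affineVal (k i) x ≤ affineVal (k j) x) :
    ∀ᶠ y in 𝓝 x, ∀ j, affineVal (k i) y ≤ affineVal (k j) y := by
  rw [eventually_all]
  intro j
  rcases (hi j).lt_or_eq with h | h
  · filter_upwards [((continuous_affineVal _).tendsto x).eventually_lt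
      ((continuous_affineVal _).tendsto x) h] with y hy using hy.le
  · exact Eventually.of_forall fun y => by rw [hx j h]

theorem exists_lipschitzWith_inf {ι : Type*} [Fintype ι] (k : ι → Euc m × ℝ) (f : Euc m → ℝ)
    (hle : ∀ x i, f x ≤ affineVal (k i) x) (hex : ∀ x, ∃ i, f x = affineVal (k i) x) :
    ∃ C, LipschitzWith C f := by
  refine ⟨∑ i, ‖(k i).1‖₊, LipschitzWith.of_le_add_mul _ fun x y => ?_⟩
  obtain ⟨i, hi⟩ := hex y
  rw [hi]
  refine (hle x i).trans ?_
  have h1 : affineVal (k i) x = affineVal (k i) y + inner ℝ (k i).1 (x - y) := by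
    rw [affineVal, affineVal, inner_sub_right]
    ring
  rw [h1, dist_eq_norm]
  gcongr
  refine (real_inner_le_norm _ _).trans ?_
  gcongr
  push_cast
  exact Finset.single_le_sum (f := fun i => ‖(k i).1‖) (fun i _ => norm_nonneg _)
    (Finset.mem_univ i)

/-- The map is a translation after a transvection along `n` with determinant -l / (1 - l). In the
building block it carries the face with slope l n onto the face with slope -(1 - l) n, which fixes
the ratio of their volumes. -/
theorem volume_preimage_reflect {n : Euc m} (hn : ‖n‖ = 1) {l : ℝ} (hl : l ∈ Set.Ioo (0 : ℝ) 1)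
    (A : Set (Euc m)) :
    volume ((fun x => x + (1 - inner ℝ n x / (1 - l)) • n) ⁻¹' A) =
      ENNReal.ofReal ((1 - l) / l) * volume A := by
  have h1l : 1 - l ≠ 0 := (sub_pos.2 hl.2).ne'
  set T := LinearMap.transvection ((-(1 - l)⁻¹) • (innerSL ℝ n).toLinearMap) n with hT
  have hdet : LinearMap.det T = - (l / (1 - l)) := by
    rw [hT, LinearMap.transvection.det]
    simp only [LinearMap.smul_apply, ContinuousLinearMap.coe_coe, innerSL_apply_apply,
      real_inner_self_eq_norm_sq, hn, smul_eq_mul]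
    field_simp
    ring
  have h2 : (fun x : Euc m => x + (1 - inner ℝ n x / (1 - l)) • n) ⁻¹' A =
      T ⁻¹' ((fun x => x + n) ⁻¹' A) := by
    ext x
    have : x + (1 - inner ℝ n x / (1 - l)) • n = T x + n := by
      simp only [hT, LinearMap.transvection.apply, LinearMap.smul_apply,
        ContinuousLinearMap.coe_coe, innerSL_apply_apply, smul_eq_mul]
      rw [sub_smul, one_smul, div_eq_inv_mul, neg_mul, neg_smul]
      abel
    simp only [Set.mem_preimage, this]
  have hl0 : l ≠ 0 := hl.1.ne'
  rw [h2, Measure.addHaar_preimage_linearMap, measure_preimage_add_right, hdet]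
  · congr 2
    rw [inv_neg, abs_neg, inv_div, abs_of_pos (div_pos (sub_pos.2 hl.2) hl.1)]
  · rw [hdet]
    exact neg_ne_zero.2 (div_ne_zero hl0 h1l)

/-- Near `x` the function `f` is affine with gradient `v`. -/
def ScalarAffineNear (f : Euc m → ℝ) (v x : Euc m) : Prop :=
  ∃ c, ∀ᶠ y in 𝓝 x, f y = affineVal (v, c) y

-- A tent over the slab 0 < ⟨n, x⟩ < 1 has the slopes l n and -(1 - l) n. Cutting it off sideways by
-- very shallow planes makes the support bounded. The sets `A` and `A'` are the two tent faces, and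
-- `E` is where a shallow plane is lowest. That `D` is star-shaped with respect to the origin serves
-- both to show that `E` is small and, later, to dilate `D`.
open scoped Pointwise in
theorem exists_scalar_block {n : Euc m} (hn : ‖n‖ = 1) {l : ℝ} (hl : l ∈ Set.Ioo (0 : ℝ) 1)
    {δ η : ℝ} (hδ : 0 < δ) (hη : η ∈ Set.Ioo (0 : ℝ) 1) :
    ∃ (D E A A' : Set (Euc m)) (f : Euc m → ℝ) (C : NNReal),
      IsOpen D ∧ Bornology.IsBounded D ∧ D.Nonempty ∧ Convex ℝ D ∧
      (∀ t ∈ Set.Ioc (0 : ℝ) 1, ∀ x ∈ D, t • x ∈ D) ∧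
      LipschitzWith C f ∧ (∀ x ∉ D, f x = 0) ∧ E ⊆ D ∧ IsOpen E ∧
      MeasurableSet A ∧ MeasurableSet A' ∧ A ⊆ D \ E ∧ A' ⊆ D \ E ∧ Disjoint A A' ∧
      (∀ᵐ x ∂(volume : Measure (Euc m)), x ∈ D \ E → x ∈ A ∪ A') ∧
      (∀ᵐ x ∂(volume : Measure (Euc m)), x ∈ A → ScalarAffineNear f (l • n) x) ∧
      (∀ᵐ x ∂(volume : Measure (Euc m)), x ∈ A' → ScalarAffineNear f (-(1 - l) • n) x) ∧
      (∀ᵐ x ∂(volume : Measure (Euc m)), x ∈ E → ∃ v, ‖v‖ ≤ δ ∧ ScalarAffineNear f v x) ∧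
      (∀ᵐ x ∂(volume : Measure (Euc m)), x ∈ D → x ∉ E → ∀ᶠ y in 𝓝 x, y ∉ E) ∧
      volume A = ENNReal.ofReal (1 - l) * volume (D \ E) ∧
      volume A' = ENNReal.ofReal l * volume (D \ E) ∧
      ENNReal.ofReal (1 - η) * volume D ≤ volume (D \ E) := by
  obtain ⟨hl0, hl1⟩ := hl
  obtain ⟨hη0, hη1⟩ := hη
  have hnn : inner ℝ n n = 1 := by rw [real_inner_self_eq_norm_sq, hn, one_pow]
  have h1l : 0 < 1 - l := sub_pos.2 hl1
  -- The contraction factor `t` and the transversal size `R`.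
  obtain ⟨t, ht0, ht1, htm⟩ : ∃ t : ℝ, 0 < t ∧ t < 1 ∧ 1 - η ≤ t ^ m := by
    have hlim : Tendsto (fun t : ℝ => t ^ m) (𝓝[<] 1) (𝓝 1) := by
      have := (continuous_pow m : Continuous fun t : ℝ => t ^ m).tendsto 1
      rw [one_pow] at this
      exact this.mono_left nhdsWithin_le_nhds
    have h1 := hlim.eventually (lt_mem_nhds (show 1 - η < 1 by linarith))
    have h2 : ∀ᶠ t : ℝ in 𝓝[<] 1, t ∈ Set.Ioo (0 : ℝ) 1 :=
      Ioo_mem_nhdsLT one_pos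
    obtain ⟨t, h3, h4⟩ := (h1.and h2).exists
    exact ⟨t, h4.1, h4.2, h3.le⟩
  have h1t : 0 < 1 - t := sub_pos.2 ht1
  set ε : ℝ := δ / 2 with hε
  have hε0 : 0 < ε := by positivity
  -- This size makes the side planes at least 1 on `t • D`, which is above the rising face l ⟨n, x⟩
  -- < 1.
  set R : ℝ := 1 / (ε * (1 - t)) with hR
  have hR0 : 0 < R := by positivity
  have hRt : ε * ((1 - t) * R) = 1 := by
    rw [hR]
    field_simp
  set sg : Bool → ℝ := fun b => if b then 1 else -1 with hsg
  set pr : Fin m → Euc m → ℝ := fun j x => x j - n j * inner ℝ n x with hpr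
  -- The two tent faces, and for each coordinate of the component orthogonal to `n` two shallow
  -- planes. Their slopes have norm at most 2ε = δ.
  set k : Bool ⊕ (Fin m × Bool) → Euc m × ℝ := Sum.elim
    (fun b => if b then (l • n, 0) else (-(1 - l) • n, 1 - l))
    (fun jb => ((sg jb.2 * ε) • (EuclideanSpace.single jb.1 1 - n jb.1 • n), ε * R)) with hk
  have vu : ∀ x, affineVal (k (Sum.inl true)) x = l * inner ℝ n x := fun x => by
    simp [hk, affineVal, real_inner_smul_left]
  have vd : ∀ x, affineVal (k (Sum.inl false)) x = (1 - l) * (1 - inner ℝ n x) := fun x => by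
    simp only [hk, affineVal, Sum.elim_inl, Bool.false_eq_true, if_false, real_inner_smul_left]
    ring
  have vp : ∀ j b x, affineVal (k (Sum.inr (j, b))) x = ε * (R + sg b * pr j x) := fun j b x => by
    simp only [hk, affineVal, Sum.elim_inr, real_inner_smul_left, inner_sub_left, hpr,
      EuclideanSpace.inner_single_left]
    simp
    ring
  have hkne : k (Sum.inl true) ≠ k (Sum.inl false) := by
    intro h
    have := congrArg Prod.snd h
    simp [hk] at this
    linarith
  set f₀ : Euc m → ℝ := fun x =>
    Finset.univ.inf' ⟨Sum.inl true, Finset.mem_univ _⟩ fun i => affineVal (k i) x with hf₀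
  have hle : ∀ x i, f₀ x ≤ affineVal (k i) x := fun x i =>
    Finset.inf'_le _ (Finset.mem_univ i)
  have hex : ∀ x, ∃ i, f₀ x = affineVal (k i) x := fun x => by
    obtain ⟨i, -, hi⟩ := Finset.exists_mem_eq_inf' (s := Finset.univ)
      ⟨Sum.inl true, Finset.mem_univ _⟩ fun i => affineVal (k i) x
    exact ⟨i, hi⟩
  obtain ⟨C, hC⟩ := exists_lipschitzWith_inf k f₀ hle hex
  set D : Set (Euc m) := {x | 0 < f₀ x} with hD
  have hDk : ∀ x, x ∈ D ↔ ∀ i, 0 < affineVal (k i) x := fun x => by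
    constructor
    · exact fun h i => lt_of_lt_of_le h (hle x i)
    · intro h
      obtain ⟨i, hi⟩ := hex x
      change 0 < f₀ x
      rw [hi]
      exact h i
  have hDs : ∀ x, x ∈ D ↔ 0 < inner ℝ n x ∧ inner ℝ n x < 1 ∧ ∀ j, |pr j x| < R := fun x => by
    rw [hDk]
    constructor
    · intro h
      have h1 := h (Sum.inl true)
      have h2 := h (Sum.inl false)
      rw [vu] at h1
      rw [vd] at h2
      refine ⟨pos_of_mul_pos_right h1 hl0.le, ?_, fun j => ?_⟩
      · have := pos_of_mul_pos_right h2 h1l.le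
        linarith
      · have h3 := h (Sum.inr (j, true))
        have h4 := h (Sum.inr (j, false))
        rw [vp] at h3 h4
        have h5 := pos_of_mul_pos_right h3 hε0.le
        have h6 := pos_of_mul_pos_right h4 hε0.le
        simp [hsg] at h5 h6
        rw [abs_lt]
        constructor <;> linarith
    · rintro ⟨h1, h2, h3⟩ (_ | ⟨j, _⟩)
      · rename_i b
        cases b
        · rw [vd]
          exact mul_pos h1l (by linarith)
        · rw [vu]
          positivity
      · have := abs_lt.1 (h3 j)
        rw [vp]
        refine mul_pos hε0 ?_
        rename_i b
        cases b <;> simp [hsg] <;> linarith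
  set E : Set (Euc m) := {x | 0 < f₀ x ∧ f₀ x < affineVal (k (Sum.inl true)) x ∧
    f₀ x < affineVal (k (Sum.inl false)) x} with hE
  set A : Set (Euc m) := {x | 0 < f₀ x ∧ f₀ x = affineVal (k (Sum.inl true)) x ∧
    affineVal (k (Sum.inl true)) x < affineVal (k (Sum.inl false)) x} with hA
  set A' : Set (Euc m) := {x | 0 < f₀ x ∧ f₀ x = affineVal (k (Sum.inl false)) x ∧
    affineVal (k (Sum.inl false)) x < affineVal (k (Sum.inl true)) x} with hA'
  have hcf := hC.continuous
  have hck := fun i => continuous_affineVal (k i)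
  have hDo : IsOpen D := isOpen_lt continuous_const hcf
  have hEo : IsOpen E := hDo.inter ((isOpen_lt hcf (hck _)).inter (isOpen_lt hcf (hck _)))
  have hAm : MeasurableSet A := hDo.measurableSet.inter
    ((isClosed_eq hcf (hck _)).measurableSet.inter (isOpen_lt (hck _) (hck _)).measurableSet)
  have hA'm : MeasurableSet A' := hDo.measurableSet.inter
    ((isClosed_eq hcf (hck _)).measurableSet.inter (isOpen_lt (hck _) (hck _)).measurableSet)
  have hAD : A ⊆ D \ E := fun x hx => ⟨hx.1, fun h => h.2.1.ne hx.2.1⟩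
  have hA'D : A' ⊆ D \ E := fun x hx => ⟨hx.1, fun h => h.2.2.ne hx.2.1⟩
  have hAA' : Disjoint A A' := Set.disjoint_left.2 fun x hx hx' => lt_asymm hx.2.2 hx'.2.2
  have hDb : Bornology.IsBounded D := by
    rw [isBounded_iff_forall_norm_le]
    refine ⟨√(∑ _j : Fin m, (R + 1) ^ 2), fun x hx => ?_⟩
    obtain ⟨h1, h2, h3⟩ := (hDs x).1 hx
    rw [EuclideanSpace.norm_eq]
    refine Real.sqrt_le_sqrt (Finset.sum_le_sum fun j _ => ?_)
    have h4 : x j = pr j x + n j * inner ℝ n x := by simp [hpr]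
    have h5 : |n j| ≤ 1 := by
      have := PiLp.norm_apply_le n j
      rwa [hn, Real.norm_eq_abs] at this
    rw [Real.norm_eq_abs]
    gcongr
    rw [h4]
    refine (abs_add_le _ _).trans (add_le_add (h3 j).le ?_)
    rw [abs_mul, abs_of_pos h1]
    exact mul_le_one₀ h5 h1.le h2.le
  have hDne : D.Nonempty := by
    refine ⟨(1 / 2 : ℝ) • n, (hDs _).2 ⟨?_, ?_, fun j => ?_⟩⟩
    · rw [real_inner_smul_right, hnn]; norm_num
    · rw [real_inner_smul_right, hnn]; norm_num
    · simp only [hpr, real_inner_smul_right, hnn, PiLp.smul_apply, smul_eq_mul]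
      rw [show 1 / 2 * n j - n j * (1 / 2 * 1) = 0 by ring, abs_zero]
      exact hR0
  have hprs : ∀ j (c : ℝ) x, pr j (c • x) = c * pr j x := fun j c x => by
    simp only [hpr, real_inner_smul_right, PiLp.smul_apply, smul_eq_mul]
    ring
  have hDstar : ∀ c ∈ Set.Ioc (0 : ℝ) 1, ∀ x ∈ D, c • x ∈ D := by
    intro c hc x hx
    obtain ⟨h1, h2, h3⟩ := (hDs x).1 hx
    refine (hDs _).2 ⟨?_, ?_, fun j => ?_⟩
    · rw [real_inner_smul_right]
      exact mul_pos hc.1 h1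
    · rw [real_inner_smul_right]
      nlinarith [hc.1, hc.2]
    · rw [hprs, abs_mul, abs_of_pos hc.1]
      have := abs_nonneg (pr j x)
      nlinarith [hc.1, hc.2, h3 j]
  have hDconv : Convex ℝ D := by
    have : D = ⋂ i, {x | -(k i).2 < inner ℝ (k i).1 x} := by
      ext x
      rw [hDk]
      simp only [Set.mem_iInter, Set.mem_ofPred_eq, affineVal]
      refine forall_congr' fun i => ?_
      constructor <;> intro h <;> linarith
    rw [this]
    exact convex_iInter fun i => convex_halfSpace_gt (innerSL ℝ (k i).1).isLinear _
  have hnear : ∀ {x i}, (∀ i j, affineVal (k i) x = affineVal (k j) x → k i = k j) →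
      0 < f₀ x → f₀ x = affineVal (k i) x →
      ∀ᶠ y in 𝓝 x, max (f₀ y) 0 = affineVal (k i) y ∧ f₀ y = affineVal (k i) y := by
    intro x i hx h0 hi
    filter_upwards [eventually_affineVal_le (hx i) fun j => hi ▸ hle x j, hDo.mem_nhds h0]
      with y hy hy0
    have : f₀ y = affineVal (k i) y := by
      obtain ⟨j, hj⟩ := hex y
      exact le_antisymm (hle y i) (hj ▸ hy j)
    exact ⟨by rw [max_eq_left (le_of_lt hy0), this], this⟩
  have hae := ae_affineVal_injective k
  have hcovx : ∀ {x}, (∀ i j, affineVal (k i) x = affineVal (k j) x → k i = k j) →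
      x ∈ D \ E → x ∈ A ∪ A' := by
    intro x hx ⟨hxD, hxE⟩
    have hne : affineVal (k (Sum.inl true)) x ≠ affineVal (k (Sum.inl false)) x :=
      fun h => hkne (hx _ _ h)
    by_cases h1 : f₀ x = affineVal (k (Sum.inl true)) x
    · exact Or.inl ⟨hxD, h1, lt_of_le_of_ne (h1 ▸ hle x _) hne⟩
    · by_cases h2 : f₀ x = affineVal (k (Sum.inl false)) x
      · exact Or.inr ⟨hxD, h2, lt_of_le_of_ne (h2 ▸ hle x _) hne.symm⟩
      · exact absurd ⟨hxD, lt_of_le_of_ne (hle x _) h1, lt_of_le_of_ne (hle x _) h2⟩ hxE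
  -- The reflection preserves the orthogonal component, hence all side planes. It gives the falling
  -- face at the image the value of the rising face at the point, and it preserves the comparison
  -- that decides which face is lower.
  have hvolA : volume A = ENNReal.ofReal ((1 - l) / l) * volume A' := by
    rw [← volume_preimage_reflect hn ⟨hl0, hl1⟩ A']
    congr 1
    ext x
    set y := x + (1 - inner ℝ n x / (1 - l)) • n with hy
    have hiy : inner ℝ n y = 1 - l / (1 - l) * inner ℝ n x := by
      rw [hy, inner_add_right, real_inner_smul_right, hnn]
      field_simp
      ring
    have hpy : ∀ j, pr j y = pr j x := fun j => by
      have hyj : y j = x j + (1 - inner ℝ n x / (1 - l)) * n j := by simp [hy]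
      simp only [hpr]
      rw [hiy, hyj]
      field_simp
      ring
    have e1 : affineVal (k (Sum.inl false)) y = affineVal (k (Sum.inl true)) x := by
      rw [vd, vu, hiy]
      field_simp
      ring
    have e2 : affineVal (k (Sum.inl true)) y - affineVal (k (Sum.inl false)) y =
        l / (1 - l) * (affineVal (k (Sum.inl false)) x - affineVal (k (Sum.inl true)) x) := by
      rw [e1, vu, vu, vd, hiy]
      field_simp
      ring
    have e3 : ∀ j b, affineVal (k (Sum.inr (j, b))) y = affineVal (k (Sum.inr (j, b))) x :=
      fun j b => by rw [vp, vp, hpy]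
    have hlt : affineVal (k (Sum.inl false)) y < affineVal (k (Sum.inl true)) y ↔
        affineVal (k (Sum.inl true)) x < affineVal (k (Sum.inl false)) x := by
      rw [← sub_pos, e2, mul_pos_iff_of_pos_left (by positivity), sub_pos]
    have hmin : ∀ {z b}, affineVal (k (Sum.inl b)) z < affineVal (k (Sum.inl !b)) z →
        (f₀ z = affineVal (k (Sum.inl b)) z ↔
          ∀ j b', affineVal (k (Sum.inl b)) z ≤ affineVal (k (Sum.inr (j, b'))) z) := by
      intro z b hb
      constructor
      · exact fun h j b' => h ▸ hle z _
      · intro h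
        obtain ⟨i, hi⟩ := hex z
        refine le_antisymm (hle z _) ?_
        rw [hi]
        rcases i with b'' | ⟨j, b'⟩
        · rcases Bool.eq_or_eq_not b'' b with h' | h'
          · rw [h']
          · rw [h']
            exact hb.le
        · exact h j b'
    change _ ↔ y ∈ A'
    constructor
    · rintro ⟨h1, h2, h3⟩
      have h4 := hlt.2 h3
      have h5 : f₀ y = affineVal (k (Sum.inl false)) y := by
        rw [hmin h4]
        intro j b
        rw [e1, e3]
        exact (hmin h3).1 h2 j b
      exact ⟨by rw [h5, e1, ← h2]; exact h1, h5, h4⟩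
    · rintro ⟨h1, h2, h3⟩
      have h4 := hlt.1 h3
      have h5 : f₀ x = affineVal (k (Sum.inl true)) x := by
        rw [hmin h4]
        intro j b
        rw [← e1, ← e3]
        exact (hmin h3).1 h2 j b
      exact ⟨by rw [h5, ← e1, ← h2]; exact h1, h5, h4⟩
  have hvolDE : volume (D \ E) = volume A + volume A' := by
    rw [← measure_union hAA' hA'm]
    refine measure_congr ?_
    filter_upwards [hae] with x hx
    exact propext ⟨fun h => hcovx hx h, fun h => Set.union_subset hAD hA'D h⟩
  have hvolA' : volume A' = ENNReal.ofReal l * volume (D \ E) := by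
    rw [hvolDE, hvolA, ← one_mul (volume A'), ← mul_assoc, ← add_mul, ← mul_assoc,
      ← ENNReal.ofReal_one, ← ENNReal.ofReal_mul (by positivity),
      ← ENNReal.ofReal_add (by positivity) zero_le_one, ← ENNReal.ofReal_mul hl0.le]
    congr 2
    field_simp
    ring
  refine ⟨D, E, A, A', fun x => max (f₀ x) 0, C, hDo, hDb, hDne, hDconv, hDstar, hC.max_const 0,
    fun x hx => max_eq_right (not_lt.1 hx), fun x hx => hx.1, hEo, hAm, hA'm, hAD, hA'D, hAA',
    ?_, ?_, ?_, ?_, ?_, ?_, hvolA', ?_⟩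
  · filter_upwards [hae] with x hx using hcovx hx
  · filter_upwards [hae] with x hx hxA
    refine ⟨0, ?_⟩
    filter_upwards [hnear hx hxA.1 hxA.2.1] with y hy using hy.1
  · filter_upwards [hae] with x hx hxA
    refine ⟨1 - l, ?_⟩
    filter_upwards [hnear hx hxA.1 hxA.2.1] with y hy using hy.1
  · filter_upwards [hae] with x hx hxE
    obtain ⟨i, hi⟩ := hex x
    rcases i with b | ⟨j, b⟩
    · cases b
      · exact absurd hi hxE.2.2.ne
      · exact absurd hi hxE.2.1.ne
    · refine ⟨(k (Sum.inr (j, b))).1, ?_, (k (Sum.inr (j, b))).2, ?_⟩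
      · have h1 : |sg b * ε| = ε := by
          rw [abs_mul, abs_of_pos hε0]
          cases b <;> simp [hsg]
        have h2 : ‖n j • n‖ ≤ 1 := by
          rw [norm_smul, hn, mul_one]
          have := PiLp.norm_apply_le n j
          rwa [hn] at this
        have h3 : ‖(EuclideanSpace.single j 1 : Euc m)‖ = 1 := by simp
        simp only [hk, Sum.elim_inr, norm_smul, Real.norm_eq_abs, h1]
        have := norm_sub_le (EuclideanSpace.single j 1 : Euc m) (n j • n)
        nlinarith
      · filter_upwards [hnear hx hxE.1 hi] with y hy using hy.1
  · filter_upwards [hae] with x hx hxD hxE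
    rcases hcovx hx ⟨hxD, hxE⟩ with h | h
    · filter_upwards [hnear hx h.1 h.2.1] with y hy hyE using hyE.2.1.ne hy.2
    · filter_upwards [hnear hx h.1 h.2.1] with y hy hyE using hyE.2.2.ne hy.2
  · rw [hvolA, hvolA', ← mul_assoc, ← ENNReal.ofReal_mul (by positivity)]
    congr 2
    field_simp
  · have hsub : t • D ⊆ D \ E := by
      rintro _ ⟨y, hy, rfl⟩
      refine ⟨hDstar t ⟨ht0, ht1.le⟩ y hy, ?_⟩
      rintro ⟨h1, h2, h3⟩
      obtain ⟨g1, g2, g3⟩ := (hDs _).1 (hDstar t ⟨ht0, ht1.le⟩ y hy)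
      obtain ⟨i, hi⟩ := hex (t • y)
      simp only at h1 h2 h3 g1 g2 g3
      rw [hi] at h2 h3
      rcases i with b | ⟨j, b⟩
      · cases b
        · exact lt_irrefl _ h3
        · exact lt_irrefl _ h2
      · rw [vp, vu, hprs] at h2
        have h4 : -R ≤ sg b * pr j y := by
          have := abs_lt.1 (((hDs y).1 hy).2.2 j)
          cases b <;> simp [hsg] <;> linarith
        have h5 : ε * ((1 - t) * R) ≤ ε * (R + sg b * (t * pr j y)) := by
          gcongr
          nlinarith
        rw [hRt] at h5
        nlinarith
    calc ENNReal.ofReal (1 - η) * volume D ≤ ENNReal.ofReal (t ^ m) * volume D := by gcongr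
      _ = volume (t • D) := by
        rw [Measure.addHaar_smul]
        simp [abs_of_pos ht0]
      _ ≤ _ := measure_mono hsub

theorem ScalarAffineNear.affineNear {f : Euc m → ℝ} {v x : Euc m} (h : ScalarAffineNear f v x)
    (a : Euc d) : AffineNear (fun y => f y • a) (tensor a v) x := by
  obtain ⟨c, hc⟩ := h
  refine ⟨c • a, ?_⟩
  filter_upwards [hc] with y hy
  rw [hy, affineFun_eq, linMap_tensor, affineVal, add_smul]

theorem map_restrict_of_ae_eq {α β : Type*} [MeasurableSpace α] [MeasurableSpace β]
    {μ : Measure α} {A : Set α} (hA : MeasurableSet A) {g : α → β} {Y : β}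
    (h : ∀ᵐ x ∂μ, x ∈ A → g x = Y) : (μ.restrict A).map g = μ A • Measure.dirac Y := by
  have : g =ᵐ[μ.restrict A] fun _ => Y := (ae_restrict_iff' hA).2 h
  rw [Measure.map_congr this, Measure.map_const, Measure.restrict_apply_univ]

/-- The scalar block times `a` splits the whole mass in its support `D`. To split only a portion θ,
`D` is placed in a dilate `Q` of volume |D| / θ; on `Q \ D` the map is zero and the gradient is
unchanged. The number `κ` is the share of `D` outside the error set. -/
theorem exists_block (a : Euc d) {n : Euc m} (hn : ‖n‖ = 1) {l : ℝ} (hl : l ∈ Set.Ioo (0 : ℝ) 1)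
    {θ : ℝ} (hθ : θ ∈ Set.Ioc (0 : ℝ) 1) {δ η : ℝ} (hδ : 0 < δ) (hη : η ∈ Set.Ioo (0 : ℝ) 1) :
    ∃ (Q E : Set (Euc m)) (ψ : Euc m → Euc d) (C : NNReal) (κ : ℝ),
      IsOpen Q ∧ Bornology.IsBounded Q ∧ Q.Nonempty ∧ volume (frontier Q) = 0 ∧
      LipschitzWith C ψ ∧ (∀ x ∉ Q, ψ x = 0) ∧ E ⊆ Q ∧ MeasurableSet E ∧
      (∀ᵐ x ∂(volume : Measure (Euc m)), x ∈ Q → IsGood ψ E x) ∧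
      (∀ᵐ x ∂(volume : Measure (Euc m)), x ∈ E → ‖grad ψ x‖ ≤ δ) ∧
      1 - η ≤ κ ∧ κ ≤ 1 ∧ volume E ≤ ENNReal.ofReal η * volume Q ∧
      (volume.restrict (Q \ E)).map (grad ψ) = volume Q •
        (ENNReal.ofReal (κ * θ * (1 - l)) • Measure.dirac (l • tensor a n) +
          ENNReal.ofReal (κ * θ * l) • Measure.dirac (-(1 - l) • tensor a n) +
          ENNReal.ofReal (1 - θ) • Measure.dirac 0) := by
  obtain ⟨D, E, A, A', f, C, hDo, hDb, hDne, hDc, hstar, hC, hf0, hED, hEo, hAm, hA'm, hAD, hA'D,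
    hAA', hcov, hAg, hA'g, hEg, hEc, hvA, hvA', hvD⟩ :=
    exists_scalar_block hn hl (δ := δ / (‖a‖ + 1)) (by positivity) hη
  obtain ⟨hθ0, hθ1⟩ := hθ
  have hm : m ≠ 0 := by
    rintro rfl
    have : n = 0 := Subsingleton.elim _ _
    rw [this, norm_zero] at hn
    exact zero_ne_one hn
  -- Dilation by 1 / t multiplies volumes by 1 / t ^ m = 1 / θ.
  set t : ℝ := θ ^ ((m : ℝ)⁻¹) with ht
  have ht0 : 0 < t := by positivity
  have ht1 : t ≤ 1 := Real.rpow_le_one hθ0.le hθ1 (by positivity)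
  have htm : t ^ m = θ := Real.rpow_inv_natCast_pow hθ0.le hm
  set Q : Set (Euc m) := (fun x => t • x) ⁻¹' D with hQ
  have hQo : IsOpen Q := hDo.preimage (continuous_const_smul t)
  have hDQ : D ⊆ Q := fun x hx => hstar t ⟨ht0, ht1⟩ x hx
  have hvDQ : volume D = ENNReal.ofReal θ * volume Q := by
    rw [hQ, Measure.addHaar_preimage_smul _ ht0.ne', ← mul_assoc, ← ENNReal.ofReal_mul hθ0.le]
    have : θ * |(t ^ Module.finrank ℝ (Euc m))⁻¹| = 1 := by
      rw [finrank_euclideanSpace_fin, htm, abs_of_pos (by positivity), mul_inv_cancel₀ hθ0.ne']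
    rw [this, ENNReal.ofReal_one, one_mul]
  have hDpos : volume D ≠ 0 := (hDo.measure_pos volume hDne).ne'
  have hDtop : volume D ≠ ⊤ := hDb.measure_lt_top.ne
  set κ : ℝ := (volume (D \ E) / volume D).toReal with hκ
  have hDE : volume (D \ E) ≤ volume D := measure_mono Set.sdiff_subset
  have hκ1 : volume (D \ E) / volume D ≤ 1 := ENNReal.div_le_of_le_mul (by rwa [one_mul])
  have hκD : volume (D \ E) = ENNReal.ofReal κ * volume D := by
    rw [hκ, ENNReal.ofReal_toReal (hκ1.trans_lt ENNReal.one_lt_top).ne,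
      ENNReal.div_mul_cancel hDpos hDtop]
  have hκ0 : 0 ≤ κ := ENNReal.toReal_nonneg
  have hlower : 1 - η ≤ κ := by
    have : ENNReal.ofReal (1 - η) ≤ volume (D \ E) / volume D := by
      rw [ENNReal.le_div_iff_mul_le (Or.inl hDpos) (Or.inl hDtop)]
      exact hvD
    rw [hκ]
    refine (ENNReal.ofReal_le_iff_le_toReal (hκ1.trans_lt ENNReal.one_lt_top).ne).1 this
  have hvolE : volume E ≤ ENNReal.ofReal η * volume D := by
    have h1 : volume (D \ E) + volume E = volume D := by
      rw [← measure_union Set.disjoint_sdiff_left hEo.measurableSet,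
        Set.sdiff_union_of_subset hED]
    have h2 : ENNReal.ofReal (1 - η) * volume D + volume E ≤
        ENNReal.ofReal (1 - η) * volume D + ENNReal.ofReal η * volume D := by
      rw [← add_mul, ← ENNReal.ofReal_add (by linarith [hη.2]) hη.1.le, sub_add_cancel,
        ENNReal.ofReal_one, one_mul, ← h1]
      gcongr
      exact h1 ▸ hvD
    exact (ENNReal.add_le_add_iff_left (ENNReal.mul_ne_top ENNReal.ofReal_ne_top hDtop)).1 h2
  set ψ : Euc m → Euc d := fun y => f y • a with hψ
  have hψL : LipschitzWith (C * ‖a‖₊) ψ := by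
    refine LipschitzWith.of_dist_le_mul fun x y => ?_
    rw [dist_eq_norm, hψ]
    simp only
    rw [← sub_smul, norm_smul, ← dist_eq_norm]
    push_cast
    calc dist (f x) (f y) * ‖a‖ ≤ (C * dist x y) * ‖a‖ := by
          gcongr
          exact hC.dist_le_mul x y
      _ = _ := by ring
  have hfr : ∀ᵐ x ∂(volume : Measure (Euc m)), x ∉ frontier D :=
    measure_eq_zero_iff_ae_notMem.1 (hDc.addHaar_frontier _)
  have hout : ∀ {x}, x ∉ D → x ∉ frontier D → ∀ᶠ y in 𝓝 x, y ∉ D := by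
    intro x hx hxf
    have : x ∉ closure D := fun h => hxf ⟨h, by rwa [hDo.interior_eq]⟩
    filter_upwards [isClosed_closure.isOpen_compl.mem_nhds this] with y hy hyD
    exact hy (subset_closure hyD)
  have hout' : ∀ {x}, x ∉ D → x ∉ frontier D → AffineNear ψ 0 x := by
    intro x hx hxf
    refine affineNear_zero ?_
    filter_upwards [hout hx hxf] with y hy
    rw [hψ]
    simp only [hf0 y hy, zero_smul]
  have hAfin := hAg.mono fun x hx hxA => (hx hxA).affineNear a
  have hA'fin := hA'g.mono fun x hx hxA => (hx hxA).affineNear a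
  refine ⟨Q, E, ψ, C * ‖a‖₊, κ, hQo, ?_, hDne.mono hDQ, ?_, hψL, ?_, hED.trans hDQ,
    hEo.measurableSet, ?_, ?_, hlower, ?_, ?_, ?_⟩
  · rw [isBounded_iff_forall_norm_le] at hDb ⊢
    obtain ⟨b, hb⟩ := hDb
    refine ⟨t⁻¹ * b, fun x hx => ?_⟩
    have := hb _ hx
    rw [norm_smul, Real.norm_of_nonneg ht0.le] at this
    rwa [le_inv_mul_iff₀ ht0]
  · exact (hDc.smul_preimage t).addHaar_frontier _
  · intro x hx
    rw [hψ]
    simp only [hf0 x fun h => hx (hDQ h), zero_smul]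
  · filter_upwards [hAfin, hA'fin, hEg, hEc, hcov, hfr] with x h1 h2 h3 h4 h5 h6 hx
    by_cases hxE : x ∈ E
    · obtain ⟨v, -, hv⟩ := h3 hxE
      refine .of_affineNear (hv.affineNear a) ?_
      filter_upwards [hEo.mem_nhds hxE] with y hy using ⟨fun _ => hxE, fun _ => hy⟩
    · by_cases hxD : x ∈ D
      · have hE' : ∀ᶠ y in 𝓝 x, (y ∈ E ↔ x ∈ E) := by
          filter_upwards [h4 hxD hxE] with y hy
          exact iff_of_false hy hxE
        rcases h5 ⟨hxD, hxE⟩ with h | h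
        · exact .of_affineNear (h1 h) hE'
        · exact .of_affineNear (h2 h) hE'
      · refine .of_affineNear (hout' hxD h6) ?_
        filter_upwards [hout hxD h6] with y hy
        exact iff_of_false (fun h => hy (hED h)) hxE
  · filter_upwards [hEg] with x hx hxE
    obtain ⟨v, hv, hvx⟩ := hx hxE
    rw [(hvx.affineNear a).grad_eq, norm_tensor]
    calc ‖a‖ * ‖v‖ ≤ (‖a‖ + 1) * (δ / (‖a‖ + 1)) := by gcongr; linarith
      _ = δ := by field_simp
  · rw [hκ]
    exact ENNReal.toReal_le_of_le_ofReal zero_le_one (by rwa [ENNReal.ofReal_one])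
  · exact hvolE.trans (by gcongr)
  · have hsplit : (Q \ E : Set (Euc m)) =ᵐ[volume] ((A ∪ A') ∪ (Q \ D) : Set (Euc m)) := by
      filter_upwards [hcov] with x hx
      refine propext ⟨fun h => ?_, fun h => ?_⟩
      · by_cases hxD : x ∈ D
        · exact Or.inl (hx ⟨hxD, h.2⟩)
        · exact Or.inr ⟨h.1, hxD⟩
      · rcases h with (h | h) | h
        · exact ⟨hDQ (hAD h).1, (hAD h).2⟩
        · exact ⟨hDQ (hA'D h).1, (hA'D h).2⟩
        · exact ⟨h.1, fun hE => h.2 (hED hE)⟩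
    have hQD : MeasurableSet (Q \ D) := hQo.measurableSet.diff hDo.measurableSet
    rw [Measure.restrict_congr_set hsplit, Measure.restrict_union _ hQD,
      Measure.restrict_union hAA' hA'm, Measure.map_add _ _ (measurable_grad ψ),
      Measure.map_add _ _ (measurable_grad ψ),
      map_restrict_of_ae_eq hAm (hAfin.mono fun x hx h => (hx h).grad_eq),
      map_restrict_of_ae_eq hA'm (hA'fin.mono fun x hx h => (hx h).grad_eq),
      map_restrict_of_ae_eq hQD (hfr.mono fun x hx h => (hout' h.2 hx).grad_eq)]
    · have hQDv : volume (Q \ D) = ENNReal.ofReal (1 - θ) * volume Q := by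
        have hQtop : volume Q ≠ ⊤ := by
          intro h
          rw [h, ENNReal.mul_top (by simpa using hθ0)] at hvDQ
          exact hDtop hvDQ
        rw [measure_sdiff hDQ hDo.nullMeasurableSet hDtop, hvDQ, ENNReal.ofReal_sub _ hθ0.le,
          ENNReal.sub_mul (fun _ _ => hQtop), ENNReal.ofReal_one, one_mul]
      have hmul : ∀ r, ENNReal.ofReal (κ * θ * r) =
          ENNReal.ofReal κ * ENNReal.ofReal θ * ENNReal.ofReal r := fun r => by
        rw [ENNReal.ofReal_mul (by positivity), ENNReal.ofReal_mul hκ0]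
      rw [hvA, hvA', hQDv, hκD, hvDQ, tensor_smul, tensor_smul, smul_add, smul_add, smul_smul,
        smul_smul, smul_smul, hmul, hmul]
      congr 1
      · congr 2 <;> ring
      · congr 1
        ring
    · refine Set.disjoint_left.2 fun x hx hx' => ?_
      rcases hx with h | h
      · exact hx'.2 (hAD h).1
      · exact hx'.2 (hA'D h).1

/-! ### Perturbations with small Hölder seminorm -/

/-- Interpolation: D = D ^ α D ^ (1 - α), where the first factor is bounded through the Lipschitz
estimate and the second through the small amplitude. -/
theorem exists_sup_bound_holder (L : ℝ) (hL : 0 ≤ L) {α η : ℝ} (hα : α ∈ Set.Ioo (0 : ℝ) 1)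
    (hη : 0 < η) : ∃ s, 0 < s ∧ s ≤ η ∧ ∀ D r : ℝ, 0 ≤ D → 0 ≤ r → D ≤ L * r → D ≤ 2 * s →
      D ≤ η * r ^ α := by
  obtain ⟨hα0, hα1⟩ := hα
  set k : ℝ := (η / (L + 1) ^ α) ^ ((1 - α)⁻¹) with hk
  have hk0 : 0 < k := by positivity
  refine ⟨min η (k / 2), by positivity, min_le_left _ _, fun D r hD hr h1 h2 => ?_⟩
  have h3 : D ≤ k := by
    have := min_le_right η (k / 2)
    linarith
  rcases hD.eq_or_lt with rfl | hD
  · positivity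
  have h4 : D = D ^ α * D ^ (1 - α) := by
    rw [← Real.rpow_add hD]
    simp
  have h5 : k ^ (1 - α) = η / (L + 1) ^ α := by
    rw [hk, ← Real.rpow_mul (by positivity), inv_mul_cancel₀ (by linarith), Real.rpow_one]
  calc D = D ^ α * D ^ (1 - α) := h4
    _ ≤ ((L + 1) * r) ^ α * k ^ (1 - α) := by
      gcongr
      · nlinarith
    _ = η * r ^ α := by
      rw [Real.mul_rpow (by positivity) hr, h5]
      field_simp

/-- The distribution of `A + grad ψ` on `V \ E`. -/
noncomputable def gradDist (V : Set (Euc m)) (A : Mat d m) (ψ : Euc m → Euc d)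
    (E : Set (Euc m)) : Measure (Mat d m) :=
  (volume.restrict (V \ E)).map fun x => A + grad ψ x

theorem measurable_const_add_grad (A : Mat d m) (ψ : Euc m → Euc d) :
    Measurable fun x => A + grad ψ x := (measurable_grad ψ).const_add A

/-- A small perturbation that splits the gradient `A` along one rank-one segment in a portion `θ`
of the open set `V`. -/
theorem exists_split_perturbation (X : Mat d m) (a : Euc d) {n : Euc m} (hn : ‖n‖ = 1) {l : ℝ}
    (hl : l ∈ Set.Ioo (0 : ℝ) 1) {θ : ℝ} (hθ : θ ∈ Set.Ioc (0 : ℝ) 1) {δ η η' α : ℝ} (hδ : 0 < δ)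
    (hη : η ∈ Set.Ioo (0 : ℝ) 1) (hη' : 0 < η') (hα : α ∈ Set.Ioo (0 : ℝ) 1) {V : Set (Euc m)}
    (hV : IsOpen V) :
    ∃ (φ : Euc m → Euc d) (E : Set (Euc m)) (κ : ℝ),
      (∃ C, LipschitzWith C φ) ∧ (∀ x ∉ V, φ x = 0) ∧ (∀ x, ‖φ x‖ ≤ η') ∧
      (∀ x y, ‖φ x - φ y‖ ≤ η' * ‖x - y‖ ^ α) ∧ E ⊆ V ∧ MeasurableSet E ∧
      (∀ᵐ x ∂(volume : Measure (Euc m)), x ∈ V → IsGood φ E x) ∧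
      (∀ᵐ x ∂(volume : Measure (Euc m)), x ∈ E → ‖grad φ x‖ ≤ δ) ∧
      1 - η ≤ κ ∧ κ ≤ 1 ∧ volume E ≤ ENNReal.ofReal η * volume V ∧
      gradDist V X φ E = volume V •
        (ENNReal.ofReal (κ * θ * (1 - l)) • Measure.dirac (X + l • tensor a n) +
          ENNReal.ofReal (κ * θ * l) • Measure.dirac (X + -(1 - l) • tensor a n) +
          ENNReal.ofReal (1 - θ) • Measure.dirac X) := by
  obtain ⟨Q, E₀, ψ₀, C, κ, hQo, hQb, hQne, hQf, hL, h0, hE₀, hE₀m, hgood, hEδ, hκ, hκ1, hvE, hdist⟩ :=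
    exists_block a hn hl hθ hδ hη
  obtain ⟨s, hs0, hs, hs'⟩ := exists_sup_bound_holder (2 * C) (by positivity) hα hη'
  obtain ⟨φ, E, hφL, hφs, hφ0, hEV, hEm, hφg, hvol1, hvol2⟩ :=
    exists_fill hQo hQb hQne hQf hL h0 hE₀ hE₀m hgood hV hs0
  have hQ0 : volume Q ≠ 0 := (hQo.measure_pos volume hQne).ne'
  have hQt : volume Q ≠ ⊤ := hQb.measure_lt_top.ne
  refine ⟨φ, E, κ, ⟨_, hφL⟩, hφ0, fun x => (hφs x).trans hs, fun x y => ?_, hEV, hEm, hφg, ?_, hκ,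
    hκ1, ?_, ?_⟩
  · refine hs' _ _ (norm_nonneg _) (norm_nonneg _) ?_ ?_
    · have := hφL.dist_le_mul x y
      rw [dist_eq_norm, dist_eq_norm] at this
      exact_mod_cast this
    · have := norm_sub_le (φ x) (φ y)
      linarith [hφs x, hφs y]
  · have h1 := hvol1 {Y | δ < ‖Y‖} (isOpen_lt continuous_const continuous_norm).measurableSet
    have h2 : volume (E₀ ∩ grad ψ₀ ⁻¹' {Y | δ < ‖Y‖}) = 0 := by
      rw [measure_eq_zero_iff_ae_notMem]
      filter_upwards [hEδ] with x hx h
      exact absurd (hx h.1) (not_le.2 h.2)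
    rw [h2, zero_mul, mul_eq_zero, or_iff_left hQ0, measure_eq_zero_iff_ae_notMem] at h1
    filter_upwards [h1] with x hx hxE
    exact not_lt.1 fun h => hx ⟨hxE, h⟩
  · have h1 := hvol1 Set.univ MeasurableSet.univ
    simp only [Set.preimage_univ, Set.inter_univ] at h1
    rw [← ENNReal.mul_le_mul_iff_left hQ0 hQt, h1]
    calc volume E₀ * volume V ≤ ENNReal.ofReal η * volume Q * volume V := by gcongr
      _ = _ := by ring
  · have h1 : (volume.restrict (V \ E)).map (grad φ) = volume V •
        (ENNReal.ofReal (κ * θ * (1 - l)) • Measure.dirac (l • tensor a n) +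
          ENNReal.ofReal (κ * θ * l) • Measure.dirac (-(1 - l) • tensor a n) +
          ENNReal.ofReal (1 - θ) • Measure.dirac 0) := by
      ext S hS
      have h2 := hvol2 S hS
      have h3 := congrArg (fun μ => μ S) hdist
      simp only [Measure.map_apply (measurable_grad ψ₀) hS,
        Measure.restrict_apply (measurable_grad ψ₀ hS), Measure.smul_apply, smul_eq_mul] at h3
      rw [Set.inter_comm] at h3
      rw [h3] at h2
      rw [Measure.map_apply (measurable_grad φ) hS, Measure.restrict_apply (measurable_grad φ hS),
        Set.inter_comm, ← ENNReal.mul_left_inj hQ0 hQt, h2, Measure.smul_apply, smul_eq_mul]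
      ring
    have hadd : Measurable fun Y : Mat d m => X + Y := measurable_const_add X
    have h2 : gradDist V X φ E = ((volume.restrict (V \ E)).map (grad φ)).map (fun Y => X + Y) := by
      rw [Measure.map_map hadd (measurable_grad φ)]
      rfl
    rw [h2, h1, Measure.map_smul, Measure.map_add _ _ hadd, Measure.map_add _ _ hadd,
      Measure.map_smul, Measure.map_smul, Measure.map_smul, Measure.map_dirac' hadd,
      Measure.map_dirac' hadd, Measure.map_dirac' hadd, add_zero]

/-! ### Realization of laminates of finite order -/

/-- `ψ` is a small perturbation supported in `V` such that `A + grad ψ` has approximately the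
distribution `ν` in `V`, up to an error set `E` of small weighted measure on which `A + grad ψ`
stays in `U`. -/
structure IsPerturbation (U : Set (Mat d m)) (A : Mat d m) (ν : Measure (Mat d m)) (α q η : ℝ)
    (V : Set (Euc m)) (ψ : Euc m → Euc d) (E : Set (Euc m)) : Prop where
  lipschitz : ∃ C, LipschitzWith C ψ
  zero : ∀ x ∉ V, ψ x = 0
  sup : ∀ x, ‖ψ x‖ ≤ η
  holder : ∀ x y, ‖ψ x - ψ y‖ ≤ η * ‖x - y‖ ^ α
  subset : E ⊆ V
  measurableSet : MeasurableSet E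
  good : ∀ᵐ x ∂(volume : Measure (Euc m)), x ∈ V → IsGood ψ E x
  mem : ∀ᵐ x ∂(volume : Measure (Euc m)), x ∈ E → A + grad ψ x ∈ U
  small : ∫⁻ x in E, ENNReal.ofReal ((1 + ‖A + grad ψ x‖) ^ q) ≤ ENNReal.ofReal η * volume V
  upper : gradDist V A ψ E ≤ volume V • ν
  lower : (ENNReal.ofReal (1 - η) * volume V) • ν ≤ gradDist V A ψ E

/-- Requiring goodness in `levelRegion` costs only a null set, so its volume is the mass of an atom
of the gradient distribution. -/
theorem ae_mem_levelRegion_iff {V : Set (Euc m)} {A : Mat d m} {ψ : Euc m → Euc d}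
    {E : Set (Euc m)} (hg : ∀ᵐ x ∂(volume : Measure (Euc m)), x ∈ V → IsGood ψ E x) (Y : Mat d m) :
    ∀ᵐ x ∂(volume : Measure (Euc m)), x ∈ levelRegion V A ψ E Y ↔ x ∈ V \ E ∧ A + grad ψ x = Y := by
  filter_upwards [hg] with x hx
  exact ⟨fun h => ⟨⟨h.1, h.2.1⟩, h.2.2.2⟩, fun h => ⟨h.1.1, h.1.2, hx h.1.1, h.2⟩⟩

theorem volume_levelRegion {V : Set (Euc m)} {A : Mat d m} {ψ : Euc m → Euc d} {E : Set (Euc m)}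
    (hg : ∀ᵐ x ∂(volume : Measure (Euc m)), x ∈ V → IsGood ψ E x) (Y : Mat d m) :
    volume (levelRegion V A ψ E Y) = gradDist V A ψ E {Y} := by
  have hs : MeasurableSet ({Y} : Set (Mat d m)) := measurableSet_singleton Y
  rw [gradDist, Measure.map_apply (measurable_const_add_grad A ψ) hs,
    Measure.restrict_apply (measurable_const_add_grad A ψ hs)]
  refine measure_congr ?_
  filter_upwards [ae_mem_levelRegion_iff hg Y] with x hx
  exact propext (hx.trans and_comm)

theorem map_restrict_diff_levelRegion {V : Set (Euc m)} {A : Mat d m}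
    {ψ : Euc m → Euc d} {E : Set (Euc m)}
    (hg : ∀ᵐ x ∂(volume : Measure (Euc m)), x ∈ V → IsGood ψ E x) (Y : Mat d m) :
    (volume.restrict ((V \ E) \ levelRegion V A ψ E Y)).map (fun x => A + grad ψ x) =
      (gradDist V A ψ E).restrict {Y}ᶜ := by
  have hs : MeasurableSet ({Y}ᶜ : Set (Mat d m)) := (measurableSet_singleton Y).compl
  rw [gradDist, Measure.restrict_map (measurable_const_add_grad A ψ) hs,
    Measure.restrict_restrict (measurable_const_add_grad A ψ hs)]
  congr 1
  refine Measure.restrict_congr_set ?_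
  filter_upwards [ae_mem_levelRegion_iff hg Y] with x hx
  refine propext ⟨fun h => ⟨fun h' => h.2 (hx.2 ⟨h.1, h'⟩), h.1⟩,
    fun h => ⟨h.2, fun h' => h.1 (hx.1 h').2⟩⟩

theorem isPerturbation_dirac (U : Set (Mat d m)) (A : Mat d m) {α q η : ℝ} (hη : 0 < η)
    {V : Set (Euc m)} (hV : IsOpen V) :
    IsPerturbation U A (Measure.dirac A) α q η V (fun _ => 0) ∅ := by
  have hg : ∀ x : Euc m, AffineNear (fun _ => (0 : Euc d)) (0 : Mat d m) x := fun x =>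
    affineNear_zero (Eventually.of_forall fun _ => rfl)
  have hdist : gradDist V A (fun _ => (0 : Euc d)) ∅ = volume V • Measure.dirac A := by
    rw [gradDist, Set.sdiff_empty]
    refine map_restrict_of_ae_eq hV.measurableSet (Eventually.of_forall fun x _ => ?_)
    rw [(hg x).grad_eq, add_zero]
  refine ⟨⟨0, LipschitzWith.const _⟩, fun _ _ => rfl, fun x => by simpa using hη.le,
    fun x y => by simpa using by positivity, Set.empty_subset _, MeasurableSet.empty,
    Eventually.of_forall fun x _ => .of_affineNear (hg x) (by simp), by simp, by simp, hdist.le, ?_⟩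
  rw [hdist]
  refine Measure.le_iff.2 fun S _ => ?_
  simp only [Measure.smul_apply, smul_eq_mul]
  gcongr
  refine mul_le_of_le_one_left zero_le ?_
  rw [← ENNReal.ofReal_one]
  exact ENNReal.ofReal_le_ofReal (by linarith)

/-- The measure `ρ` may charge `X` too, so an elementary splitting moves only part of the atom
there. If z = λ + (1 - λ) ρ {X} is the whole atom, then the splitting replaces the fraction θ = λ /
z of it by `σ`. -/
theorem splitting_measure_eq {X : Mat d m} {lam : ℝ} (hlam : lam ∈ Set.Ioc (0 : ℝ) 1)
    {ρ σ : Measure (Mat d m)} [IsProbabilityMeasure ρ] :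
    ∃ z : ℝ, ∃ θ ∈ Set.Ioc (0 : ℝ) 1, 0 ≤ z ∧
      (ENNReal.ofReal lam • Measure.dirac X + ENNReal.ofReal (1 - lam) • ρ) {X} =
        ENNReal.ofReal z ∧
      (ENNReal.ofReal lam • Measure.dirac X + ENNReal.ofReal (1 - lam) • ρ).restrict {X}ᶜ +
        ENNReal.ofReal z • (ENNReal.ofReal θ • σ + ENNReal.ofReal (1 - θ) • Measure.dirac X) =
      ENNReal.ofReal lam • σ + ENNReal.ofReal (1 - lam) • ρ := by
  obtain ⟨h0, h1⟩ := hlam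
  set r := (ρ {X}).toReal with hr
  have hr0 : 0 ≤ r := ENNReal.toReal_nonneg
  have hρX : ρ {X} = ENNReal.ofReal r := (ENNReal.ofReal_toReal (measure_ne_top _ _)).symm
  have h1l : 0 ≤ 1 - lam := by linarith
  have hz : 0 < lam + (1 - lam) * r := by positivity
  have hrest : ρ.restrict {X}ᶜ + ENNReal.ofReal r • Measure.dirac X = ρ := by
    rw [← hρX, ← Measure.restrict_singleton, add_comm,
      Measure.restrict_add_restrict_compl (measurableSet_singleton X)]
  refine ⟨lam + (1 - lam) * r, lam / (lam + (1 - lam) * r), ⟨by positivity, ?_⟩, hz.le, ?_, ?_⟩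
  · rw [div_le_one hz]
    nlinarith
  · rw [ENNReal.ofReal_add h0.le (by positivity), ENNReal.ofReal_mul h1l, ← hρX]
    simp
  · have hd : (Measure.dirac X).restrict {X}ᶜ = 0 := by
      rw [Measure.restrict_eq_zero, Measure.dirac_apply' _ (measurableSet_singleton X).compl]
      simp
    have e1 : (lam + (1 - lam) * r) * (lam / (lam + (1 - lam) * r)) = lam := by field_simp
    have e2 : (lam + (1 - lam) * r) * (1 - lam / (lam + (1 - lam) * r)) = (1 - lam) * r := by
      field_simp
      ring
    rw [smul_add, smul_smul, smul_smul, ← ENNReal.ofReal_mul hz.le, ← ENNReal.ofReal_mul hz.le, e1,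
      e2, Measure.restrict_add, Measure.restrict_smul, Measure.restrict_smul, hd, smul_zero,
      zero_add, ENNReal.ofReal_mul h1l, ← smul_smul, add_left_comm, ← smul_add, hrest]

/-- A second perturbation is added on the open region where the gradient equals the split point `X`.
The rest of the domain keeps its gradient, so the new distribution is the old one off `X` plus the
split atom. Both measure inequalities survive because this operation is linear and monotone in the
measure. -/
theorem IsPerturbation.split {U : Set (Mat d m)} (hU : IsOpen U) {A : Mat d m}
    {ν μ : Measure (Mat d m)} {α q η : ℝ} (hα : α ∈ Set.Ioo (0 : ℝ) 1) (hq : 0 ≤ q)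
    (hη : η ∈ Set.Ioo (0 : ℝ) 1) {V : Set (Euc m)} (hV : IsOpen V) {ψ : Euc m → Euc d}
    {E : Set (Euc m)} (h : IsPerturbation U A ν α q (η / 2) V ψ E)
    (hs : ElementarySplitting U ν μ) :
    ∃ (ψ' : Euc m → Euc d) (E' : Set (Euc m)), IsPerturbation U A μ α q η V ψ' E' := by
  obtain ⟨lam, l, X, B, B', ρ, hlam, hl, hρ, hXU, hXB, hrank, hν, hμ⟩ := hs
  obtain ⟨hη0, hη1⟩ := hη
  obtain ⟨a, n, hn, han⟩ := exists_tensor_of_rank hrank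
  have hB : B = X + -(1 - l) • tensor a n := by
    rw [← han, hXB]
    module
  have hB' : B' = X + l • tensor a n := by
    rw [← han, hXB]
    module
  set σ : Measure (Mat d m) :=
    ENNReal.ofReal l • Measure.dirac B + ENNReal.ofReal (1 - l) • Measure.dirac B' with hσ
  obtain ⟨z, θ, hθ, hz0, hνX, hμeq⟩ := splitting_measure_eq (X := X) hlam (ρ := ρ) (σ := σ)
  rw [← hμ, ← hν] at hμeq
  rw [← hν] at hνX
  obtain ⟨δ, hδ0, hδU⟩ := Metric.isOpen_iff.1 hU X hXU
  -- Bounds the weight (1 + |·|) ^ q on the new error set, where the gradient is within distance 1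
  -- of `X`.
  set c : ℝ := (2 + ‖X‖) ^ q with hc
  have hc0 : 0 < c := by positivity
  set R := levelRegion V A ψ E X with hR
  have hRo : IsOpen R := isOpen_levelRegion hV A ψ E X
  have hRV : R ⊆ V := fun x hx => hx.1
  -- Gradients smaller than δ / 2 keep the new error values in `U`; dividing by `c` makes the
  -- weighted measure of the error set small.
  obtain ⟨φ, F, κ, ⟨Cφ, hφL⟩, hφ0, hφs, hφh, hFR, hFm, hφg, hφδ, hκ, hκ1, hvF, hφd⟩ :=
    exists_split_perturbation X a hn hl hθ (δ := min (δ / 2) 1) (η := min (η / 2) (η / 2 / c))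
      (η' := η / 2) (by positivity) ⟨by positivity, (min_le_left _ _).trans_lt (by linarith)⟩
      (by positivity) hα hRo
  have hκ' : 1 - η / 2 ≤ κ := by
    have := min_le_left (η / 2) (η / 2 / c)
    linarith
  have hκ0 : 0 ≤ κ := by linarith
  have hdist : gradDist R X φ F = volume R • (ENNReal.ofReal (κ * θ) • σ +
      ENNReal.ofReal (1 - θ) • Measure.dirac X) := by
    have hκθ : 0 ≤ κ * θ := mul_nonneg hκ0 hθ.1.le
    rw [hφd, ← hB, ← hB', hσ, smul_add (ENNReal.ofReal (κ * θ)), smul_smul, smul_smul,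
      ← ENNReal.ofReal_mul hκθ, ← ENNReal.ofReal_mul hκθ,
      add_comm (ENNReal.ofReal (κ * θ * (1 - l)) • _)]
  have hin : ∀ {x}, x ∈ R → IsGood φ F x → AffineNear (fun y => ψ y + φ y) (X - A + grad φ x) x := by
    intro x hx hg
    have h1 : AffineNear ψ (X - A) x := by
      have := hx.2.2.1.1
      rwa [eq_sub_of_add_eq' hx.2.2.2] at this
    exact h1.add hg.1
  have hoff : ∀ {x}, x ∈ V → IsGood ψ E x → x ∉ R → ∀ᶠ y in 𝓝 x, y ∉ R := fun hx hg hxR =>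
    hg.eventually_notMem_levelRegion hx hxR
  have hout : ∀ {x}, x ∈ V → IsGood ψ E x → x ∉ R → AffineNear (fun y => ψ y + φ y) (grad ψ x) x := by
    intro x hx hg hxR
    refine hg.1.congr ?_
    filter_upwards [hoff hx hg hxR] with y hy
    rw [hφ0 y hy, add_zero]
  have hEgrad : ∀ᵐ x ∂(volume : Measure (Euc m)), x ∈ E →
      grad (fun y => ψ y + φ y) x = grad ψ x := by
    filter_upwards [h.good] with x hx hxE
    exact (hout (h.subset hxE) (hx (h.subset hxE)) fun hxR => hxR.2.1 hxE).grad_eq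
  have hFgrad : ∀ᵐ x ∂(volume : Measure (Euc m)), x ∈ R →
      A + grad (fun y => ψ y + φ y) x = X + grad φ x := by
    filter_upwards [hφg] with x hx hxR
    rw [(hin hxR (hx hxR)).grad_eq]
    abel
  have hFδ : ∀ᵐ x ∂(volume : Measure (Euc m)), x ∈ F →
      ‖A + grad (fun y => ψ y + φ y) x - X‖ ≤ min (δ / 2) 1 := by
    filter_upwards [hFgrad, hφδ] with x h1 h2 hxF
    rw [h1 (hFR hxF), add_sub_cancel_left]
    exact h2 hxF
  have hsplitset : V \ (E ∪ F) = (R \ F) ∪ ((V \ E) \ R) := by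
    ext x
    constructor
    · rintro ⟨h1, h2⟩
      by_cases hxR : x ∈ R
      · exact Or.inl ⟨hxR, fun hF => h2 (Or.inr hF)⟩
      · exact Or.inr ⟨⟨h1, fun hE => h2 (Or.inl hE)⟩, hxR⟩
    · rintro (⟨h1, h2⟩ | ⟨⟨h1, h2⟩, h3⟩)
      · exact ⟨hRV h1, fun h => h.elim (fun hE => h1.2.1 hE) h2⟩
      · exact ⟨h1, fun h => h.elim h2 fun hF => h3 (hFR hF)⟩
  have hnewdist : gradDist V A (fun y => ψ y + φ y) (E ∪ F) =
      gradDist R X φ F + (gradDist V A ψ E).restrict {X}ᶜ := by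
    have hm1 : MeasurableSet ((V \ E) \ R) :=
      (hV.measurableSet.diff h.measurableSet).diff hRo.measurableSet
    rw [← map_restrict_diff_levelRegion h.good X, gradDist, hsplitset,
      Measure.restrict_union (Set.disjoint_left.2 fun x hx hx' => hx'.2 hx.1) hm1,
      Measure.map_add _ _ (measurable_const_add_grad A _), gradDist]
    congr 1
    · refine Measure.map_congr ((ae_restrict_iff' (hRo.measurableSet.diff hFm)).2 ?_)
      filter_upwards [hFgrad] with x hx hxR using hx hxR.1
    · refine Measure.map_congr ((ae_restrict_iff' hm1).2 ?_)
      filter_upwards [h.good] with x hx hxV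
      rw [(hout hxV.1.1 (hx hxV.1.1) hxV.2).grad_eq]
  have hvR : volume R = gradDist V A ψ E {X} := volume_levelRegion h.good X
  have hκθ : ENNReal.ofReal (κ * θ) = ENNReal.ofReal κ * ENNReal.ofReal θ := ENNReal.ofReal_mul hκ0
  have hκ1' : ENNReal.ofReal κ ≤ 1 := by
    rw [← ENNReal.ofReal_one]
    exact ENNReal.ofReal_le_ofReal hκ1
  obtain ⟨Cψ, hψL⟩ := h.lipschitz
  refine ⟨fun y => ψ y + φ y, E ∪ F, ⟨_, hψL.add hφL⟩, ?_, ?_, ?_,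
    Set.union_subset h.subset (hFR.trans hRV), h.measurableSet.union hFm, ?_, ?_, ?_, ?_, ?_⟩
  · intro x hx
    rw [h.zero x hx, hφ0 x fun hxR => hx (hRV hxR), add_zero]
  · intro x
    exact (norm_add_le _ _).trans (by linarith [h.sup x, hφs x])
  · intro x y
    have : ψ x + φ x - (ψ y + φ y) = (ψ x - ψ y) + (φ x - φ y) := by abel
    rw [this]
    exact (norm_add_le _ _).trans (by linarith [h.holder x y, hφh x y])
  · filter_upwards [h.good, hφg] with x h1 h2 hxV
    by_cases hxR : x ∈ R
    · refine .of_affineNear (hin hxR (h2 hxR)) ?_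
      filter_upwards [(h2 hxR).2, (h1 hxV).2] with y hy1 hy2
      simp only [Set.mem_union, hy1, hy2]
    · refine .of_affineNear (hout hxV (h1 hxV) hxR) ?_
      filter_upwards [hoff hxV (h1 hxV) hxR, (h1 hxV).2] with y hy1 hy2
      simp only [Set.mem_union, hy2, iff_false_intro fun hF => hy1 (hFR hF),
        iff_false_intro fun hF => hxR (hFR hF)]
  · filter_upwards [hEgrad, h.mem, hFδ] with x h1 h2 h3 hx
    rcases hx with hxE | hxF
    · rw [h1 hxE]
      exact h2 hxE
    · refine hδU ?_
      rw [Metric.mem_ball, dist_eq_norm]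
      have := (h3 hxF).trans (min_le_left _ _)
      linarith
  · have hE : ∫⁻ x in E, ENNReal.ofReal ((1 + ‖A + grad (fun y => ψ y + φ y) x‖) ^ q) =
        ∫⁻ x in E, ENNReal.ofReal ((1 + ‖A + grad ψ x‖) ^ q) := by
      refine lintegral_congr_ae ((ae_restrict_iff' h.measurableSet).2 ?_)
      filter_upwards [hEgrad] with x hx hxE
      rw [hx hxE]
    have hF : ∫⁻ x in F, ENNReal.ofReal ((1 + ‖A + grad (fun y => ψ y + φ y) x‖) ^ q) ≤
        ENNReal.ofReal (η / 2) * volume V := by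
      calc _ ≤ ∫⁻ _ in F, ENNReal.ofReal c := by
            refine lintegral_mono_ae ((ae_restrict_iff' hFm).2 ?_)
            filter_upwards [hFδ] with x hx hxF
            refine ENNReal.ofReal_le_ofReal (Real.rpow_le_rpow (by positivity) ?_ hq)
            have h1 := (hx hxF).trans (min_le_right _ _)
            have h2 := norm_le_norm_add_norm_sub' (A + grad (fun y => ψ y + φ y) x) X
            linarith
        _ = ENNReal.ofReal c * volume F := by rw [setLIntegral_const]
        _ ≤ ENNReal.ofReal c * (ENNReal.ofReal (η / 2 / c) * volume V) := by
            gcongr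
            refine hvF.trans ?_
            gcongr
            exact min_le_right _ _
        _ = ENNReal.ofReal (η / 2) * volume V := by
            rw [← mul_assoc, ← ENNReal.ofReal_mul hc0.le]
            congr 2
            field_simp
    calc _ ≤ _ := lintegral_union_le _ _ _
      _ ≤ ENNReal.ofReal (η / 2) * volume V + ENNReal.ofReal (η / 2) * volume V := by
          rw [hE]
          exact add_le_add h.small hF
      _ = ENNReal.ofReal η * volume V := by
          rw [← add_mul, ← ENNReal.ofReal_add (by positivity) (by positivity), add_halves]
  · rw [hnewdist, hdist, hvR]
    have h1 : gradDist V A ψ E {X} ≤ volume V * ENNReal.ofReal z := by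
      refine (Measure.le_iff.1 h.upper _ (measurableSet_singleton X)).trans ?_
      rw [Measure.smul_apply, hνX, smul_eq_mul]
    refine Measure.le_iff.2 fun S hS => ?_
    have h2 := Measure.le_iff.1 (Measure.restrict_mono subset_rfl h.upper : _ ≤
      (volume V • ν).restrict {X}ᶜ) S hS
    have h3 := congrArg (fun m => m S) hμeq
    simp only [Measure.add_apply, Measure.smul_apply, smul_eq_mul, Measure.restrict_smul] at h2 h3 ⊢
    rw [← h3, hκθ]
    calc _ ≤ volume V * ENNReal.ofReal z *
          (1 * ENNReal.ofReal θ * σ S + ENNReal.ofReal (1 - θ) * Measure.dirac X S) +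
          volume V * ν.restrict {X}ᶜ S := by gcongr
      _ = _ := by ring
  · rw [hnewdist, hdist, hvR]
    have h1 : ENNReal.ofReal (1 - η / 2) * volume V * ENNReal.ofReal z ≤ gradDist V A ψ E {X} := by
      refine le_trans ?_ (Measure.le_iff.1 h.lower _ (measurableSet_singleton X))
      rw [Measure.smul_apply, hνX, smul_eq_mul]
    refine Measure.le_iff.2 fun S hS => ?_
    have h2 := Measure.le_iff.1 (Measure.restrict_mono subset_rfl h.lower :
      ((ENNReal.ofReal (1 - η / 2) * volume V) • ν).restrict {X}ᶜ ≤ _) S hS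
    have h3 := congrArg (fun m => m S) hμeq
    simp only [Measure.add_apply, Measure.smul_apply, smul_eq_mul, Measure.restrict_smul] at h2 h3 ⊢
    rw [← h3, hκθ]
    -- The two losses multiply: (1 - η / 2) ^ 2 ≥ 1 - η.
    have h4 : ENNReal.ofReal (1 - η) ≤ ENNReal.ofReal κ * ENNReal.ofReal (1 - η / 2) := by
      rw [← ENNReal.ofReal_mul hκ0]
      refine ENNReal.ofReal_le_ofReal ?_
      nlinarith
    calc _ ≤ ENNReal.ofReal κ * ENNReal.ofReal (1 - η / 2) * volume V *
          (ν.restrict {X}ᶜ S + ENNReal.ofReal z *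
            (ENNReal.ofReal θ * σ S + ENNReal.ofReal (1 - θ) * Measure.dirac X S)) := by gcongr
      _ = (ENNReal.ofReal (1 - η / 2) * volume V * ENNReal.ofReal z) *
            (ENNReal.ofReal κ * ENNReal.ofReal θ * σ S +
              ENNReal.ofReal κ * (ENNReal.ofReal (1 - θ) * Measure.dirac X S)) +
          ENNReal.ofReal κ * (ENNReal.ofReal (1 - η / 2) * volume V * ν.restrict {X}ᶜ S) := by ring
      _ ≤ (ENNReal.ofReal (1 - η / 2) * volume V * ENNReal.ofReal z) *
            (ENNReal.ofReal κ * ENNReal.ofReal θ * σ S +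
              1 * (ENNReal.ofReal (1 - θ) * Measure.dirac X S)) +
          1 * (ENNReal.ofReal (1 - η / 2) * volume V * ν.restrict {X}ᶜ S) := by gcongr
      _ ≤ _ := by
          rw [one_mul, one_mul]
          gcongr

theorem FiniteLaminate.exists_isPerturbation {U : Set (Mat d m)} (hU : IsOpen U) {A : Mat d m}
    {ν : Measure (Mat d m)} (h : FiniteLaminate U A ν) {α q : ℝ} (hα : α ∈ Set.Ioo (0 : ℝ) 1)
    (hq : 0 ≤ q) {V : Set (Euc m)} (hV : IsOpen V) :
    ∀ η ∈ Set.Ioo (0 : ℝ) 1, ∃ (ψ : Euc m → Euc d) (E : Set (Euc m)),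
      IsPerturbation U A ν α q η V ψ E := by
  induction h with
  | dirac => exact fun η hη => ⟨_, _, isPerturbation_dirac U A hη.1 hV⟩
  | split _ hs ih =>
    intro η hη
    obtain ⟨ψ, E, h⟩ := ih (η / 2) ⟨by linarith [hη.1], by linarith [hη.1, hη.2]⟩
    exact h.split hU hα hq hη hV hs

/-! ### Staircase laminates -/

theorem integrable_id_dirac (X : Mat d m) : Integrable (fun Y : Mat d m => Y) (Measure.dirac X) :=
  integrable_dirac (by simp)

theorem FiniteLaminate.hasBarycenter {U : Set (Mat d m)} {A : Mat d m} {ν : Measure (Mat d m)}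
    (h : FiniteLaminate U A ν) : HasBarycenter ν A := by
  induction h with
  | dirac => exact ⟨integrable_id_dirac A, integral_dirac _ _⟩
  | split _ hs ih =>
    obtain ⟨lam, l, X, B, B', ρ, hlam, hl, -, -, hX, -, hν, hμ⟩ := hs
    obtain ⟨hi, hA⟩ := ih
    have h1l : 0 ≤ 1 - l := by linarith [hl.2]
    rw [hν, integrable_add_measure] at hi
    rw [hν, integral_add_measure hi.1 hi.2, integral_smul_measure, integral_dirac,
      ENNReal.toReal_ofReal hlam.1.le] at hA
    have hB : Integrable (fun Y : Mat d m => Y) (ENNReal.ofReal l • Measure.dirac B) :=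
      (integrable_id_dirac B).smul_measure ENNReal.ofReal_ne_top
    have hB' : Integrable (fun Y : Mat d m => Y) (ENNReal.ofReal (1 - l) • Measure.dirac B') :=
      (integrable_id_dirac B').smul_measure ENNReal.ofReal_ne_top
    have hBB : Integrable (fun Y : Mat d m => Y) (ENNReal.ofReal lam •
        (ENNReal.ofReal l • Measure.dirac B + ENNReal.ofReal (1 - l) • Measure.dirac B')) :=
      (hB.add_measure hB').smul_measure ENNReal.ofReal_ne_top
    refine ⟨hμ ▸ hBB.add_measure hi.2, ?_⟩
    rw [hμ, integral_add_measure hBB hi.2, integral_smul_measure, integral_add_measure hB hB',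
      integral_smul_measure, integral_smul_measure, integral_dirac, integral_dirac,
      ENNReal.toReal_ofReal hlam.1.le, ENNReal.toReal_ofReal hl.1.le, ENNReal.toReal_ofReal h1l,
      ← hX, hA]

theorem IsFiniteAtomic.measure_compl {K : Set (Mat d m)} {μ : Measure (Mat d m)}
    (h : IsFiniteAtomic K μ) : ∃ S : Finset (Mat d m), (S : Set (Mat d m)) ⊆ K ∧ μ (S : Set _)ᶜ = 0 := by
  obtain ⟨S, c, hS, -, -, rfl⟩ := h
  refine ⟨S, hS, ?_⟩
  rw [Measure.finsetSum_apply]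
  refine Finset.sum_eq_zero fun Y hY => ?_
  rw [Measure.smul_apply, Measure.dirac_apply' _ S.measurableSet.compl]
  simp [hY]

theorem IsFiniteAtomic.integrable {K : Set (Mat d m)} {μ : Measure (Mat d m)}
    (h : IsFiniteAtomic K μ) : Integrable (fun Y : Mat d m => Y) μ := by
  obtain ⟨S, c, -, -, -, rfl⟩ := h
  exact integrable_finsetSum_measure.2 fun Y _ =>
    (integrable_id_dirac Y).smul_measure ENNReal.ofReal_ne_top

theorem IsFiniteAtomic.apply_singleton {K : Set (Mat d m)} {μ : Measure (Mat d m)}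
    (h : IsFiniteAtomic K μ) {X : Mat d m} (hX : X ∉ K) : μ {X} = 0 := by
  obtain ⟨S, hS, hμ⟩ := h.measure_compl
  refine measure_mono_null ?_ hμ
  rintro _ rfl hXS
  exact hX (hS hXS)

/-- Since X ∉ K, the measure `μ` has no mass at `X`, so the continuing part and the part in `K` can
be told apart by the value of the gradient. -/
theorem stepMeasure_singleton {K : Set (Mat d m)} {μ : Measure (Mat d m)}
    (h : IsFiniteAtomic K μ) {X : Mat d m} (hX : X ∉ K) (γ : ℝ) :
    stepMeasure γ μ X {X} = ENNReal.ofReal γ := by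
  rw [stepMeasure, Measure.add_apply, Measure.smul_apply, Measure.smul_apply, h.apply_singleton hX]
  simp

theorem stepMeasure_restrict {K : Set (Mat d m)} {μ : Measure (Mat d m)}
    (h : IsFiniteAtomic K μ) {X : Mat d m} (hX : X ∉ K) (γ : ℝ) :
    (stepMeasure γ μ X).restrict {X}ᶜ = ENNReal.ofReal (1 - γ) • μ := by
  have hd : (Measure.dirac X).restrict {X}ᶜ = 0 := by
    rw [Measure.restrict_eq_zero, Measure.dirac_apply' _ (measurableSet_singleton X).compl]
    simp
  have hμ : μ.restrict {X}ᶜ = μ := by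
    rw [Measure.restrict_eq_self_of_ae_mem]
    exact measure_eq_zero_iff_ae_notMem.1 (h.apply_singleton hX)
  rw [stepMeasure, Measure.restrict_add, Measure.restrict_smul, Measure.restrict_smul, hd, hμ,
    smul_zero, add_zero]

theorem stairWeight_succ (γ : ℕ → ℝ) (n : ℕ) : stairWeight γ (n + 1) = stairWeight γ n * γ n :=
  Finset.prod_range_succ _ _

theorem stairWeight_nonneg {γ : ℕ → ℝ} (hγ : ∀ n, γ n ∈ Set.Ioo (0 : ℝ) 1) (n : ℕ) :
    0 ≤ stairWeight γ n := Finset.prod_nonneg fun k _ => (hγ k).1.le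

/-- The remaining Dirac mass has weight β_N → 0 and disappears on every set. -/
theorem eq_sum_of_tendsto_stairMeasure {X : ℕ → Mat d m} {μ : ℕ → Measure (Mat d m)} {γ : ℕ → ℝ}
    {ν : Measure (Mat d m)} (hβ : Tendsto (stairWeight γ) atTop (𝓝 0))
    (hlim : ∀ E : Set (Mat d m), MeasurableSet E →
      Tendsto (fun N => stairMeasure X μ γ N E) atTop (𝓝 (ν E))) :
    ν = Measure.sum fun n => ENNReal.ofReal (stairWeight γ n * (1 - γ n)) • μ n := by
  ext S hS
  rw [Measure.sum_apply _ hS]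
  have h1 := ENNReal.tendsto_nat_tsum fun n =>
    (ENNReal.ofReal (stairWeight γ n * (1 - γ n)) • μ n) S
  have h2 : Tendsto (fun N => ENNReal.ofReal (stairWeight γ N) * Measure.dirac (X N) S) atTop
      (𝓝 0) := by
    have h3 : Tendsto (fun N => ENNReal.ofReal (stairWeight γ N)) atTop (𝓝 0) := by
      simpa using ENNReal.tendsto_ofReal hβ
    refine tendsto_of_tendsto_of_tendsto_of_le_of_le tendsto_const_nhds h3 (fun _ => zero_le)
      fun N => ?_
    exact mul_le_of_le_one_right zero_le prob_le_one
  have h4 := h1.add h2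
  rw [add_zero] at h4
  refine tendsto_nhds_unique (hlim S hS) (h4.congr fun N => ?_)
  rw [stairMeasure, Measure.add_apply, Measure.finsetSum_apply, Measure.smul_apply, smul_eq_mul]

/-- Each step measure has barycenter `X n`, so the n-th summand of the staircase has first moment
β_n X n - β_{n+1} X (n+1). The partial sums X 0 - β_N X N converge to the barycenter, which is `X
0`. -/
theorem tendsto_stairWeight_smul {K U : Set (Mat d m)} {X : ℕ → Mat d m}
    {μ : ℕ → Measure (Mat d m)} {γ : ℕ → ℝ} (hμ : ∀ n, IsFiniteAtomic K (μ n))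
    (hγ : ∀ n, γ n ∈ Set.Ioo (0 : ℝ) 1)
    (hlam : ∀ n, FiniteLaminate U (X n) (stepMeasure (γ n) (μ n) (X (n + 1))))
    (hbar : HasBarycenter
      (Measure.sum fun n => ENNReal.ofReal (stairWeight γ n * (1 - γ n)) • μ n) (X 0)) :
    Tendsto (fun n => stairWeight γ n • X n) atTop (𝓝 0) := by
  have hsum := (hasSum_integral_measure hbar.1).tendsto_sum_nat
  rw [hbar.2] at hsum
  have h1 : ∀ n, ∫ Y, Y ∂(ENNReal.ofReal (stairWeight γ n * (1 - γ n)) • μ n) =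
      stairWeight γ n • X n - stairWeight γ (n + 1) • X (n + 1) := by
    intro n
    have h1γ : 0 ≤ 1 - γ n := by linarith [(hγ n).2]
    have hβ := stairWeight_nonneg hγ n
    have h2 := (hlam n).hasBarycenter.2
    rw [stepMeasure, integral_add_measure ((hμ n).integrable.smul_measure ENNReal.ofReal_ne_top)
      ((integrable_id_dirac _).smul_measure ENNReal.ofReal_ne_top), integral_smul_measure,
      integral_smul_measure, integral_dirac, ENNReal.toReal_ofReal h1γ,
      ENNReal.toReal_ofReal (hγ n).1.le] at h2
    rw [integral_smul_measure, ENNReal.toReal_ofReal (by positivity), ← h2, stairWeight_succ]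
    module
  have h2 : ∀ N, ∑ n ∈ Finset.range N,
      ∫ Y, Y ∂(ENNReal.ofReal (stairWeight γ n * (1 - γ n)) • μ n) =
      X 0 - stairWeight γ N • X N := by
    intro N
    rw [Finset.sum_congr rfl fun n _ => h1 n, Finset.sum_range_sub']
    simp [stairWeight]
  have h3 := (tendsto_const_nhds (x := X 0)).sub (hsum.congr h2)
  simpa using h3

/-! ### Iteration along a staircase -/

/-- A sequence of perturbations `ψ n`, supported in decreasing open sets `R n`, that realize the
steps of a staircase. -/
structure StairIteration (K U : Set (Mat d m)) (X : ℕ → Mat d m) (μ : ℕ → Measure (Mat d m))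
    (γ : ℕ → ℝ) (α q ε : ℝ) (R : ℕ → Set (Euc m)) (ψ : ℕ → Euc m → Euc d)
    (E : ℕ → Set (Euc m)) : Prop where
  notMem : ∀ n, X n ∉ K
  atomic : ∀ n, IsFiniteAtomic K (μ n)
  mem_Ioo : ∀ n, γ n ∈ Set.Ioo (0 : ℝ) 1
  tendsto : Tendsto (stairWeight γ) atTop (𝓝 0)
  eps : ε ∈ Set.Ioo (0 : ℝ) 1
  finite : volume (R 0) ≠ ⊤
  isOpen : ∀ n, IsOpen (R n)
  succ : ∀ n, R (n + 1) = levelRegion (R n) (X n) (ψ n) (E n) (X (n + 1))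
  pert : ∀ n, IsPerturbation U (X n) (stepMeasure (γ n) (μ n) (X (n + 1))) α q
    (ε * (1 / 2) ^ (n + 2)) (R n) (ψ n) (E n)

/-- The region of a step depends on all earlier choices. Perturbations are therefore chosen for
every open set beforehand, and the recursion runs over bundled open sets. -/
theorem exists_stairIteration {K U : Set (Mat d m)} (hU : IsOpen U) {X : ℕ → Mat d m}
    {μ : ℕ → Measure (Mat d m)} {γ : ℕ → ℝ} (hX : ∀ n, X n ∉ K)
    (hμ : ∀ n, IsFiniteAtomic K (μ n)) (hγ : ∀ n, γ n ∈ Set.Ioo (0 : ℝ) 1)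
    (hβ : Tendsto (stairWeight γ) atTop (𝓝 0))
    (hlam : ∀ n, FiniteLaminate U (X n) (stepMeasure (γ n) (μ n) (X (n + 1))))
    {α q ε : ℝ} (hα : α ∈ Set.Ioo (0 : ℝ) 1) (hq : 0 ≤ q) (hε : ε ∈ Set.Ioo (0 : ℝ) 1)
    {Ω : Set (Euc m)} (hΩ : IsOpen Ω) (hfin : volume Ω ≠ ⊤) :
    ∃ (R : ℕ → Set (Euc m)) (ψ : ℕ → Euc m → Euc d) (E : ℕ → Set (Euc m)), R 0 = Ω ∧
      StairIteration K U X μ γ α q ε R ψ E := by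
  have key : ∀ (n : ℕ) (V : TopologicalSpace.Opens (Euc m)),
      ∃ (ψ : Euc m → Euc d) (E : Set (Euc m)), IsPerturbation U (X n)
        (stepMeasure (γ n) (μ n) (X (n + 1))) α q (ε * (1 / 2) ^ (n + 2)) V ψ E := fun n V => by
    refine (hlam n).exists_isPerturbation hU hα hq V.isOpen _ ⟨by have := hε.1; positivity, ?_⟩
    have h1 : ((1 : ℝ) / 2) ^ (n + 2) ≤ 1 := pow_le_one₀ (by norm_num) (by norm_num)
    have := hε.1
    have := hε.2
    nlinarith
  choose Ψ 𝓔 h using key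
  let R : ℕ → TopologicalSpace.Opens (Euc m) := fun n => Nat.rec ⟨Ω, hΩ⟩
    (fun n V => ⟨levelRegion V (X n) (Ψ n V) (𝓔 n V) (X (n + 1)),
      isOpen_levelRegion V.isOpen _ _ _ _⟩) n
  refine ⟨fun n => (R n).1, fun n => Ψ n (R n), fun n => 𝓔 n (R n), rfl, ?_⟩
  exact ⟨hX, hμ, hγ, hβ, hε, hfin, fun n => (R n).isOpen, fun n => rfl, fun n => h n (R n)⟩

/-- The partial sums of the iteration. -/
noncomputable def stairMap (A : Mat d m) (b : Euc d) (ψ : ℕ → Euc m → Euc d) (n : ℕ) (x : Euc m) :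
    Euc d := affineFun A b x + ∑ k ∈ Finset.range n, ψ k x

/-- The limit of the iteration. -/
noncomputable def stairLimit (A : Mat d m) (b : Euc d) (ψ : ℕ → Euc m → Euc d) (x : Euc m) :
    Euc d := affineFun A b x + ∑' k, ψ k x

/-! ### Volumes and gradients along the iteration -/

namespace StairIteration

variable {K U : Set (Mat d m)} {X : ℕ → Mat d m} {μ : ℕ → Measure (Mat d m)} {γ : ℕ → ℝ}
  {α q ε : ℝ} {R : ℕ → Set (Euc m)} {ψ : ℕ → Euc m → Euc d} {E : ℕ → Set (Euc m)}

theorem hasSum_eps (ε : ℝ) : HasSum (fun n : ℕ => ε * ((1 : ℝ) / 2) ^ (n + 2)) (ε / 2) := by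
  have h := (hasSum_geometric_of_lt_one (r := (1 : ℝ) / 2) (by norm_num) (by norm_num)).mul_left
    (ε / 4)
  have h1 : (fun n : ℕ => ε / 4 * ((1 : ℝ) / 2) ^ n) = fun n : ℕ => ε * ((1 : ℝ) / 2) ^ (n + 2) := by
    funext n
    rw [pow_add]
    ring
  have h2 : ε / 4 * (1 - (1 : ℝ) / 2)⁻¹ = ε / 2 := by norm_num; ring
  rwa [h1, h2] at h

theorem antitone (h : StairIteration K U X μ γ α q ε R ψ E) : Antitone R := by
  refine antitone_nat_of_succ_le fun n x hx => ?_
  rw [h.succ] at hx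
  exact hx.1

theorem eq_zero (h : StairIteration K U X μ γ α q ε R ψ E) {n k : ℕ} (hk : n ≤ k) {x : Euc m}
    (hx : x ∉ R n) : ψ k x = 0 := (h.pert k).zero x fun hxk => hx (h.antitone hk hxk)

theorem summable (h : StairIteration K U X μ γ α q ε R ψ E) (x : Euc m) :
    Summable fun k => ψ k x :=
  Summable.of_norm_bounded (hasSum_eps ε).summable fun k => (h.pert k).sup x

theorem stairMap_succ (A : Mat d m) (b : Euc d) (ψ : ℕ → Euc m → Euc d) (n : ℕ) :
    stairMap A b ψ (n + 1) = fun x => stairMap A b ψ n x + ψ n x := by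
  funext x
  rw [stairMap, stairMap, Finset.sum_range_succ, add_assoc]

theorem stairLimit_eq (h : StairIteration K U X μ γ α q ε R ψ E) (b : Euc d) {n k : ℕ}
    (hk : n ≤ k) {x : Euc m} (hx : x ∉ R n) :
    stairMap (X 0) b ψ k x = stairLimit (X 0) b ψ x := by
  rw [stairMap, stairLimit, tsum_eq_sum (s := Finset.range k)]
  intro j hj
  rw [Finset.mem_range, not_lt] at hj
  exact h.eq_zero (hk.trans hj) hx

theorem affineNear_stairMap (h : StairIteration K U X μ γ α q ε R ψ E) (b : Euc d) (n : ℕ) :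
    ∀ x ∈ R n, AffineNear (stairMap (X 0) b ψ n) (X n) x := by
  induction n with
  | zero =>
    intro x _
    refine ⟨b, Eventually.of_forall fun y => ?_⟩
    simp [stairMap]
  | succ n ih =>
    intro x hx
    rw [h.succ] at hx
    have h1 := (ih x hx.1).add hx.2.2.1.1
    rwa [← stairMap_succ, hx.2.2.2] at h1

theorem lipschitz_stairMap (h : StairIteration K U X μ γ α q ε R ψ E) (b : Euc d) (n : ℕ) :
    ∃ C, LipschitzWith C (stairMap (X 0) b ψ n) := by
  induction n with
  | zero =>
    refine ⟨‖linMap (X 0)‖₊, LipschitzWith.of_dist_le_mul fun x y => ?_⟩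
    have := (linMap (X 0)).lipschitz.dist_le_mul x y
    simpa [stairMap, affineFun_eq] using this
  | succ n ih =>
    obtain ⟨C, hC⟩ := ih
    obtain ⟨C', hC'⟩ := (h.pert n).lipschitz
    rw [stairMap_succ]
    exact ⟨_, hC.add hC'⟩

theorem stairWeight_pos (h : StairIteration K U X μ γ α q ε R ψ E) (n : ℕ) :
    0 ≤ stairWeight γ n := stairWeight_nonneg h.mem_Ioo n

theorem volume_succ (h : StairIteration K U X μ γ α q ε R ψ E) (n : ℕ) :
    volume (R (n + 1)) = gradDist (R n) (X n) (ψ n) (E n) {X (n + 1)} := by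
  rw [h.succ]
  exact volume_levelRegion (h.pert n).good _

theorem volume_le (h : StairIteration K U X μ γ α q ε R ψ E) (n : ℕ) :
    volume (R n) ≤ ENNReal.ofReal (stairWeight γ n) * volume (R 0) := by
  induction n with
  | zero => simp [stairWeight]
  | succ n ih =>
    rw [h.volume_succ, stairWeight_succ, ENNReal.ofReal_mul (h.stairWeight_pos n)]
    refine (Measure.le_iff.1 (h.pert n).upper _ (measurableSet_singleton _)).trans ?_
    rw [Measure.smul_apply, stepMeasure_singleton (h.atomic n) (h.notMem _), smul_eq_mul]
    calc _ ≤ ENNReal.ofReal (stairWeight γ n) * volume (R 0) * ENNReal.ofReal (γ n) := by gcongr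
      _ = _ := by ring

/-- With s = 2^{-(n+1)} ≤ 1/2 one has (1/2 + s)(1 - s/2) ≥ 1/2 + s/2. The factor 1/2 + s equals 1 at
n = 0 and never drops below 1/2, so it absorbs the product of all losses. -/
theorem one_sub_eps_nonneg (h : StairIteration K U X μ γ α q ε R ψ E) (n : ℕ) :
    (1 / 2 : ℝ) + (1 / 2) ^ (n + 2) ≤ (1 / 2 + (1 / 2) ^ (n + 1)) * (1 - ε * (1 / 2) ^ (n + 2)) ∧
      0 ≤ 1 - ε * (1 / 2) ^ (n + 2) := by
  have h1 : ((1 : ℝ) / 2) ^ (n + 2) = (1 / 2) ^ (n + 1) / 2 := by rw [pow_succ]; ring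
  have h2 : ((1 : ℝ) / 2) ^ (n + 1) ≤ 1 / 2 := by
    rw [pow_succ]
    have : ((1 : ℝ) / 2) ^ n ≤ 1 := pow_le_one₀ (by norm_num) (by norm_num)
    linarith
  have h3 : 0 < ((1 : ℝ) / 2) ^ (n + 1) := by positivity
  rw [h1]
  set t := ((1 : ℝ) / 2) ^ (n + 1)
  have := h.eps.1
  have := h.eps.2
  have h4 : ε * (t / 2) ≤ t / 2 := mul_le_of_le_one_left (by positivity) h.eps.2.le
  constructor
  · nlinarith
  · linarith

theorem le_volume (h : StairIteration K U X μ γ α q ε R ψ E) (n : ℕ) :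
    ENNReal.ofReal (stairWeight γ n * (1 / 2 + (1 / 2) ^ (n + 1))) * volume (R 0) ≤
      volume (R n) := by
  induction n with
  | zero =>
    norm_num [stairWeight]
  | succ n ih =>
    rw [h.volume_succ]
    refine le_trans ?_ (Measure.le_iff.1 (h.pert n).lower _ (measurableSet_singleton _))
    rw [Measure.smul_apply, stepMeasure_singleton (h.atomic n) (h.notMem _), smul_eq_mul]
    obtain ⟨h1, h2⟩ := h.one_sub_eps_nonneg n
    have hβ := h.stairWeight_pos n
    have hγ := (h.mem_Ioo n).1.le
    have key : stairWeight γ (n + 1) * (1 / 2 + (1 / 2) ^ (n + 1 + 1)) ≤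
        (1 - ε * (1 / 2) ^ (n + 2)) * (stairWeight γ n * (1 / 2 + (1 / 2) ^ (n + 1))) * γ n := by
      rw [stairWeight_succ]
      calc stairWeight γ n * γ n * (1 / 2 + (1 / 2) ^ (n + 1 + 1))
          ≤ stairWeight γ n * γ n *
            ((1 / 2 + (1 / 2) ^ (n + 1)) * (1 - ε * (1 / 2) ^ (n + 2))) :=
            mul_le_mul_of_nonneg_left h1 (by positivity)
        _ = _ := by ring
    calc _ ≤ ENNReal.ofReal ((1 - ε * (1 / 2) ^ (n + 2)) *
          (stairWeight γ n * (1 / 2 + (1 / 2) ^ (n + 1))) * γ n) * volume (R 0) := by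
          gcongr ENNReal.ofReal ?_ * _
      _ = ENNReal.ofReal (1 - ε * (1 / 2) ^ (n + 2)) *
          (ENNReal.ofReal (stairWeight γ n * (1 / 2 + (1 / 2) ^ (n + 1))) * volume (R 0)) *
          ENNReal.ofReal (γ n) := by
          rw [ENNReal.ofReal_mul (by positivity), ENNReal.ofReal_mul h2]
          ring
      _ ≤ _ := by gcongr

theorem tendsto_volume (h : StairIteration K U X μ γ α q ε R ψ E) :
    Tendsto (fun n => volume (R n)) atTop (𝓝 0) := by
  have h1 : Tendsto (fun n => ENNReal.ofReal (stairWeight γ n) * volume (R 0)) atTop (𝓝 0) := by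
    have h2 : Tendsto (fun N => ENNReal.ofReal (stairWeight γ N)) atTop (𝓝 0) := by
      simpa using ENNReal.tendsto_ofReal h.tendsto
    simpa using ENNReal.Tendsto.mul_const h2 (Or.inr h.finite)
  exact tendsto_of_tendsto_of_tendsto_of_le_of_le tendsto_const_nhds h1 (fun _ => zero_le)
    h.volume_le

theorem ae_exists_notMem (h : StairIteration K U X μ γ α q ε R ψ E) :
    ∀ᵐ x ∂(volume : Measure (Euc m)), ∃ n, x ∉ R n := by
  have : volume (⋂ n, R n) = 0 := by
    refine le_antisymm (ge_of_tendsto' h.tendsto_volume fun n => ?_) zero_le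
    exact measure_mono (Set.iInter_subset _ n)
  filter_upwards [measure_eq_zero_iff_ae_notMem.1 this] with x hx
  simpa using hx

theorem ae_exists_mem_diff (h : StairIteration K U X μ γ α q ε R ψ E) :
    ∀ᵐ x ∂(volume : Measure (Euc m)), x ∈ R 0 → ∃ n, x ∈ R n ∧ x ∉ R (n + 1) := by
  filter_upwards [h.ae_exists_notMem] with x hx hx0
  by_contra hcon
  push Not at hcon
  obtain ⟨n, hn⟩ := hx
  refine hn ?_
  clear hn
  induction n with
  | zero => exact hx0
  | succ n ih => exact hcon n ih

/-- Outside `R (n + 1)` the limit map has reached its final gradient. -/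
theorem affineNear_of_mem_diff (h : StairIteration K U X μ γ α q ε R ψ E) (b : Euc d) (n : ℕ) :
    ∀ᵐ x ∂(volume : Measure (Euc m)), x ∈ R n → x ∉ R (n + 1) →
      AffineNear (stairLimit (X 0) b ψ) (X n + grad (ψ n) x) x ∧
      ∀ k > n, AffineNear (stairMap (X 0) b ψ k) (X n + grad (ψ n) x) x := by
  filter_upwards [(h.pert n).good] with x hx hxn hxs
  have h1 := (h.affineNear_stairMap b n x hxn).add (hx hxn).1
  rw [← stairMap_succ] at h1
  have h2 : ∀ᶠ y in 𝓝 x, y ∉ R (n + 1) := by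
    rw [h.succ] at hxs ⊢
    exact (hx hxn).eventually_notMem_levelRegion hxn hxs
  refine ⟨h1.congr ?_, fun k hk => h1.congr ?_⟩
  · filter_upwards [h2] with y hy using (h.stairLimit_eq b le_rfl hy).symm
  · filter_upwards [h2] with y hy
    rw [h.stairLimit_eq b le_rfl hy, h.stairLimit_eq b hk hy]

theorem ae_affineNear (h : StairIteration K U X μ γ α q ε R ψ E) (b : Euc d) :
    ∀ᵐ x ∂(volume : Measure (Euc m)), x ∈ R 0 →
      AffineNear (stairLimit (X 0) b ψ) (grad (stairLimit (X 0) b ψ) x) x := by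
  filter_upwards [h.ae_exists_mem_diff, ae_all_iff.2 (h.affineNear_of_mem_diff b)] with x h1 h2 hx
  obtain ⟨n, hn, hn'⟩ := h1 hx
  have := (h2 n hn hn').1
  rwa [this.grad_eq]

/-! ### Frozen regions and error sets -/

/-- The part of the domain on which the step `n` produces its final gradients in `K`. -/
def frozen (R E : ℕ → Set (Euc m)) (n : ℕ) : Set (Euc m) := (R n \ E n) \ R (n + 1)

theorem measurableSet_frozen (h : StairIteration K U X μ γ α q ε R ψ E) (n : ℕ) :
    MeasurableSet (frozen R E n) :=
  ((h.isOpen n).measurableSet.diff (h.pert n).measurableSet).diff (h.isOpen _).measurableSet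

theorem notMem_succ_of_mem_error (h : StairIteration K U X μ γ α q ε R ψ E) {n : ℕ} {x : Euc m}
    (hx : x ∈ E n) : x ∉ R (n + 1) := by
  rw [h.succ]
  exact fun h' => h'.2.1 hx

theorem ae_mem_frozen_or_error (h : StairIteration K U X μ γ α q ε R ψ E) :
    ∀ᵐ x ∂(volume : Measure (Euc m)), x ∈ R 0 → x ∈ (⋃ n, frozen R E n) ∪ ⋃ n, E n := by
  filter_upwards [h.ae_exists_mem_diff] with x hx hx0
  obtain ⟨n, hn, hn'⟩ := hx hx0
  by_cases hE : x ∈ E n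
  · exact Or.inr (Set.mem_iUnion.2 ⟨n, hE⟩)
  · exact Or.inl (Set.mem_iUnion.2 ⟨n, ⟨hn, hE⟩, hn'⟩)

theorem frozen_subset (h : StairIteration K U X μ γ α q ε R ψ E) :
    ⋃ n, frozen R E n ⊆ R 0 :=
  Set.iUnion_subset fun n _ hx => h.antitone (Nat.zero_le n) hx.1.1

theorem pairwise_disjoint_frozen (h : StairIteration K U X μ γ α q ε R ψ E) :
    Pairwise (Function.onFun Disjoint (frozen R E)) := by
  rw [pairwise_disjoint_on]
  intro i j hij
  refine Set.disjoint_left.2 fun x hx hx' => ?_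
  exact hx.2 (h.antitone (Nat.succ_le_of_lt hij) hx'.1.1)

/-- Later perturbations vanish near almost every frozen point, so the limit has there the gradient
produced in step `n`; the value `X (n + 1)` is removed because it continues in `R (n + 1)`. -/
theorem map_frozen (h : StairIteration K U X μ γ α q ε R ψ E) (b : Euc d) (n : ℕ) :
    (volume.restrict (frozen R E n)).map (grad (stairLimit (X 0) b ψ)) =
      (gradDist (R n) (X n) (ψ n) (E n)).restrict {X (n + 1)}ᶜ := by
  rw [← map_restrict_diff_levelRegion (h.pert n).good, ← h.succ]
  refine Measure.map_congr ((ae_restrict_iff' (h.measurableSet_frozen n)).2 ?_)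
  filter_upwards [h.affineNear_of_mem_diff b n] with x hx hxF
  exact (hx hxF.1.1 hxF.2).1.grad_eq

theorem map_frozen_le (h : StairIteration K U X μ γ α q ε R ψ E) (b : Euc d) (n : ℕ) :
    (volume.restrict (frozen R E n)).map (grad (stairLimit (X 0) b ψ)) ≤
      volume (R 0) • ENNReal.ofReal (stairWeight γ n * (1 - γ n)) • μ n := by
  rw [h.map_frozen b n]
  have h1 := Measure.restrict_mono (le_refl ({X (n + 1)}ᶜ : Set (Mat d m))) (h.pert n).upper
  rw [Measure.restrict_smul, stepMeasure_restrict (h.atomic n) (h.notMem _)] at h1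
  refine h1.trans (Measure.le_iff.2 fun S _ => ?_)
  simp only [Measure.smul_apply, smul_eq_mul]
  rw [ENNReal.ofReal_mul (h.stairWeight_pos n)]
  calc _ ≤ ENNReal.ofReal (stairWeight γ n) * volume (R 0) * (ENNReal.ofReal (1 - γ n) * μ n S) := by
        gcongr
        exact h.volume_le n
    _ = _ := by ring

/-- The loss of step `n` and those accumulated in `R n` still leave at least half of the ideal mass.
-/
theorem le_map_frozen (h : StairIteration K U X μ γ α q ε R ψ E) (b : Euc d) (n : ℕ) :
    (ENNReal.ofReal (1 / 2) * volume (R 0)) • ENNReal.ofReal (stairWeight γ n * (1 - γ n)) • μ n ≤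
      (volume.restrict (frozen R E n)).map (grad (stairLimit (X 0) b ψ)) := by
  rw [h.map_frozen b n]
  have h1 := Measure.restrict_mono (le_refl ({X (n + 1)}ᶜ : Set (Mat d m))) (h.pert n).lower
  rw [Measure.restrict_smul, stepMeasure_restrict (h.atomic n) (h.notMem _)] at h1
  refine le_trans (Measure.le_iff.2 fun S _ => ?_) h1
  simp only [Measure.smul_apply, smul_eq_mul]
  obtain ⟨h2, h3⟩ := h.one_sub_eps_nonneg n
  have h4 : (0 : ℝ) < (1 / 2) ^ (n + 2) := by positivity
  have hβ := h.stairWeight_pos n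
  calc _ = ENNReal.ofReal (1 / 2) * ENNReal.ofReal (stairWeight γ n) * volume (R 0) *
        (ENNReal.ofReal (1 - γ n) * μ n S) := by
        rw [ENNReal.ofReal_mul hβ]
        ring
    _ ≤ ENNReal.ofReal (1 - ε * (1 / 2) ^ (n + 2)) *
        (ENNReal.ofReal (stairWeight γ n * (1 / 2 + (1 / 2) ^ (n + 1))) * volume (R 0)) *
        (ENNReal.ofReal (1 - γ n) * μ n S) := by
        rw [← mul_assoc (ENNReal.ofReal (1 - _)), ← ENNReal.ofReal_mul h3,
          ← ENNReal.ofReal_mul (by norm_num)]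
        gcongr ENNReal.ofReal ?_ * _ * _
        calc (1 / 2 : ℝ) * stairWeight γ n ≤ ((1 / 2 + (1 / 2) ^ (n + 1)) *
              (1 - ε * (1 / 2) ^ (n + 2))) * stairWeight γ n :=
              mul_le_mul_of_nonneg_right (by linarith) hβ
          _ = _ := by ring
    _ ≤ _ := by
        gcongr
        exact h.le_volume n

theorem map_restrict_iUnion_frozen (h : StairIteration K U X μ γ α q ε R ψ E) (b : Euc d) :
    (volume.restrict (⋃ n, frozen R E n)).map (grad (stairLimit (X 0) b ψ)) =
      Measure.sum fun n => (volume.restrict (frozen R E n)).map (grad (stairLimit (X 0) b ψ)) := by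
  rw [Measure.restrict_iUnion h.pairwise_disjoint_frozen h.measurableSet_frozen,
    Measure.map_sum (measurable_grad _).aemeasurable]

theorem map_iUnion_frozen_le (h : StairIteration K U X μ γ α q ε R ψ E) (b : Euc d) :
    (volume.restrict (⋃ n, frozen R E n)).map (grad (stairLimit (X 0) b ψ)) ≤
      volume (R 0) • Measure.sum fun n => ENNReal.ofReal (stairWeight γ n * (1 - γ n)) • μ n := by
  rw [h.map_restrict_iUnion_frozen b]
  refine Measure.le_iff.2 fun S hS => ?_
  rw [Measure.sum_apply _ hS, Measure.smul_apply, Measure.sum_apply _ hS, smul_eq_mul,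
    ← ENNReal.tsum_mul_left]
  exact ENNReal.tsum_le_tsum fun n => Measure.le_iff.1 (h.map_frozen_le b n) S hS

theorem le_map_iUnion_frozen (h : StairIteration K U X μ γ α q ε R ψ E) (b : Euc d) :
    (ENNReal.ofReal (1 / 2) * volume (R 0)) •
      Measure.sum (fun n => ENNReal.ofReal (stairWeight γ n * (1 - γ n)) • μ n) ≤
    (volume.restrict (⋃ n, frozen R E n)).map (grad (stairLimit (X 0) b ψ)) := by
  rw [h.map_restrict_iUnion_frozen b]
  refine Measure.le_iff.2 fun S hS => ?_
  rw [Measure.sum_apply _ hS, Measure.smul_apply, Measure.sum_apply _ hS, smul_eq_mul,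
    ← ENNReal.tsum_mul_left]
  exact ENNReal.tsum_le_tsum fun n => Measure.le_iff.1 (h.le_map_frozen b n) S hS

/-- The frozen gradients of step `n` are distributed below a multiple of `μ n`, which lives on
finitely many points of `K`. This needs no measurability of `K`. -/
theorem ae_mem_of_frozen (h : StairIteration K U X μ γ α q ε R ψ E) (b : Euc d) :
    ∀ᵐ x ∂(volume : Measure (Euc m)), x ∈ (⋃ n, frozen R E n) →
      grad (stairLimit (X 0) b ψ) x ∈ K := by
  have key : ∀ n, ∀ᵐ x ∂(volume : Measure (Euc m)), x ∈ frozen R E n →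
      grad (stairLimit (X 0) b ψ) x ∈ K := by
    intro n
    obtain ⟨S, hS, hμ⟩ := (h.atomic n).measure_compl
    have hSm : MeasurableSet ((S : Set (Mat d m))ᶜ) := S.measurableSet.compl
    have h1 := Measure.le_iff.1 (h.map_frozen_le b n) _ hSm
    rw [Measure.smul_apply, Measure.smul_apply, hμ, smul_zero, smul_zero,
      Measure.map_apply (measurable_grad _) hSm,
      Measure.restrict_apply (measurable_grad _ hSm)] at h1
    filter_upwards [measure_eq_zero_iff_ae_notMem.1 (le_antisymm h1 zero_le)] with x hx hxF
    by_contra hcon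
    exact hx ⟨fun hmem => hcon (hS hmem), hxF⟩
  filter_upwards [ae_all_iff.2 key] with x hx hxU
  obtain ⟨n, hn⟩ := Set.mem_iUnion.1 hxU
  exact hx n hn

theorem ae_grad_error (h : StairIteration K U X μ γ α q ε R ψ E) (b : Euc d) (n : ℕ) :
    ∀ᵐ x ∂(volume : Measure (Euc m)), x ∈ E n →
      grad (stairLimit (X 0) b ψ) x = X n + grad (ψ n) x := by
  filter_upwards [h.affineNear_of_mem_diff b n] with x hx hxE
  exact (hx ((h.pert n).subset hxE) (h.notMem_succ_of_mem_error hxE)).1.grad_eq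

theorem ae_mem_of_error (h : StairIteration K U X μ γ α q ε R ψ E) (b : Euc d) :
    ∀ᵐ x ∂(volume : Measure (Euc m)), x ∈ (⋃ n, E n) → grad (stairLimit (X 0) b ψ) x ∈ U := by
  filter_upwards [ae_all_iff.2 (h.ae_grad_error b), ae_all_iff.2 fun n => (h.pert n).mem]
    with x h1 h2 hx
  obtain ⟨n, hn⟩ := Set.mem_iUnion.1 hx
  rw [h1 n hn]
  exact h2 n hn

theorem lintegral_error_le (h : StairIteration K U X μ γ α q ε R ψ E) (b : Euc d) :
    ∫⁻ x in ⋃ n, E n, ENNReal.ofReal ((1 + ‖grad (stairLimit (X 0) b ψ) x‖) ^ q) ≤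
      ENNReal.ofReal (ε / 2) * volume (R 0) := by
  have h1 : ∀ n, ∫⁻ x in E n, ENNReal.ofReal ((1 + ‖grad (stairLimit (X 0) b ψ) x‖) ^ q) ≤
      ENNReal.ofReal (ε * (1 / 2) ^ (n + 2)) * volume (R 0) := by
    intro n
    calc _ = ∫⁻ x in E n, ENNReal.ofReal ((1 + ‖X n + grad (ψ n) x‖) ^ q) := by
          refine lintegral_congr_ae ((ae_restrict_iff' (h.pert n).measurableSet).2 ?_)
          filter_upwards [h.ae_grad_error b n] with x hx hxE
          rw [hx hxE]
      _ ≤ _ := (h.pert n).small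
      _ ≤ _ := by
          gcongr
          exact h.antitone (Nat.zero_le n)
  refine (lintegral_iUnion_le _ _).trans ((ENNReal.tsum_le_tsum h1).trans ?_)
  rw [ENNReal.tsum_mul_right, ← ENNReal.ofReal_tsum_of_nonneg _ (hasSum_eps ε).summable,
    (hasSum_eps ε).tsum_eq]
  intro n
  have := h.eps.1
  positivity

end StairIteration

/-! ### Weak gradients -/

theorem setIntegral_eq_integral_of_tsupport_subset {Ω : Set (Euc m)} {φ : Euc m → ℝ}
    (hs : tsupport φ ⊆ Ω) {g : Euc m → ℝ} (hg : ∀ x, φ =ᶠ[𝓝 x] 0 → g x = 0) :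
    ∫ x in Ω, g x = ∫ x, g x :=
  setIntegral_eq_integral_of_forall_compl_eq_zero fun x hx =>
    hg x (notMem_tsupport_iff_eventuallyEq.1 fun h => hx (hs h))

/-- By Rademacher's theorem the pointwise gradient exists almost everywhere, and integration by
parts holds for Lipschitz functions. The support of `φ` allows passing from `Ω` to the whole space.
-/
theorem integral_mul_fderiv_of_lipschitz {Ω : Set (Euc m)} {w : Euc m → Euc d} {C : NNReal}
    (hw : LipschitzWith C w) {φ : Euc m → ℝ} (hφ : ContDiff ℝ ∞ φ) (hc : HasCompactSupport φ)
    (hs : tsupport φ ⊆ Ω) (i : Fin d) (j : Fin m) :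
    ∫ x in Ω, w x i * fderiv ℝ φ x (EuclideanSpace.single j 1) =
      - ∫ x in Ω, grad w x (i, j) * φ x := by
  have hwi : LipschitzWith C fun x => w x i := by
    refine LipschitzWith.of_dist_le_mul fun x y => ?_
    refine le_trans ?_ (hw.dist_le_mul x y)
    rw [dist_eq_norm, dist_eq_norm]
    simpa using PiLp.norm_apply_le (w x - w y) i
  obtain ⟨D, hD⟩ := ContDiff.lipschitzWith_of_hasCompactSupport hc hφ (by simp)
  have key := hwi.integral_lineDeriv_mul_eq (μ := volume) hD hc (EuclideanSpace.single j 1)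
  rw [setIntegral_eq_integral_of_tsupport_subset hs, setIntegral_eq_integral_of_tsupport_subset hs]
  · have h1 : ∫ x, lineDeriv ℝ (fun x => w x i) x (EuclideanSpace.single j 1) * φ x =
        ∫ x, grad w x (i, j) * φ x := by
      refine integral_congr_ae ?_
      filter_upwards [hw.ae_differentiableAt] with x hx
      have h2 : HasFDerivAt (fun x => w x i)
          ((EuclideanSpace.proj i : Euc d →L[ℝ] ℝ).comp (fderiv ℝ w x)) x :=
        (EuclideanSpace.proj i : Euc d →L[ℝ] ℝ).hasFDerivAt.comp x hx.hasFDerivAt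
      rw [(h2.hasLineDerivAt _).lineDeriv]
      rfl
    rw [h1] at key
    rw [key, ← integral_neg]
    refine integral_congr_ae (Eventually.of_forall fun x => ?_)
    simp only
    rw [((hφ.differentiable (by simp) x).hasFDerivAt.hasLineDerivAt _).lineDeriv, map_neg]
    ring
  · intro x hx
    rw [hx.eq_of_nhds]
    simp
  · intro x hx
    rw [hx.fderiv_eq]
    simp

namespace StairIteration

variable {K U : Set (Mat d m)} {X : ℕ → Mat d m} {μ : ℕ → Measure (Mat d m)} {γ : ℕ → ℝ}
  {α q ε : ℝ} {R : ℕ → Set (Euc m)} {ψ : ℕ → Euc m → Euc d} {E : ℕ → Set (Euc m)}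

theorem continuous_stairLimit (h : StairIteration K U X μ γ α q ε R ψ E) (b : Euc d) :
    Continuous (stairLimit (X 0) b ψ) := by
  refine Continuous.add ?_ (continuous_tsum (fun k => ?_) (hasSum_eps ε).summable
    fun k x => (h.pert k).sup x)
  · exact (linMap (X 0)).continuous.add continuous_const
  · obtain ⟨C, hC⟩ := (h.pert k).lipschitz
    exact hC.continuous

/-- The seminorms of the perturbations sum to ε / 2. For the linear part, boundedness of `S` trades
|x - y| for |x - y| ^ α. -/
theorem holder_stairLimit (h : StairIteration K U X μ γ α q ε R ψ E) (b : Euc d)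
    (hα : α ∈ Set.Ioo (0 : ℝ) 1) {S : Set (Euc m)} (hS : Bornology.IsBounded S) :
    IsHolderOn α S (stairLimit (X 0) b ψ) := by
  refine ⟨‖linMap (X 0)‖ * Metric.diam S ^ (1 - α) + ε / 2, fun x hx y hy => ?_⟩
  have h1 : ‖∑' k, ψ k x - ∑' k, ψ k y‖ ≤ ε / 2 * ‖x - y‖ ^ α := by
    rw [← (h.summable x).tsum_sub (h.summable y)]
    exact tsum_of_norm_bounded ((hasSum_eps ε).mul_right _) fun k => (h.pert k).holder x y
  have h2 : ‖linMap (X 0) (x - y)‖ ≤ ‖linMap (X 0)‖ * Metric.diam S ^ (1 - α) * ‖x - y‖ ^ α := by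
    refine ((linMap (X 0)).le_opNorm _).trans ?_
    rw [mul_assoc]
    gcongr
    rcases eq_or_ne x y with rfl | hxy
    · simp only [sub_self, norm_zero]
      positivity
    have hpos : 0 < ‖x - y‖ := norm_pos_iff.2 (sub_ne_zero.2 hxy)
    calc ‖x - y‖ = ‖x - y‖ ^ (1 - α) * ‖x - y‖ ^ α := by
          rw [← Real.rpow_add hpos]
          simp
      _ ≤ _ := by
          have h3 : 0 ≤ 1 - α := by linarith [hα.2]
          gcongr
          rw [← dist_eq_norm]
          exact Metric.dist_le_diam_of_mem hS hx hy
  have h4 : stairLimit (X 0) b ψ x - stairLimit (X 0) b ψ y =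
      linMap (X 0) (x - y) + (∑' k, ψ k x - ∑' k, ψ k y) := by
    rw [stairLimit, stairLimit, affineFun_eq, affineFun_eq, map_sub]
    abel
  rw [h4, add_mul]
  exact (norm_add_le _ _).trans (add_le_add h2 h1)

theorem norm_stairMap_le (h : StairIteration K U X μ γ α q ε R ψ E) (b : Euc d) (n : ℕ)
    (x : Euc m) : ‖stairMap (X 0) b ψ n x‖ ≤ ‖affineFun (X 0) b x‖ + ε / 2 := by
  refine (norm_add_le _ _).trans (add_le_add le_rfl ?_)
  have hε := h.eps.1
  calc _ ≤ ∑ k ∈ Finset.range n, ‖ψ k x‖ := norm_sum_le _ _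
    _ ≤ ∑ k ∈ Finset.range n, ε * (1 / 2) ^ (k + 2) :=
        Finset.sum_le_sum fun k _ => (h.pert k).sup x
    _ ≤ ε / 2 := sum_le_hasSum _ (fun k _ => by positivity) (hasSum_eps ε)

theorem measurableSet_error (h : StairIteration K U X μ γ α q ε R ψ E) :
    MeasurableSet (⋃ n, E n) := MeasurableSet.iUnion fun n => (h.pert n).measurableSet

/-- On the frozen part the gradient distribution is below a multiple of the staircase laminate,
which has a first moment. On the error set |G| ≤ (1 + |G|) ^ q. -/
theorem integrableOn_grad (h : StairIteration K U X μ γ α q ε R ψ E) (b : Euc d) (hq : 1 ≤ q)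
    (hint : Integrable (fun Y : Mat d m => Y)
      (Measure.sum fun n => ENNReal.ofReal (stairWeight γ n * (1 - γ n)) • μ n)) :
    IntegrableOn (grad (stairLimit (X 0) b ψ)) (R 0) volume := by
  set G := grad (stairLimit (X 0) b ψ) with hG
  have hGm : Measurable G := measurable_grad _
  have h1 : IntegrableOn G (⋃ n, frozen R E n) volume := by
    have h2 : Integrable (fun Y : Mat d m => Y)
        ((volume.restrict (⋃ n, frozen R E n)).map G) :=
      (hint.smul_measure h.finite).mono_measure (h.map_iUnion_frozen_le b)
    exact (integrable_map_measure h2.aestronglyMeasurable hGm.aemeasurable).1 h2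
  have h3 : IntegrableOn G (⋃ n, E n) volume := by
    refine ⟨hGm.aestronglyMeasurable, ?_⟩
    refine lt_of_le_of_lt ?_ ((h.lintegral_error_le b).trans_lt
      (ENNReal.mul_lt_top ENNReal.ofReal_lt_top h.finite.lt_top))
    refine lintegral_mono fun x => ?_
    rw [← ofReal_norm]
    refine ENNReal.ofReal_le_ofReal ?_
    have h4 : 1 ≤ 1 + ‖G x‖ := by linarith [norm_nonneg (G x)]
    calc ‖G x‖ ≤ (1 + ‖G x‖) ^ (1 : ℝ) := by rw [Real.rpow_one]; linarith
      _ ≤ _ := Real.rpow_le_rpow_of_exponent_le h4 hq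
  refine (h1.union h3).mono_set_ae ?_
  filter_upwards [h.ae_mem_frozen_or_error] with x hx using hx

theorem tendsto_stairMap (h : StairIteration K U X μ γ α q ε R ψ E) (b : Euc d) (x : Euc m) :
    Tendsto (fun n => stairMap (X 0) b ψ n x) atTop (𝓝 (stairLimit (X 0) b ψ x)) :=
  (h.summable x).hasSum.tendsto_sum_nat.const_add _

/-- The integration by parts formula holds for the Lipschitz partial sums and passes to the limit by
dominated convergence, up to the term from `R n`. -/
theorem isW11 (h : StairIteration K U X μ γ α q ε R ψ E) (b : Euc d) (hq : 1 ≤ q)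
    (hb : Bornology.IsBounded (R 0))
    (hint : Integrable (fun Y : Mat d m => Y)
      (Measure.sum fun n => ENNReal.ofReal (stairWeight γ n * (1 - γ n)) • μ n))
    (hX : Tendsto (fun n => stairWeight γ n • X n) atTop (𝓝 0)) :
    IsW11WithGradient (R 0) (stairLimit (X 0) b ψ) (grad (stairLimit (X 0) b ψ)) := by
  have hGint := h.integrableOn_grad b hq hint
  refine ⟨((h.continuous_stairLimit b).continuousOn.integrableOn_compact
    hb.isCompact_closure).mono_set subset_closure, hGint, ?_⟩
  intro φ hφ hc hs i j
  set w := stairLimit (X 0) b ψ with hw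
  set G := grad w with hG
  set e : Euc m := EuclideanSpace.single j 1 with he
  have hφc : Continuous φ := hφ.continuous
  have hdc : Continuous fun x => fderiv ℝ φ x e :=
    (hφ.continuous_fderiv (by simp)).clm_apply continuous_const
  have hdcs : HasCompactSupport fun x => fderiv ℝ φ x e := hc.fderiv_apply ℝ e
  obtain ⟨B, hB⟩ := hc.exists_bound_of_continuous hφc
  have hB0 : 0 ≤ B := (norm_nonneg _).trans (hB 0)
  -- Convergence of the left-hand sides.
  have hL : Tendsto (fun n => ∫ x in R 0, stairMap (X 0) b ψ n x i * fderiv ℝ φ x e) atTop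
      (𝓝 (∫ x in R 0, w x i * fderiv ℝ φ x e)) := by
    refine tendsto_integral_of_dominated_convergence
      (fun x => (‖affineFun (X 0) b x‖ + ε / 2) * ‖fderiv ℝ φ x e‖) (fun n => ?_) ?_ (fun n => ?_) ?_
    · obtain ⟨C, hC⟩ := h.lipschitz_stairMap b n
      have : Continuous fun x => stairMap (X 0) b ψ n x i :=
        (continuous_apply i).comp ((PiLp.continuous_ofLp 2 _).comp hC.continuous)
      exact (this.mul hdc).aestronglyMeasurable
    · have h1 : Continuous fun x => (‖affineFun (X 0) b x‖ + ε / 2) * ‖fderiv ℝ φ x e‖ :=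
        ((((linMap (X 0)).continuous.add continuous_const).norm).add continuous_const).mul hdc.norm
      exact (h1.integrable_of_hasCompactSupport hdcs.norm.mul_left).integrableOn
    · refine Eventually.of_forall fun x => ?_
      rw [norm_mul]
      gcongr
      exact (PiLp.norm_apply_le _ i).trans (h.norm_stairMap_le b n x)
    · refine Eventually.of_forall fun x => ?_
      refine Tendsto.mul_const _ ?_
      exact (((continuous_apply i).comp (PiLp.continuous_ofLp 2 _)).tendsto _).comp
        (h.tendsto_stairMap b x)
  -- Convergence of the right-hand sides.
  have hGij : IntegrableOn (fun x => G x (i, j) * φ x) (R 0) volume := by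
    have h1 : IntegrableOn (fun x => G x (i, j)) (R 0) volume :=
      (EuclideanSpace.proj (i, j) : Mat d m →L[ℝ] ℝ).integrable_comp hGint
    exact h1.mul_bdd hφc.aestronglyMeasurable (Eventually.of_forall hB)
  -- The n-th partial sum already has the limit gradient off `R n` and has gradient `X n` on it.
  have hsplit : ∀ n, ∫ x in R 0, grad (stairMap (X 0) b ψ n) x (i, j) * φ x =
      (∫ x in R 0, (R n)ᶜ.indicator (fun x => G x (i, j) * φ x) x) +
        ∫ x in R n, X n (i, j) * φ x := by
    intro n
    have hRn := (h.isOpen n).measurableSet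
    have hXint : IntegrableOn (fun x => X n (i, j) * φ x) (R 0) volume :=
      ((hφc.integrable_of_hasCompactSupport hc).const_mul _).integrableOn
    have h2 : ∫ x in R n, X n (i, j) * φ x =
        ∫ x in R 0, (R n).indicator (fun x => X n (i, j) * φ x) x := by
      rw [setIntegral_indicator hRn, Set.inter_eq_right.2 (h.antitone (Nat.zero_le n))]
    rw [h2, ← integral_add (hGij.indicator hRn.compl) (hXint.indicator hRn)]
    refine integral_congr_ae ((ae_restrict_iff' (h.isOpen 0).measurableSet).2 ?_)
    filter_upwards [h.ae_exists_mem_diff, ae_all_iff.2 (h.affineNear_of_mem_diff b)] with x h3 h4 h5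
    by_cases hx : x ∈ R n
    · rw [Set.indicator_of_notMem (by simpa using hx), Set.indicator_of_mem hx, zero_add,
        (h.affineNear_stairMap b n x hx).grad_eq]
    · rw [Set.indicator_of_mem (by simpa using hx), Set.indicator_of_notMem hx, add_zero]
      obtain ⟨k, hk, hk'⟩ := h3 h5
      have hkn : k < n := by
        by_contra hcon
        exact hx (h.antitone (not_lt.1 hcon) hk)
      obtain ⟨h6, h7⟩ := h4 k hk hk'
      rw [(h7 n hkn).grad_eq, hG, h6.grad_eq]
  have hR1 : Tendsto (fun n => ∫ x in R 0, (R n)ᶜ.indicator (fun x => G x (i, j) * φ x) x) atTop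
      (𝓝 (∫ x in R 0, G x (i, j) * φ x)) := by
    refine tendsto_integral_of_dominated_convergence (fun x => ‖G x (i, j) * φ x‖)
      (fun n => ?_) hGij.norm (fun n => ?_) ?_
    · exact (hGij.indicator (h.isOpen n).measurableSet.compl).aestronglyMeasurable
    · exact Eventually.of_forall fun x => norm_indicator_le_norm_self _ _
    · refine ae_restrict_of_ae ?_
      filter_upwards [h.ae_exists_notMem] with x hx
      obtain ⟨n, hn⟩ := hx
      refine tendsto_const_nhds.congr' ?_
      filter_upwards [eventually_ge_atTop n] with k hk
      rw [Set.indicator_of_mem]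
      exact fun hxk => hn (h.antitone hk hxk)
  -- The term is at most |X n| sup|φ| |R n| ≤ |β_n X n| sup|φ| |Ω|, which tends to 0 by the
  -- barycenter condition.
  have hR2 : Tendsto (fun n => ∫ x in R n, X n (i, j) * φ x) atTop (𝓝 0) := by
    have h1 : Tendsto (fun n => ‖stairWeight γ n • X n‖ * B * (volume (R 0)).toReal) atTop
        (𝓝 0) := by
      have := ((hX.norm).mul_const B).mul_const (volume (R 0)).toReal
      simpa using this
    refine squeeze_zero_norm (fun n => ?_) h1
    have hβ := h.stairWeight_pos n
    have hfin : volume (R n) < ⊤ :=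
      (measure_mono (h.antitone (Nat.zero_le n))).trans_lt h.finite.lt_top
    have hv : (volume (R n)).toReal ≤ stairWeight γ n * (volume (R 0)).toReal := by
      have := ENNReal.toReal_mono (ENNReal.mul_ne_top ENNReal.ofReal_ne_top h.finite) (h.volume_le n)
      rwa [ENNReal.toReal_mul, ENNReal.toReal_ofReal hβ] at this
    calc ‖∫ x in R n, X n (i, j) * φ x‖ ≤ (‖X n‖ * B) * (volume (R n)).toReal := by
          refine norm_setIntegral_le_of_norm_le_const hfin fun x _ => ?_
          rw [norm_mul]
          exact mul_le_mul (PiLp.norm_apply_le _ _) (hB x) (norm_nonneg _) (norm_nonneg _)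
      _ ≤ (‖X n‖ * B) * (stairWeight γ n * (volume (R 0)).toReal) := by gcongr
      _ = _ := by
          rw [norm_smul, Real.norm_of_nonneg hβ]
          ring
  have hR : Tendsto (fun n => - ∫ x in R 0, grad (stairMap (X 0) b ψ n) x (i, j) * φ x) atTop
      (𝓝 (- ∫ x in R 0, G x (i, j) * φ x)) := by
    have := (hR1.add hR2).neg
    rw [add_zero] at this
    exact this.congr fun n => by rw [hsplit n]
  refine tendsto_nhds_unique hL (hR.congr fun n => ?_)
  obtain ⟨C, hC⟩ := h.lipschitz_stairMap b n
  exact (integral_mul_fderiv_of_lipschitz hC hφ hc hs i j).symm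

end StairIteration

/-! ### The reduction -/

/-- The same map serves both notions of reducibility: its lower tail is stated in terms of `ν`, so
that a lower bound for `ν` can be inserted afterwards. -/
theorem exists_isReduction {K U : Set (Mat d m)} (hU : IsOpen U) {p : ℝ} (hp : 1 < p) {M : ℝ}
    (hM : 1 ≤ M) {X₀ : Mat d m} {ν : Measure (Mat d m)} (hν : IsStaircaseLaminate K U X₀ ν)
    (hbar : HasBarycenter ν X₀)
    (htail : ∀ t : ℝ, 0 < t →
      ν {X | t < ‖X‖} ≤ ENNReal.ofReal (M ^ p * (1 + ‖X₀‖ ^ p) * t ^ (-p)))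
    (b : Euc d) {ε α q : ℝ} (hε : ε ∈ Set.Ioo (0 : ℝ) 1) (hα : α ∈ Set.Ioo (0 : ℝ) 1)
    {Ω : Set (Euc m)} (hΩ : IsRegularDomain Ω) :
    ∃ (w : Euc m → Euc d) (G : Euc m → Mat d m), IsReduction K U p (2 * M) X₀ b ε α q Ω w G ∧
      ∀ t : ℝ, ENNReal.ofReal (1 / 2) * volume Ω * ν {X | t < ‖X‖} ≤
        volume {x ∈ Ω | t < ‖G x‖} := by
  obtain ⟨X, μ, γ, hX0, -, hXK, hμ, hγ, hlam, -, -, hβ, hlim⟩ := hν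
  have hsum := eq_sum_of_tendsto_stairMeasure hβ hlim
  have hfin : volume Ω ≠ ⊤ := hΩ.isBounded.measure_lt_top.ne
  have hpos : volume Ω ≠ 0 := (hΩ.isOpen.measure_pos volume hΩ.isConnected.nonempty).ne'
  -- The exponent p is included so that Chebyshev's inequality bounds the tail of the error set by t
  -- ^ (-p).
  set q' := max q p with hq'
  have hq1 : 1 ≤ q' := hp.le.trans (le_max_right _ _)
  obtain ⟨R, ψ, E, hR0, h⟩ := exists_stairIteration (d := d) hU hXK hμ hγ hβ hlam hα
    (zero_le_one.trans hq1) hε hΩ.isOpen hfin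
  subst hX0
  rw [hsum] at hbar
  have hXβ := tendsto_stairWeight_smul hμ hγ hlam hbar
  set w := stairLimit (X 0) b ψ with hw
  set G := grad w with hG
  have hGm : Measurable G := measurable_grad w
  have hset : ∀ t : ℝ, MeasurableSet {Y : Mat d m | t < ‖Y‖} := fun t =>
    (isOpen_lt continuous_const continuous_norm).measurableSet
  have herr : ∀ t : ℝ, 0 < t → volume {x | x ∈ (⋃ n, E n) ∧ t < ‖G x‖} ≤
      ENNReal.ofReal (t ^ (-p)) * (ENNReal.ofReal (ε / 2) * volume Ω) := by
    intro t ht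
    have hm : MeasurableSet {x | x ∈ (⋃ n, E n) ∧ t < ‖G x‖} :=
      h.measurableSet_error.inter (hGm (hset t))
    calc volume {x | x ∈ (⋃ n, E n) ∧ t < ‖G x‖}
        = ∫⁻ _ in {x | x ∈ (⋃ n, E n) ∧ t < ‖G x‖}, 1 := by rw [setLIntegral_one]
      _ ≤ ∫⁻ x in {x | x ∈ (⋃ n, E n) ∧ t < ‖G x‖},
            ENNReal.ofReal (t ^ (-p)) * ENNReal.ofReal ((1 + ‖G x‖) ^ q') := by
          refine setLIntegral_mono' hm fun x hx => ?_
          rw [← ENNReal.ofReal_mul (by positivity), ← ENNReal.ofReal_one]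
          refine ENNReal.ofReal_le_ofReal ?_
          have h1 : 1 ≤ 1 + ‖G x‖ := by linarith [norm_nonneg (G x)]
          calc 1 = t ^ (-p) * t ^ p := by rw [← Real.rpow_add ht]; simp
            _ ≤ t ^ (-p) * (1 + ‖G x‖) ^ q' := by
              gcongr
              calc t ^ p ≤ (1 + ‖G x‖) ^ p :=
                    Real.rpow_le_rpow ht.le (by linarith [hx.2]) (by linarith)
                _ ≤ _ := Real.rpow_le_rpow_of_exponent_le h1 (le_max_right _ _)
      _ ≤ ∫⁻ x in ⋃ n, E n, ENNReal.ofReal (t ^ (-p)) * ENNReal.ofReal ((1 + ‖G x‖) ^ q') :=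
          lintegral_mono_set fun x hx => hx.1
      _ = ENNReal.ofReal (t ^ (-p)) * ∫⁻ x in ⋃ n, E n, ENNReal.ofReal ((1 + ‖G x‖) ^ q') :=
          lintegral_const_mul' _ _ ENNReal.ofReal_ne_top
      _ ≤ _ := by
          gcongr
          rw [← hR0]
          exact h.lintegral_error_le b
  have hmap : ∀ t : ℝ, (volume.restrict (⋃ n, StairIteration.frozen R E n)).map G {Y | t < ‖Y‖} =
      volume {x | t < ‖G x‖ ∧ x ∈ ⋃ n, StairIteration.frozen R E n} := fun t => by
    rw [Measure.map_apply hGm (hset t), Measure.restrict_apply (hGm (hset t))]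
    rfl
  have hinE : ∀ᵐ x ∂(volume : Measure (Euc m)), x ∈ {x ∈ Ω | G x ∉ K} → x ∈ ⋃ n, E n := by
    filter_upwards [h.ae_mem_frozen_or_error, h.ae_mem_of_frozen b] with x h1 h2 h3
    rcases h1 (hR0 ▸ h3.1) with h4 | h4
    · exact absurd (h2 h4) h3.2
    · exact h4
  refine ⟨w, G, ⟨?_, ?_, ?_, ?_, ?_, ?_, ?_⟩, ?_⟩
  · have := h.isW11 b hq1 (hR0 ▸ hΩ.isBounded) hbar.1 hXβ
    rwa [hR0] at this
  · exact h.holder_stairLimit b hα hΩ.isBounded.closure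
  · have := h.ae_affineNear b
    rw [hR0] at this
    exact isPiecewiseAffine_of_ae hΩ.isOpen this
  · intro x hx
    have hxR : x ∉ R 0 := by
      rw [hR0]
      rw [hΩ.isOpen.frontier_eq] at hx
      exact hx.2
    rw [hw, stairLimit, tsum_congr fun k => h.eq_zero (Nat.zero_le k) hxR, tsum_zero, add_zero]
  · intro t ht
    have hsub : ({x ∈ Ω | t < ‖G x‖} : Set (Euc m)) ≤ᵐ[volume]
        ({x | t < ‖G x‖ ∧ x ∈ ⋃ n, StairIteration.frozen R E n} ∪
          {x | x ∈ (⋃ n, E n) ∧ t < ‖G x‖} : Set (Euc m)) := by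
      filter_upwards [h.ae_mem_frozen_or_error] with x h1 h2
      rcases h1 (hR0 ▸ h2.1) with h4 | h4
      · exact Or.inl ⟨h2.2, h4⟩
      · exact Or.inr ⟨h4, h2.2⟩
    have h1 := Measure.le_iff.1 (h.map_iUnion_frozen_le b) _ (hset t)
    rw [hmap, Measure.smul_apply, ← hsum, hR0, smul_eq_mul] at h1
    have hM0 : 0 < M := by linarith
    have htp : 0 ≤ t ^ (-p) := by positivity
    have hMp : 1 ≤ M ^ p := Real.one_le_rpow hM (by linarith)
    have hXp : 0 ≤ ‖X 0‖ ^ p := by positivity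
    have h2p : 2 ≤ (2 : ℝ) ^ p := by
      calc (2 : ℝ) = 2 ^ (1 : ℝ) := by simp
        _ ≤ 2 ^ p := Real.rpow_le_rpow_of_exponent_le (by norm_num) hp.le
    calc volume {x ∈ Ω | t < ‖G x‖} ≤ _ := measure_mono_ae hsub
      _ ≤ _ := measure_union_le _ _
      _ ≤ volume Ω * ENNReal.ofReal (M ^ p * (1 + ‖X 0‖ ^ p) * t ^ (-p)) +
          ENNReal.ofReal (t ^ (-p)) * (ENNReal.ofReal (ε / 2) * volume Ω) := by
          refine add_le_add (h1.trans ?_) (herr t ht)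
          gcongr
          exact htail t ht
      _ = ENNReal.ofReal (M ^ p * (1 + ‖X 0‖ ^ p) * t ^ (-p) + t ^ (-p) * (ε / 2)) *
          volume Ω := by
          rw [ENNReal.ofReal_add (by positivity) (mul_nonneg htp (by linarith [hε.1])),
            ENNReal.ofReal_mul htp]
          ring
      _ ≤ _ := by
          gcongr ENNReal.ofReal ?_ * _
          rw [Real.mul_rpow (by norm_num) hM0.le]
          have h3 : 1 ≤ M ^ p * (1 + ‖X 0‖ ^ p) := by nlinarith
          -- The error adds at most ε / 2 to a constant that is at least 1; the factor 2 ^ p ≥ 2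
          -- from doubling `M` absorbs it.
          have h4 : M ^ p * (1 + ‖X 0‖ ^ p) + ε / 2 ≤ 2 ^ p * (M ^ p * (1 + ‖X 0‖ ^ p)) := by
            nlinarith [hε.2]
          calc _ = (M ^ p * (1 + ‖X 0‖ ^ p) + ε / 2) * t ^ (-p) := by ring
            _ ≤ 2 ^ p * (M ^ p * (1 + ‖X 0‖ ^ p)) * t ^ (-p) := by gcongr
            _ = _ := by ring
  · filter_upwards [hinE, h.ae_mem_of_error b] with x h1 h2 h3 h4
    exact h2 (h1 ⟨h3, h4⟩)
  · calc ∫⁻ x in {x ∈ Ω | G x ∉ K}, ENNReal.ofReal ((1 + ‖G x‖) ^ q)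
        ≤ ∫⁻ x in ⋃ n, E n, ENNReal.ofReal ((1 + ‖G x‖) ^ q) := lintegral_mono_set' hinE
      _ ≤ ∫⁻ x in ⋃ n, E n, ENNReal.ofReal ((1 + ‖G x‖) ^ q') := by
          refine lintegral_mono fun x => ENNReal.ofReal_le_ofReal ?_
          exact Real.rpow_le_rpow_of_exponent_le (by linarith [norm_nonneg (G x)]) (le_max_left _ _)
      _ ≤ ENNReal.ofReal (ε / 2) * volume Ω := by
          rw [← hR0]
          exact h.lintegral_error_le b
      _ < ENNReal.ofReal ε * volume Ω := by
          refine ENNReal.mul_lt_mul_left hpos hfin ?_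
          exact (ENNReal.ofReal_lt_ofReal_iff hε.1).2 (by linarith [hε.1])
  · intro t
    have h1 := Measure.le_iff.1 (h.le_map_iUnion_frozen b) _ (hset t)
    rw [hmap, Measure.smul_apply, ← hsum, hR0, smul_eq_mul] at h1
    refine h1.trans (measure_mono fun x hx => ⟨hR0 ▸ h.frozen_subset hx.2, hx.1⟩)

end StaircaseLaminate

theorem theorem1p3 {d m : ℕ} (K U : Set (StaircaseLaminate.Mat d m)) (hU : IsOpen U)
    (p : ℝ) (hp : 1 < p) (M : ℝ) (hM : 1 ≤ M) (c : ℝ) (hc : 0 < c) :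
    ((∀ X₀ ∈ U, ∃ ν : Measure (StaircaseLaminate.Mat d m),
        StaircaseLaminate.IsStaircaseLaminate K U X₀ ν ∧
        StaircaseLaminate.HasBarycenter ν X₀ ∧
        ∀ t : ℝ, 0 < t →
          ν {X | t < ‖X‖} ≤ ENNReal.ofReal (M ^ p * (1 + ‖X₀‖ ^ p) * t ^ (-p))) →
      StaircaseLaminate.Reducible U K p) ∧
    ((∀ X₀ ∈ U, ∃ ν : Measure (StaircaseLaminate.Mat d m),
        StaircaseLaminate.IsStaircaseLaminate K U X₀ ν ∧
        StaircaseLaminate.HasBarycenter ν X₀ ∧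
        (∀ t : ℝ, 0 < t →
          ν {X | t < ‖X‖} ≤ ENNReal.ofReal (M ^ p * (1 + ‖X₀‖ ^ p) * t ^ (-p))) ∧
        (∀ t : ℝ, 1 < t →
          ENNReal.ofReal (c ^ p * t ^ (-p)) ≤ ν {X | t < ‖X‖})) →
      StaircaseLaminate.ExactlyReducible U K p) := by
  refine ⟨fun H => ⟨2 * M, by linarith, fun X₀ hX₀ b ε α q hε hα _ Ω hΩ => ?_⟩,
    fun H => ⟨2 * M, by linarith, c / 2, by positivity, fun X₀ hX₀ b ε α q hε hα _ Ω hΩ => ?_⟩⟩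
  · obtain ⟨ν, hν, hbar, htail⟩ := H X₀ hX₀
    obtain ⟨w, G, h, -⟩ := StaircaseLaminate.exists_isReduction hU hp hM hν hbar htail b hε hα hΩ
    exact ⟨w, G, h⟩
  · obtain ⟨ν, hν, hbar, htail, hlow⟩ := H X₀ hX₀
    obtain ⟨w, G, h, h'⟩ := StaircaseLaminate.exists_isReduction hU hp hM hν hbar htail b hε hα hΩ
    refine ⟨w, G, h, fun t ht => le_trans ?_ (h' t)⟩
    have htp : 0 ≤ t ^ (-p) := by positivity
    -- Half of the mass of `ν` is retained, and halving `c` pays for this because 2 ^ p ≥ 2.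
    have hle : (c / 2) ^ p * t ^ (-p) ≤ 1 / 2 * (c ^ p * t ^ (-p)) := by
      have h2p : (2 : ℝ) ≤ 2 ^ p := by
        calc (2 : ℝ) = 2 ^ (1 : ℝ) := by simp
          _ ≤ 2 ^ p := Real.rpow_le_rpow_of_exponent_le (by norm_num) hp.le
      have hcp : 0 ≤ c ^ p := by positivity
      rw [Real.div_rpow hc.le (by norm_num), ← mul_assoc]
      gcongr
      rw [div_le_iff₀ (by positivity)]
      nlinarith
    calc ENNReal.ofReal ((c / 2) ^ p * t ^ (-p)) * volume Ω
        ≤ ENNReal.ofReal (1 / 2 * (c ^ p * t ^ (-p))) * volume Ω := by gcongr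
      _ = ENNReal.ofReal (1 / 2) * volume Ω * ENNReal.ofReal (c ^ p * t ^ (-p)) := by
          rw [ENNReal.ofReal_mul (by norm_num)]
          ring
      _ ≤ _ := by
          gcongr
          exact hlow t ht
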